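/- All topological spaces are compactly generated (no separation axiom is imposed unless stated); $\mathsf{Top}$ is the category of such spaces with the topology of open coverings, and products and fibre products are taken in $\mathsf{Top}$. A map $f\colon E\to B$ is a local Hurewicz fibration if every $x\in E$ has an open neighbourhood $U$, and $f(x)$ an open neighbourhood $V$, such that $f(U)\subseteq V$ and $f|_U\colon U\to V$ is a Hurewicz fibration. Dually, $i\colon A\to Y$ is a local cofibration if every $a\in A$ has an open neighbourhood $U$, and $i(a)$ an open neighbourhood $V$, such that $i(U)\subseteq V$ and $i|_U\colon U\to V$ is a Hurewicz cofibration. A topological stack is a stack $\mathfrak X$ over $\mathsf{Top}$ equivalent to the quotient stack $[X_0/X_1]$ (the stack of torsors) of a topological groupoid $X_1\rightrightarrows X_0$ whose source and target maps are local Hurewicz fibrations. For a space $T$, $\mathfrak X(T)=\operatorname{Hom}(T,\mathfrak X)$ is the groupoid of morphisms of stacks $T\to\mathfrak X$. For a space $Y$, the mapping stack $\operatorname{Map}(Y,\mathfrak X)$ is $T\mapsto\operatorname{Hom}(T\times Y,\mathfrak X)$; $\mathrm L\mathfrak X=\operatorname{Map}(S^1,\mathfrak X)$ is the loop stack and $\operatorname{ev}_0\colon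 \mathrm L\mathfrak X\to\mathfrak X$ is evaluation at the base point $0\in S^1$. A square of stacks is 2-cartesian if for every space $T$ the square of groupoids of $T$-points is 2-cartesian. (1) Let $A\to Y$ be a closed embedding of Hausdorff spaces which is a local cofibration, let $A\to Z$ be a proper map of Hausdorff spaces with finite fibres, and let $Z\vee_A Y$ be the pushout in the category of topological spaces. Then this pushout remains a pushout in the 2-category of topological stacks: for every topological stack $\mathfrak X$ the functor $$\mathfrak X(Z\vee_A Y)\longrightarrow \mathfrak X(Z)\times_{\mathfrak X(A)}\mathfrak X(Y)$$ to the 2-fibre product is an equivalence of groupoids. (2) For $A$, $Y$, $Z$ as in (1) and every topological stack $\mathfrak X$, the square with corners $\operatorname{Map}(Z\vee_A Y,\mathfrak X)$, $\operatorname{Map}(Y,\mathfrak X)$, $\operatorname{Map}(Z,\mathfrak X)$, $\operatorname{Map}(A,\mathfrak X)$ given by restriction is 2-cartesian. (3) For every topological stack $\mathfrak X$, the square $$\begin{array}{ccc}\operatorname{Map}(S^1\vee S^1,\mathfrak X)&\longrightarrow&\mathrm L\mathfrak X\\ \downarrow&&\downarrow{\scriptstyle \operatorname{ev}_0}\\ \mathrm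 L\mathfrak X&\xrightarrow{\ \operatorname{ev}_0\ }&\mathfrak X\end{array}$$ given by restriction to the two circles is 2-cartesian; that is, $\operatorname{Map}(S^1\vee S^1,\mathfrak X)\simeq \mathrm L\mathfrak X\times_{\mathfrak X}\mathrm L\mathfrak X$. -/

import Mathlib

universe u v w

open CategoryTheory Topology

namespace TopStack

/-! ## The site of compactly generated spaces -/

/-- The category of compactly generated topological spaces (no separation axiom is imposed),
written `Top` in the literature on topological stacks. -/
abbrev CGTop := CompactlyGenerated.{u, u}

/-- The space `X` retopologized by the compactly generated topology: the final topology for all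
continuous maps from compact Hausdorff spaces to `X`. Products and fibre products of compactly
generated spaces are formed by applying this to the usual ones. -/
@[ext]
structure Kify (X : Type u) : Type u where
  /-- The underlying point of `X`. -/
  val : X

section Kify

variable {X Y : Type u} [TopologicalSpace X] [TopologicalSpace Y]

instance : TopologicalSpace (Kify X) :=
  TopologicalSpace.coinduced Kify.mk (TopologicalSpace.compactlyGenerated.{u} X)

theorem Kify.continuous_of_test (f : Kify X → Y)
    (h : ∀ (S : CompHaus.{u}) (g : C(S, X)), Continuous (fun s => f ⟨g s⟩)) : Continuous f :=
  continuous_coinduced_dom.2 (continuous_from_compactlyGenerated (X := X) (f ∘ Kify.mk) h)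

theorem Kify.continuous_test (S : CompHaus.{u}) (g : C(S, X)) :
    Continuous (fun s => Kify.mk (g s)) := by
  let F : (Σ (i : (S : CompHaus.{u}) × C(S, X)), i.fst) → X := fun x => x.1.2 x.2
  have hF : @Continuous _ _ _ (TopologicalSpace.compactlyGenerated.{u} X) F :=
    continuous_coinduced_rng
  have hS : Continuous (fun s : S =>
      (⟨⟨S, g⟩, s⟩ : Σ (i : (S : CompHaus.{u}) × C(S, X)), i.fst)) :=
    continuous_sigmaMk (σ := fun i : (S : CompHaus.{u}) × C(S, X) => i.fst) (i := ⟨S, g⟩)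
  have hmk : @Continuous _ _ (TopologicalSpace.compactlyGenerated.{u} X) _ (Kify.mk (X := X)) :=
    continuous_coinduced_rng
  have hg : @Continuous _ _ _ (TopologicalSpace.compactlyGenerated.{u} X) g :=
    @Continuous.comp _ _ _ _ _ (TopologicalSpace.compactlyGenerated.{u} X) _ F hF hS
  exact @Continuous.comp _ _ _ _ (TopologicalSpace.compactlyGenerated.{u} X) _ _ _ hmk hg

theorem Kify.continuous_val : Continuous (Kify.val (X := X)) :=
  Kify.continuous_of_test _ fun _ g => g.continuous

instance : CompactlyGeneratedSpace (Kify X) :=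
  uCompactlyGeneratedSpace_of_continuous_maps fun f hf =>
    Kify.continuous_of_test f fun S g => hf S ⟨fun s => ⟨g s⟩, Kify.continuous_test S g⟩

/-- A continuous map from a compactly generated space to `X` is also continuous to `Kify X`. -/
theorem Kify.continuous_lift {T : Type u} [TopologicalSpace T] [CompactlyGeneratedSpace T]
    (f : T → X) (hf : Continuous f) : Continuous (fun t => Kify.mk (f t)) :=
  continuous_from_uCompactlyGeneratedSpace _ fun S g =>
    Kify.continuous_test S ⟨fun s => f (g s), hf.comp g.continuous⟩

end Kify

/-- The product `T × Y` in the category of compactly generated spaces. -/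
abbrev kProd (T Y : CGTop.{u}) : CGTop.{u} := CompactlyGenerated.of (Kify (T × Y))

/-- The map `f × g` of compactly generated products. -/
def kProdMap {T T' Y Y' : CGTop.{u}} (f : T ⟶ T') (g : Y ⟶ Y') : kProd T Y ⟶ kProd T' Y' :=
  CompactlyGenerated.ofHom
    ⟨fun x => ⟨(f x.val.1, g x.val.2)⟩, Kify.continuous_lift _
      (((map_continuous (ConcreteCategory.hom f)).comp
          (continuous_fst.comp Kify.continuous_val)).prodMk
        ((map_continuous (ConcreteCategory.hom g)).comp
          (continuous_snd.comp Kify.continuous_val)))⟩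

/-- The functor `T ↦ T × Y`. -/
def prodFunctor (Y : CGTop.{u}) : CGTop.{u} ⥤ CGTop.{u} where
  obj T := kProd T Y
  map f := kProdMap f (𝟙 Y)
  map_id _ := rfl
  map_comp _ _ := rfl

/-- The natural map `T × A ⟶ T × Y` induced by a map `A ⟶ Y`. -/
def prodFunctorMap {A Y : CGTop.{u}} (g : A ⟶ Y) : prodFunctor A ⟶ prodFunctor Y where
  app T := kProdMap (𝟙 T) g
  naturality _ _ _ := rfl

/-- The natural map `T ⟶ T × Y`, `t ↦ (t, y)`, given by a point `y` of `Y`. -/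
def sliceAt {Y : CGTop.{u}} (y : Y) : 𝟭 CGTop.{u} ⟶ prodFunctor Y where
  app T := CompactlyGenerated.ofHom ⟨fun t : T => ⟨(t, y)⟩, Kify.continuous_lift _ (by fun_prop)⟩
  naturality _ _ _ := rfl

/-! ## Local fibrations and local cofibrations -/

/-- A Hurewicz fibration: a continuous map with the homotopy lifting property with respect to all
(compactly generated) spaces. -/
def IsHurewiczFibration {E B : Type u} [TopologicalSpace E] [TopologicalSpace B]
    (p : E → B) : Prop :=
  Continuous p ∧
    ∀ (W : Type u) [TopologicalSpace W] [CompactlyGeneratedSpace W]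
      (f : C(W, E)) (H : C(W × unitInterval, B)), (∀ w, H (w, 0) = p (f w)) →
      ∃ G : C(W × unitInterval, E), (∀ w, G (w, 0) = f w) ∧ ∀ x, p (G x) = H x

/-- A local Hurewicz fibration: every `x` has an open neighbourhood `U`, and `f x` an open
neighbourhood `V`, such that `f` restricts to a Hurewicz fibration `U → V`. -/
def IsLocalHurewiczFibration {E B : Type u} [TopologicalSpace E] [TopologicalSpace B]
    (f : E → B) : Prop :=
  ∀ x : E, ∃ (U : Set E) (V : Set B) (h : Set.MapsTo f U V), IsOpen U ∧ IsOpen V ∧ x ∈ U ∧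
    IsHurewiczFibration (h.restrict f U V)

/-- A Hurewicz cofibration: a continuous map with the homotopy extension property with respect to
all (compactly generated) spaces. -/
def IsHurewiczCofibration {A Y : Type u} [TopologicalSpace A] [TopologicalSpace Y]
    (i : A → Y) : Prop :=
  Continuous i ∧
    ∀ (W : Type u) [TopologicalSpace W] [CompactlyGeneratedSpace W]
      (f : C(Y, W)) (H : C(A × unitInterval, W)), (∀ a, H (a, 0) = f (i a)) →
      ∃ G : C(Y × unitInterval, W), (∀ y, G (y, 0) = f y) ∧ ∀ a t, G (i a, t) = H (a, t)

/-- A local (Hurewicz) cofibration: every `a` has an open neighbourhood `U`, and `i a` an open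
neighbourhood `V`, such that `i` restricts to a Hurewicz cofibration `U → V`. -/
def IsLocalCofibration {A Y : Type u} [TopologicalSpace A] [TopologicalSpace Y]
    (i : A → Y) : Prop :=
  ∀ a : A, ∃ (U : Set A) (V : Set Y) (h : Set.MapsTo i U V), IsOpen U ∧ IsOpen V ∧ a ∈ U ∧
    IsHurewiczCofibration (h.restrict i U V)

/-! ## Topological groupoids and their quotient stacks -/

/-- A topological groupoid `Mor ⇉ Ob` in compactly generated spaces. The composite `comp g h` is
written in diagrammatic order, and is continuous on the compactly generated fibre product. -/
structure TopGroupoid where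
  /-- The space of objects. -/
  Ob : CGTop.{u}
  /-- The space of arrows. -/
  Mor : CGTop.{u}
  /-- The source map. -/
  src : C(Mor, Ob)
  /-- The target map. -/
  tgt : C(Mor, Ob)
  /-- The identity arrows. -/
  unit : C(Ob, Mor)
  /-- The inverse of an arrow. -/
  inv : C(Mor, Mor)
  /-- The composite of two composable arrows. -/
  comp : ∀ g h : Mor, tgt g = src h → Mor
  continuous_comp : Continuous
    (fun x : Kify {x : Mor × Mor // tgt x.1 = src x.2} => comp x.val.1.1 x.val.1.2 x.val.2)
  src_unit : ∀ x, src (unit x) = x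
  tgt_unit : ∀ x, tgt (unit x) = x
  src_inv : ∀ g, src (inv g) = tgt g
  tgt_inv : ∀ g, tgt (inv g) = src g
  src_comp : ∀ g h e, src (comp g h e) = src g
  tgt_comp : ∀ g h e, tgt (comp g h e) = tgt h
  unit_comp : ∀ g, comp (unit (src g)) g (tgt_unit _) = g
  comp_unit : ∀ g, comp g (unit (tgt g)) (src_unit _).symm = g
  comp_assoc : ∀ g h k (e : tgt g = src h) (e' : tgt h = src k),
    comp (comp g h e) k ((tgt_comp g h e).trans e') =
      comp g (comp h k e') (e.trans (src_comp h k e').symm)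
  comp_inv : ∀ g, comp g (inv g) (src_inv g).symm = unit (src g)
  inv_comp : ∀ g, comp (inv g) g (tgt_inv g) = unit (tgt g)

/-- A (right, principal) torsor of a topological groupoid `Γ` over a space `base`: a space `total`
with a projection to `base` and an anchor map to `Γ.Ob`, an action of `Γ` along the anchor
preserving the projection, such that the projection has local sections (that is, it is an
epimorphism for the topology of open coverings) and the shear map
`total ×_Ob Mor → total ×_base total`, `(p, g) ↦ (p, p g)`, is a homeomorphism of compactly
generated fibre products. -/
structure Torsor (Γ : TopGroupoid.{u}) where
  /-- The base space. -/
  base : CGTop.{u}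
  /-- The total space. -/
  total : CGTop.{u}
  /-- The projection to the base. -/
  proj : C(total, base)
  /-- The anchor map. -/
  anchor : C(total, Γ.Ob)
  /-- The action. -/
  act : ∀ (p : total) (g : Γ.Mor), anchor p = Γ.src g → total
  continuous_act : Continuous
    (fun x : Kify {x : total × Γ.Mor // anchor x.1 = Γ.src x.2} => act x.val.1.1 x.val.1.2 x.val.2)
  proj_act : ∀ p g e, proj (act p g e) = proj p
  anchor_act : ∀ p g e, anchor (act p g e) = Γ.tgt g
  act_unit : ∀ p, act p (Γ.unit (anchor p)) (Γ.src_unit _).symm = p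
  act_comp : ∀ p g h (e : anchor p = Γ.src g) (e' : Γ.tgt g = Γ.src h),
    act p (Γ.comp g h e') (e.trans (Γ.src_comp g h e').symm) =
      act (act p g e) h ((anchor_act p g e).trans e')
  shear : IsHomeomorph
    (fun x : Kify {x : total × Γ.Mor // anchor x.1 = Γ.src x.2} =>
      (⟨⟨(x.val.1.1, act x.val.1.1 x.val.1.2 x.val.2), (proj_act _ _ _).symm⟩⟩ :
        Kify {y : total × total // proj y.1 = proj y.2}))
  exists_local_section : ∀ b : base, ∃ (U : Set base) (σ : C(U, total)),
    IsOpen U ∧ b ∈ U ∧ ∀ x : U, proj (σ x) = x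

/-- A morphism of `Γ`-torsors: an equivariant map of total spaces over a map of base spaces. -/
@[ext]
structure Torsor.Hom {Γ : TopGroupoid.{u}} (P Q : Torsor Γ) where
  /-- The map of base spaces. -/
  baseMap : P.base ⟶ Q.base
  /-- The map of total spaces. -/
  totalMap : P.total ⟶ Q.total
  proj_map : ∀ p, Q.proj (totalMap p) = baseMap (P.proj p)
  anchor_map : ∀ p, Q.anchor (totalMap p) = P.anchor p
  map_act : ∀ p g (e : P.anchor p = Γ.src g),
    totalMap (P.act p g e) = Q.act (totalMap p) g ((anchor_map p).trans e)

instance (Γ : TopGroupoid.{u}) : Category.{u} (Torsor Γ) where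
  Hom P Q := Torsor.Hom P Q
  id _ :=
    { baseMap := 𝟙 _
      totalMap := 𝟙 _
      proj_map := fun _ => rfl
      anchor_map := fun _ => rfl
      map_act := fun _ _ _ => rfl }
  comp φ ψ :=
    { baseMap := φ.baseMap ≫ ψ.baseMap
      totalMap := φ.totalMap ≫ ψ.totalMap
      proj_map := fun p => (ψ.proj_map (φ.totalMap p)).trans
        (congrArg ψ.baseMap (φ.proj_map p))
      anchor_map := fun p => (ψ.anchor_map (φ.totalMap p)).trans (φ.anchor_map p)
      map_act := fun p g e => (congrArg ψ.totalMap (φ.map_act p g e)).trans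
        (ψ.map_act (φ.totalMap p) g ((φ.anchor_map p).trans e)) }
  id_comp _ := rfl
  comp_id _ := rfl
  assoc _ _ _ := rfl

/-- The quotient stack `[Ob / Mor]` of a topological groupoid: the category of `Γ`-torsors over
variable spaces, as a category over the category of spaces. -/
def quotientStack (Γ : TopGroupoid.{u}) : BasedCategory.{u, u + 1} CGTop.{u} :=
  BasedCategory.ofFunctor (𝒳 := Torsor Γ)
    { obj := fun P => P.base
      map := fun φ => Torsor.Hom.baseMap φ
      map_id := fun _ => rfl
      map_comp := fun _ _ => rfl }

/-- A category over `CGTop` is fibred in groupoids: it is fibred and every morphism lying over an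
identity is invertible. -/
structure IsFibredInGroupoids (𝒳 : BasedCategory.{v, w} CGTop.{u}) : Prop where
  isFibered : 𝒳.p.IsFibered
  isIso_of_vertical : ∀ (S : CGTop.{u}) (a b : 𝒳.obj) (φ : a ⟶ b),
    𝒳.p.IsHomLift (𝟙 S) φ → IsIso φ

/-- A topological stack: a category fibred in groupoids over `CGTop` which is equivalent, over
`CGTop`, to the quotient stack of a topological groupoid whose source and target maps are local
Hurewicz fibrations. (Torsors satisfy descent for open coverings, hence so does such a category.) -/
structure IsTopologicalStack (𝒳 : BasedCategory.{v, w} CGTop.{u}) : Prop where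
  isFibredInGroupoids : IsFibredInGroupoids 𝒳
  exists_presentation : ∃ Γ : TopGroupoid.{u},
    IsLocalHurewiczFibration Γ.src ∧ IsLocalHurewiczFibration Γ.tgt ∧
      ∃ F : BasedFunctor 𝒳 (quotientStack Γ), F.toFunctor.IsEquivalence

/-! ## Points of stacks and mapping stacks -/

/-- A space `T` regarded as a stack: spaces over `T`. -/
def spaceStack (T : CGTop.{u}) : BasedCategory.{u, u + 1} CGTop.{u} :=
  BasedCategory.ofFunctor (Over.forget T)

/-- The morphism of stacks given by a map of spaces: composition with the map. -/
def spaceStackMap {S T : CGTop.{u}} (f : S ⟶ T) : BasedFunctor (spaceStack S) (spaceStack T) where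
  toFunctor := Over.map f
  w := rfl

/-- The functor `T ↦ 𝒳(T)`, where `𝒳(T)` is the category of morphisms of stacks `T ⟶ 𝒳` (a
groupoid when `𝒳` is fibred in groupoids), with restriction along `S ⟶ T` given by composition. -/
def points (𝒳 : BasedCategory.{v, w} CGTop.{u}) : CGTop.{u}ᵒᵖ ⥤ Cat where
  obj T := Cat.of (BasedFunctor (spaceStack T.unop) 𝒳)
  map {T S} f := Functor.toCatHom
    { obj := fun F => BasedFunctor.comp (spaceStackMap f.unop) F
      map := fun α => BasedCategory.whiskerLeft (spaceStackMap f.unop) α }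

/-- The mapping stack from a space `Y` to `𝒳`: the functor `T ↦ Hom(T × Y, 𝒳)`. -/
def mappingStack (Y : CGTop.{u}) (𝒳 : BasedCategory.{v, w} CGTop.{u}) : CGTop.{u}ᵒᵖ ⥤ Cat :=
  (prodFunctor Y).op ⋙ points 𝒳

/-- The restriction morphism `Hom(Y, 𝒳) ⟶ Hom(A, 𝒳)` of mapping stacks along a map `A ⟶ Y`. -/
def mappingStackMap {A Y : CGTop.{u}} (g : A ⟶ Y) (𝒳 : BasedCategory.{v, w} CGTop.{u}) :
    mappingStack Y 𝒳 ⟶ mappingStack A 𝒳 :=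
  Functor.whiskerRight (NatTrans.op (prodFunctorMap g)) (points 𝒳)

/-- The evaluation morphism `Hom(Y, 𝒳) ⟶ 𝒳` at a point `y` of `Y`. -/
def evalAt {Y : CGTop.{u}} (y : Y) (𝒳 : BasedCategory.{v, w} CGTop.{u}) :
    mappingStack Y 𝒳 ⟶ points 𝒳 where
  app T := (points 𝒳).map ((sliceAt y).app T.unop).op
  naturality _ _ _ := rfl

/-! ## 2-cartesian squares -/

/-- A commutative square of categories is 2-cartesian if the comparison functor from its corner `P`
to the 2-fibre product `B ×_D C` (triples of `b`, `c` and an isomorphism `f b ≅ g c`) is an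
equivalence of categories. -/
def IsTwoCartesianCat {P B C D : Cat.{v, w}} (p : P ⟶ B) (q : P ⟶ C) (f : B ⟶ D) (g : C ⟶ D)
    (h : p ≫ f = q ≫ g) : Prop :=
  ((Limits.CategoricalPullback.CatCommSqOver.toFunctorToCategoricalPullback
    f.toFunctor g.toFunctor P).obj
      { fst := p.toFunctor
        snd := q.toFunctor
        iso := eqToIso (congrArg Cat.Hom.toFunctor h) }).IsEquivalence

/-- A commutative square of stacks is 2-cartesian if for every space `T` its square of `T`-points is
2-cartesian. -/
def IsTwoCartesian {P B C D : CGTop.{u}ᵒᵖ ⥤ Cat.{v, w}} (p : P ⟶ B) (q : P ⟶ C) (f : B ⟶ D)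
    (g : C ⟶ D) (h : p ≫ f = q ≫ g) : Prop :=
  ∀ T : CGTop.{u}ᵒᵖ, IsTwoCartesianCat (p.app T) (q.app T) (f.app T) (g.app T)
    (congrArg (fun η => NatTrans.app η T) h)

/-! ## The figure eight -/

/-- The circle `ℝ / ℤ`. -/
def circle : CGTop.{u} := CompactlyGenerated.of (ULift.{u} UnitAddCircle)

/-- The base point `0` of the circle. -/
def circleBase : circle.{u} := ULift.up (0 : UnitAddCircle)

/-- The wedge `S¹ ∨ S¹`: two circles with their base points identified. -/
def figureEight : CGTop.{u} :=
  CompactlyGenerated.of (Quotient (Relation.EqvGen.setoid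
    (fun x y : circle.{u} ⊕ circle.{u} => x = Sum.inl circleBase ∧ y = Sum.inr circleBase)))

/-- The inclusion of the first circle in the figure eight. -/
def leftCircle : circle.{u} ⟶ figureEight.{u} :=
  CompactlyGenerated.ofHom (X := circle.{u}) ⟨fun x => Quotient.mk _ (Sum.inl x),
    continuous_quotient_mk'.comp continuous_inl⟩

/-- The inclusion of the second circle in the figure eight. -/
def rightCircle : circle.{u} ⟶ figureEight.{u} :=
  CompactlyGenerated.ofHom (X := circle.{u}) ⟨fun x => Quotient.mk _ (Sum.inr x),
    continuous_quotient_mk'.comp continuous_inr⟩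

theorem leftCircle_base : leftCircle.{u} circleBase = rightCircle.{u} circleBase :=
  Quotient.sound (Relation.EqvGen.rel _ _ ⟨rfl, rfl⟩)

/-- The loop stack `L𝒳 = Hom(S¹, 𝒳)`. -/
abbrev loopStack (𝒳 : BasedCategory.{v, w} CGTop.{u}) : CGTop.{u}ᵒᵖ ⥤ Cat := mappingStack circle 𝒳

/-! ## Commutativity of the squares -/

theorem points_square {A Y Z U : CGTop.{u}} {i : A ⟶ Y} {f : A ⟶ Z} {inY : Y ⟶ U} {inZ : Z ⟶ U}
    (h : i ≫ inY = f ≫ inZ) (𝒳 : BasedCategory.{v, w} CGTop.{u}) :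
    (points 𝒳).map inZ.op ≫ (points 𝒳).map f.op =
      (points 𝒳).map inY.op ≫ (points 𝒳).map i.op := by
  rw [← Functor.map_comp, ← Functor.map_comp, ← op_comp, ← op_comp, h]

theorem mappingStack_square {A Y Z U : CGTop.{u}} {i : A ⟶ Y} {f : A ⟶ Z} {inY : Y ⟶ U}
    {inZ : Z ⟶ U} (h : i ≫ inY = f ≫ inZ) (𝒳 : BasedCategory.{v, w} CGTop.{u}) :
    mappingStackMap inZ 𝒳 ≫ mappingStackMap f 𝒳 =
      mappingStackMap inY 𝒳 ≫ mappingStackMap i 𝒳 := by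
  ext T : 2
  exact points_square (show kProdMap (𝟙 T.unop) i ≫ kProdMap (𝟙 T.unop) inY =
    kProdMap (𝟙 T.unop) f ≫ kProdMap (𝟙 T.unop) inZ from
      congrArg (fun g => kProdMap (𝟙 T.unop) g) h) 𝒳

theorem figureEight_square (𝒳 : BasedCategory.{v, w} CGTop.{u}) :
    mappingStackMap leftCircle 𝒳 ≫ evalAt circleBase 𝒳 =
      mappingStackMap rightCircle 𝒳 ≫ evalAt circleBase 𝒳 := by
  ext T : 2
  exact points_square (show (sliceAt circleBase).app T.unop ≫ kProdMap (𝟙 T.unop) rightCircle =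
    (sliceAt circleBase).app T.unop ≫ kProdMap (𝟙 T.unop) leftCircle from
      congrArg (fun y : figureEight => (sliceAt y).app T.unop) leftCircle_base.symm) 𝒳

end TopStack

open TopStack

-- By the 2-Yoneda lemma a point of `𝒳` over `U` is an object of the fibre over `U`, and a
-- presentation turns such objects into torsors of a groupoid `Γ` whose source map is a local
-- Hurewicz fibration. The claim becomes descent: a torsor over the pushout `U` is the same as
-- torsors over `Y` and `Z` with an isomorphism of their restrictions to `A`.
--
-- Morphisms descend for soft reasons. A morphism of torsors is bijective on fibres, so equivariant
-- maps glue as maps of sets; continuity is checked on a local section, and thus on `U`, whose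
-- topology is detected on `Y` and `Z` (`Torsor.exists_hom_desc`).
--
-- Objects need the hypotheses. The glued torsor exists as a set, and it becomes a torsor once every
-- point of `U` has a neighbourhood carrying a pair of sections over `Y` and `Z` that agree over
-- `A`. Away from `Z` this is clear, because `A` is closed in `Y`. Near a point `z` of `Z`, choose a
-- section over `Z` and transport it to `A`; it must be extended to a neighbourhood in `Y` of each
-- point of the fibre over `z`. Compared with an arbitrary local section over `Y`, it is a map `g`
-- to `Γ.Mor` with prescribed source, so the extension is a lifting problem for `Γ.src` relative to
-- `A`. It is solved locally because `A` is locally a deformation retract in `Y` and `Γ.src` is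
-- locally a fibration (`exists_local_extension`). The fibre over `z` is finite and `Y` is
-- Hausdorff, so these extensions can be given disjoint domains; closedness of `A ⟶ Z` then shrinks
-- their union to a saturated open set (`exists_glueSection_inZ`).
--
-- Mapping stacks require the same for the square multiplied by an arbitrary space `T`. All that is
-- used of the square is collected in `GluingSquare`, which survives this product when `A` is
-- Hausdorff and `A ⟶ Z` is proper (`GluingSquare.kProdMap`). The figure eight is the gluing of two
-- circles along a point.

universe v' w'

namespace TopStack

/-! ## Compactly generated spaces -/

section CompactlyGenerated

variable {X Y : Type u} [TopologicalSpace X] [TopologicalSpace Y]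

/-- An open subspace of a compactly generated space is compactly generated. -/
theorem compactlyGeneratedSpace_of_isOpen_subtype [CompactlyGeneratedSpace X] {s : Set X}
    (hs : IsOpen s) : CompactlyGeneratedSpace s := by
  refine compactlyGeneratedSpace_of_isOpen fun W hW => ?_
  rw [hs.isOpenEmbedding_subtypeVal.isOpen_iff_image_isOpen]
  refine CompactlyGeneratedSpace.isOpen' fun K _ _ _ g hg => ?_
  rw [isOpen_iff_mem_nhds]
  rintro k ⟨x, hxW, hxk⟩
  have hks : g k ∈ s := hxk ▸ x.2
  -- A test map to `X` need not land in `s`; its restriction to a compact neighbourhood of `k`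
  -- inside the preimage of `s` is a test map to `s`.
  obtain ⟨C, hC, hCs, hCc⟩ :=
    LocallyCompactSpace.local_compact_nhds k (g ⁻¹' s) ((hs.preimage hg).mem_nhds hks)
  have : CompactSpace C := isCompact_iff_compactSpace.1 hCc
  have hopen := hW C (fun c => ⟨g c, hCs c.2⟩) ((hg.comp continuous_subtype_val).subtype_mk _)
  obtain ⟨O, hO, hOC⟩ := isOpen_induced_iff.1 hopen
  have hkO : k ∈ O := by
    have : (⟨k, mem_of_mem_nhds hC⟩ : C) ∈ Subtype.val ⁻¹' O := by
      rw [hOC]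
      change (⟨g k, _⟩ : s) ∈ W
      convert hxW
      exact hxk.symm
    exact this
  filter_upwards [hC, hO.mem_nhds hkO] with c hc hcO
  have : (⟨c, hc⟩ : C) ∈ Subtype.val ⁻¹' O := hcO
  rw [hOC] at this
  exact ⟨⟨g c, hCs hc⟩, this, rfl⟩

/-- A map out of `X × K`, with `X` compactly generated and `K` compact Hausdorff, is continuous if
it is so after pulling back along all maps from compact Hausdorff spaces to `X`. -/
theorem continuous_prod_of_test [CompactlyGeneratedSpace X] {K Z : Type*} [TopologicalSpace K]
    [LocallyCompactSpace K] [TopologicalSpace Z] (f : X × K → Z)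
    (h : ∀ (S : CompHaus.{u}) (g : C(S, X)), Continuous fun x : S × K => f (g x.1, x.2)) :
    Continuous f := by
  let F : (Σ (i : (S : CompHaus.{u}) × C(S, X)), i.fst) → X := fun x => x.1.2 x.2
  have hq : IsQuotientMap F := by
    refine (isQuotientMap_iff _).2 ⟨isCoinducing_iff.2 fun s => ⟨fun hs => ?_, fun hs => ?_⟩,
      fun x => ⟨⟨⟨CompHaus.of PUnit, ContinuousMap.const _ x⟩, ⟨⟩⟩, rfl⟩⟩
    · exact UCompactlyGeneratedSpace.isOpen fun S g => isOpen_sigma_iff.1 hs ⟨S, g⟩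
    · exact hs.preimage (continuous_sigma fun i => i.2.continuous)
  -- `X` is a quotient of the disjoint union of all its test spaces, and the product with a locally
  -- compact space preserves quotient maps.
  refine hq.continuous_lift_prod_left ?_
  let e := Homeomorph.sigmaProdDistrib (ι := (S : CompHaus.{u}) × C(S, X))
    (X := fun i => i.fst) (Y := K)
  have : (fun p : (Σ (i : (S : CompHaus.{u}) × C(S, X)), i.fst) × K => f (F p.1, p.2)) =
      (fun x : Σ (i : (S : CompHaus.{u}) × C(S, X)), (i.fst × K) =>
        f (x.1.2 x.2.1, x.2.2)) ∘ e := by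
    ext ⟨⟨i, s⟩, k⟩
    rfl
  rw [this]
  exact (continuous_sigma fun i => h i.1 i.2).comp e.continuous

/-- Homotopies with values in a `Kify` space are built by `Kify.continuous_lift`, which wants a
compactly generated domain; here `K` is the unit interval. As `K` lives in `Type`, it is lifted to
the universe of the test spaces. -/
theorem compactlyGeneratedSpace_prod [CompactlyGeneratedSpace X] {K : Type} [TopologicalSpace K]
    [CompactSpace K] [T2Space K] : CompactlyGeneratedSpace (X × K) :=
  uCompactlyGeneratedSpace_of_continuous_maps fun f h =>
    continuous_prod_of_test f fun S g =>
      (h (CompHaus.of (S × ULift.{u} K))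
        ⟨fun x => (g x.1, x.2.down), by fun_prop⟩).comp
        (continuous_fst.prodMk (continuous_uliftUp.comp continuous_snd))

theorem compactlyGeneratedSpace_prod_compHaus [CompactlyGeneratedSpace X] {K : Type u}
    [TopologicalSpace K] [CompactSpace K] [T2Space K] : CompactlyGeneratedSpace (X × K) :=
  uCompactlyGeneratedSpace_of_continuous_maps fun f h =>
    continuous_prod_of_test f fun S g =>
      h (CompHaus.of (S × K)) ⟨fun x => (g x.1, x.2), by fun_prop⟩

end CompactlyGenerated

/-! ## Local neighbourhood deformation retracts -/

/-- A subset `B` of `Y` is locally a neighbourhood deformation retract: near every point of `B`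
there is a deformation `D` of an open set `V`, stationary on `B`, which has moved `v` into `B` by
the time `u v`, where `u` vanishes on `B`. -/
def IsLocalNDR {Y : Type u} [TopologicalSpace Y] (B : Set Y) : Prop :=
  ∀ b ∈ B, ∃ (V : Set Y) (u : C(V, unitInterval)) (D : C(V × unitInterval, Y)),
    IsOpen V ∧ b ∈ V ∧ (∀ v, D (v, 0) = v) ∧ (∀ v : V, (v : Y) ∈ B → u v = 0 ∧ ∀ t, D (v, t) = v) ∧
      ∀ v, D (v, u v) ∈ B

/-- Strøm's argument. Extending the tautological homotopy into the cylinder `M`, the union of `V ×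
0` and `A × I`, gives a retraction `r` of `V × I` onto `M`. Its space coordinate is the deformation.
Its time coordinate measures how long a point takes to reach `A`: where it is positive, the space
coordinate lies in `A`. -/
theorem isLocalNDR_of_isLocalCofibration {A Y : Type u} [TopologicalSpace A] [TopologicalSpace Y]
    [CompactlyGeneratedSpace A] [CompactlyGeneratedSpace Y] {i : A → Y} (hi : IsClosedEmbedding i)
    (h : IsLocalCofibration i) : IsLocalNDR (Set.range i) := by
  rintro _ ⟨a, rfl⟩
  obtain ⟨U, V, hUV, hU, hV, haU, hcont, hext⟩ := h a
  have := compactlyGeneratedSpace_of_isOpen_subtype hU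
  have := compactlyGeneratedSpace_of_isOpen_subtype hV
  have : CompactlyGeneratedSpace (U × unitInterval) := compactlyGeneratedSpace_prod
  let M := {x : V × unitInterval // x.2 = 0 ∨ x.1 ∈ Set.range (hUV.restrict i U V)}
  let f : C(V, Kify M) := ⟨fun v => ⟨⟨(v, 0), Or.inl rfl⟩⟩,
    Kify.continuous_lift _ (Continuous.subtype_mk (by fun_prop) _)⟩
  let H : C(U × unitInterval, Kify M) :=
    ⟨fun x => ⟨⟨(hUV.restrict i U V x.1, x.2), Or.inr ⟨_, rfl⟩⟩⟩,
      Kify.continuous_lift _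
        (Continuous.subtype_mk ((hcont.comp continuous_fst).prodMk continuous_snd) _)⟩
  obtain ⟨G, hG0, hGH⟩ := hext (Kify M) f H (fun a => rfl)
  let r : C(V × unitInterval, V × unitInterval) :=
    ⟨fun x => (G x).val.1, continuous_subtype_val.comp (Kify.continuous_val.comp G.continuous)⟩
  have hr0 : ∀ v, r (v, 0) = (v, 0) := fun v => by
    change (G (v, 0)).val.1 = _
    rw [hG0]
    rfl
  have hrU : ∀ (x : U) t, r (hUV.restrict i U V x, t) = (hUV.restrict i U V x, t) := fun x t => by
    change (G (_, t)).val.1 = _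
    rw [hGH]
    rfl
  have hrM : ∀ x, (r x).2 = 0 ∨ (r x).1 ∈ Set.range (hUV.restrict i U V) := fun x => (G x).val.2
  let F : C(V × unitInterval, ℝ) := ⟨fun x => (x.2 : ℝ) - ((r x).2 : ℝ), by fun_prop⟩
  -- The largest gap between `t` and the time coordinate of `r (v, t)`, continuous in `v` as the
  -- norm of a curried map on a compact interval.
  let w : V → ℝ := fun v => ‖F.curry v‖
  have hw : Continuous w := F.curry.continuous.norm
  have hle : ∀ (v : V) (t : unitInterval), |(t : ℝ) - ((r (v, t)).2 : ℝ)| ≤ w v := fun v t =>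
    (F.curry v).norm_coe_le_norm t
  have hw1 : ∀ v, w v ≤ 1 := fun v => by
    refine (ContinuousMap.norm_le _ zero_le_one).2 fun t => ?_
    change |(t : ℝ) - ((r (v, t)).2 : ℝ)| ≤ 1
    have h1 := t.2
    have h2 := (r (v, t)).2.2
    rw [abs_le]
    constructor <;> linarith [h1.1, h1.2, h2.1, h2.2]
  have hw0 : ∀ v, 0 ≤ w v := fun v => norm_nonneg _
  have hwU : ∀ x : U, w (hUV.restrict i U V x) = 0 := fun x => by
    refine le_antisymm ((ContinuousMap.norm_le _ le_rfl).2 fun t => ?_) (hw0 _)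
    change |(t : ℝ) - ((r (_, t)).2 : ℝ)| ≤ 0
    rw [hrU]
    simp
  let u0 : C(V, unitInterval) := ⟨fun v => ⟨w v, hw0 v, hw1 v⟩, by fun_prop⟩
  -- For `t > w v` the time coordinate of `r (v, t)` is at least `t - w v > 0`, so the space
  -- coordinate is in `A`. As `A` is closed this persists at `t = w v`, which is a limit of such `t`
  -- because `w v < 1`.
  have hmem : ∀ v, w v < 1 → ((r (v, u0 v)).1 : Y) ∈ Set.range i := fun v hv => by
    have hclosed : IsClosed {t : unitInterval | ((r (v, t)).1 : Y) ∈ Set.range i} :=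
      hi.isClosed_range.preimage (by fun_prop)
    have hsub : Set.Ioc (u0 v) 1 ⊆ {t : unitInterval | ((r (v, t)).1 : Y) ∈ Set.range i} := by
      rintro t ⟨ht, -⟩
      rcases hrM (v, t) with h0 | ⟨x, hx⟩
      · have h1 := hle v t
        have h2 : w v < (t : ℝ) := ht
        rw [h0] at h1
        have h3 := (abs_le.1 h1).2
        simp only [Set.Icc.coe_zero, sub_zero] at h3
        linarith
      · exact ⟨x, congrArg Subtype.val hx⟩
    have hlt : u0 v < 1 := Subtype.coe_lt_coe.1 hv
    have := closure_minimal hsub hclosed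
    rw [closure_Ioc hlt.ne] at this
    exact this ⟨le_rfl, hlt.le⟩
  -- The retraction is known to be stationary only on the image of `U`, so `V` is cut down to an
  -- open set in which every point of `A` comes from `U`.
  obtain ⟨O, hO, hOU⟩ := hi.isInducing.isOpen_iff.1 hU
  let N : Set V := {v | w v < 1} ∩ Subtype.val ⁻¹' O
  have hN : IsOpen N := (isOpen_Iio.preimage hw).inter (hO.preimage continuous_subtype_val)
  have hNV : ∀ y : (Subtype.val '' N : Set Y), ∃ h : (y : Y) ∈ V, (⟨y, h⟩ : V) ∈ N := by
    rintro ⟨_, v, hv, rfl⟩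
    exact ⟨v.2, hv⟩
  let k : C((Subtype.val '' N : Set Y), V) :=
    ⟨fun y => ⟨y, (hNV y).1⟩, by fun_prop⟩
  have hkU : ∀ y : (Subtype.val '' N : Set Y), (y : Y) ∈ Set.range i →
      ∃ x : U, k y = hUV.restrict i U V x := by
    rintro y ⟨a', ha'⟩
    refine ⟨⟨a', ?_⟩, Subtype.ext ha'.symm⟩
    rw [← hOU]
    change i a' ∈ O
    rw [ha']
    exact (hNV y).2.2
  have haN : (hUV.restrict i U V ⟨a, haU⟩) ∈ N := by
    refine ⟨?_, ?_⟩
    · change w _ < 1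
      rw [hwU]
      exact one_pos
    · have : a ∈ i ⁻¹' O := by rw [hOU]; exact haU
      exact this
  refine ⟨Subtype.val '' N, u0.comp k, ⟨fun x => (r (k x.1, x.2)).1, by fun_prop⟩,
    hV.isOpenMap_subtype_val _ hN, ⟨_, haN, rfl⟩, fun v => ?_, fun v hv => ?_, fun v => ?_⟩
  · change ((r (k v, 0)).1 : Y) = v
    rw [hr0]
    rfl
  · obtain ⟨x, hx⟩ := hkU v hv
    refine ⟨?_, fun t => ?_⟩
    · change u0 (k v) = 0
      rw [hx]
      exact Subtype.ext (hwU x)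
    · change ((r (k v, t)).1 : Y) = v
      rw [hx, hrU, ← hx]
      rfl
  · exact hmem (k v) (hNV v).2.1

/-- The deformation moves only the `Y` coordinate. This easy stability under products is the reason
to work with explicit local deformations in place of the homotopy extension property. -/
theorem IsLocalNDR.preimage_kify {T Y : Type u} [TopologicalSpace T] [TopologicalSpace Y]
    {B : Set Y} (hB : IsLocalNDR B) :
    IsLocalNDR ((fun x : Kify (T × Y) => x.val.2) ⁻¹' B) := by
  intro x hx
  obtain ⟨V, w, D, hV, hxV, hD0, hDB, hDu⟩ := hB _ hx
  have hsnd : Continuous fun x : Kify (T × Y) => x.val.2 :=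
    continuous_snd.comp Kify.continuous_val
  have hfst : Continuous fun x : Kify (T × Y) => x.val.1 :=
    continuous_fst.comp Kify.continuous_val
  let V' : Set (Kify (T × Y)) := (fun x : Kify (T × Y) => x.val.2) ⁻¹' V
  have hV' : IsOpen V' := hV.preimage hsnd
  have := compactlyGeneratedSpace_of_isOpen_subtype hV'
  have : CompactlyGeneratedSpace (V' × unitInterval) := compactlyGeneratedSpace_prod
  let q : C(V', V) := ⟨fun y => ⟨y.1.val.2, y.2⟩,
    (hsnd.comp continuous_subtype_val).subtype_mk _⟩
  refine ⟨V', w.comp q, ⟨fun y => ⟨(y.1.1.val.1, D (q y.1, y.2))⟩,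
    Kify.continuous_lift _ (Continuous.prodMk ?_ (by fun_prop))⟩, hV', hxV, ?_, ?_, ?_⟩
  · exact hfst.comp (continuous_subtype_val.comp continuous_fst)
  · intro y
    exact Kify.ext (Prod.ext rfl (hD0 (q y)))
  · intro y hy
    obtain ⟨h1, h2⟩ := hDB (q y) hy
    exact ⟨h1, fun t => Kify.ext (Prod.ext rfl (h2 t))⟩
  · intro y
    exact hDu (q y)

/-- Local extension of lifts: a lift, defined on a closed local neighbourhood deformation retract,
of a map to the base of a local Hurewicz fibration, extends locally. -/
theorem exists_local_extension {A Y E B : Type u} [TopologicalSpace A] [TopologicalSpace Y]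
    [TopologicalSpace E] [TopologicalSpace B] [CompactlyGeneratedSpace Y] {i : A → Y}
    (hi : IsEmbedding i) (hNDR : IsLocalNDR (Set.range i)) {p : E → B}
    (hp : IsLocalHurewiczFibration p) {V₀ : Set Y} (hV₀ : IsOpen V₀) {h : Y → B}
    (hh : ContinuousOn h V₀) {g : A → E} (hg : ContinuousOn g (i ⁻¹' V₀))
    (hgh : ∀ a, i a ∈ V₀ → p (g a) = h (i a)) {a₀ : A} (ha₀ : i a₀ ∈ V₀) :
    ∃ (V : Set Y) (g' : Y → E), IsOpen V ∧ V ⊆ V₀ ∧ i a₀ ∈ V ∧ ContinuousOn g' V ∧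
      (∀ y ∈ V, p (g' y) = h y) ∧ ∀ a, i a ∈ V → g' (i a) = g a := by
  obtain ⟨V, w, D, hV, haV, hD0, hDB, hDu⟩ := hNDR (i a₀) ⟨a₀, rfl⟩
  obtain ⟨U₁, V₁, hUV₁, hU₁, hV₁, hgU₁, -, hlift⟩ := hp (g a₀)
  have := compactlyGeneratedSpace_of_isOpen_subtype hV
  -- `κ v` is the point of `A` at which the path of `v` arrives at time `w v`.
  choose κ hκ using hDu
  have hκc : Continuous κ := by
    rw [hi.isInducing.continuous_iff]
    have : i ∘ κ = fun v => D (v, w v) := funext hκ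
    rw [this]
    fun_prop
  have hκi : ∀ v : V, ∀ a, i a = v → κ v = a := fun v a hav => by
    apply hi.injective
    rw [hκ, (hDB v ⟨a, hav⟩).2, hav]
  let O : Set Y := V₀ ∩ h ⁻¹' V₁
  have hO : IsOpen O := hh.isOpen_inter_preimage hV₀ hV₁
  -- The points whose whole path stays in `O`; they form an open set by compactness of the interval.
  let N₁ : Set V := {v | ∀ t, D (v, t) ∈ O}
  have hN₁ : IsOpen N₁ := by
    have hc : IsClosed (Prod.fst '' (D ⁻¹' Oᶜ)) :=
      isClosedMap_fst_of_compactSpace _ (hO.isClosed_compl.preimage D.continuous)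
    convert hc.isOpen_compl using 1
    ext v
    simp [N₁]
  have hκV₀ : ∀ v ∈ N₁, i (κ v) ∈ V₀ := fun v hv => by
    rw [hκ]
    exact (hv _).1
  have hgκ : ContinuousOn (g ∘ κ) N₁ := hg.comp hκc.continuousOn hκV₀
  let N : Set V := N₁ ∩ (g ∘ κ) ⁻¹' U₁
  have hN : IsOpen N := hgκ.isOpen_inter_preimage hN₁ hU₁
  have := compactlyGeneratedSpace_of_isOpen_subtype hN
  let f : C(N, U₁) := ⟨fun n => ⟨g (κ n), n.2.2⟩,
    ((hgκ.mono Set.inter_subset_left).domRestrict).subtype_mk _⟩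
  -- A clock running backwards from `w` to `0` and stopping there: `D (x.1, c x)` travels from `i (κ
  -- v)` back to `v` and arrives at time `w v`. The composite with `h` is a homotopy whose start is
  -- lifted by `g ∘ κ`.
  let c : N × unitInterval → unitInterval := fun x =>
    ⟨max ((w x.1 : ℝ) - x.2) 0, le_max_right _ _,
      max_le (by linarith [(w x.1).2.2, x.2.2.1]) zero_le_one⟩
  have hc : Continuous c := by
    refine Continuous.subtype_mk ?_ _
    fun_prop
  let H : C(N × unitInterval, V₁) := ⟨fun x => ⟨h (D (x.1, c x)), (x.1.2.1 _).2⟩, by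
    refine Continuous.subtype_mk ?_ _
    exact hh.comp_continuous (f := fun x : N × unitInterval => D (x.1, c x)) (by fun_prop)
      fun x => (x.1.2.1 _).1⟩
  obtain ⟨G, hG0, hGH⟩ := hlift N f H (fun n => by
    apply Subtype.ext
    change h (D (n, c (n, 0))) = p (g (κ n))
    have hc0 : c (n, 0) = w n := by
      apply Subtype.ext
      simp only [c, Set.Icc.coe_zero, sub_zero]
      exact max_eq_left (w _).2.1
    rw [hc0, hgh _ (hκV₀ n n.2.1), hκ])
  have hcw : ∀ n : N, c (n, w n) = 0 := fun n => by
    apply Subtype.ext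
    simp [c]
  let V' : Set Y := Subtype.val '' N
  have hV'N : ∀ y ∈ V', ∃ hy : y ∈ V, (⟨y, hy⟩ : V) ∈ N := by
    rintro _ ⟨v, hv, rfl⟩
    exact ⟨v.2, hv⟩
  classical
  -- The lifted homotopy is evaluated at time `w y`, not at time `1`. On `A` this is time `0`, so
  -- the extension agrees with `g` exactly; at time `1` it need not, since a stationary homotopy may
  -- have a non-stationary lift.
  let g' : Y → E := fun y => if hy : y ∈ V' then
    (G (⟨⟨y, (hV'N y hy).1⟩, (hV'N y hy).2⟩, w ⟨y, (hV'N y hy).1⟩) : U₁) else g a₀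
  have hg' : ∀ n : N, g' n = (G (n, w n) : U₁) := fun n => by
    simp only [g']
    rw [dif_pos ⟨_, n.2, rfl⟩]
  refine ⟨V', g', hV.isOpenMap_subtype_val _ hN, ?_, ⟨⟨_, haV⟩, ?_, rfl⟩, ?_, ?_, ?_⟩
  · rintro _ ⟨v, hv, rfl⟩
    rw [← hD0 v]
    exact (hv.1 0).1
  · have hB := hDB ⟨i a₀, haV⟩ ⟨a₀, rfl⟩
    refine ⟨fun t => ?_, ?_⟩
    · rw [hB.2 t]
      refine ⟨ha₀, ?_⟩
      change h (i a₀) ∈ V₁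
      rw [← hgh a₀ ha₀]
      exact hUV₁ hgU₁
    · change g (κ _) ∈ U₁
      rw [hκi _ a₀ rfl]
      exact hgU₁
  · rw [continuousOn_iff_continuous_domRestrict]
    let k : V' → N := fun y => ⟨⟨y, (hV'N y y.2).1⟩, (hV'N y y.2).2⟩
    have hk : Continuous k := (continuous_subtype_val.subtype_mk _).subtype_mk _
    have : V'.domRestrict g' = fun y => (G (k y, w (k y)) : U₁).1 := by
      ext y
      exact hg' (k y)
    rw [this]
    fun_prop
  · rintro _ ⟨v, hv, rfl⟩
    rw [hg' ⟨v, hv⟩]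
    have h1 := congrArg Subtype.val (hGH (⟨v, hv⟩, w v))
    refine h1.trans ?_
    change h (D (v, c (⟨v, hv⟩, w v))) = h v
    rw [hcw ⟨v, hv⟩, hD0]
  · rintro a ⟨v, hv, hav⟩
    have hB := (hDB v ⟨a, hav.symm⟩).1
    rw [← hav, hg' ⟨v, hv⟩]
    change ((G (⟨v, hv⟩, w v) : U₁) : E) = g a
    rw [hB, hG0]
    change g (κ v) = g a
    rw [hκi v a hav.symm]

/-! ## Set-theoretic torsors -/

/-- Groupoid and torsor operations are continuous only for the compactly generated topology on fibre
products. An open set `s` is itself compactly generated, so a pair of continuous maps on it factors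
continuously through `Kify`. -/
theorem continuousOn_of_kify {T X Y Z : Type u} [TopologicalSpace T] [TopologicalSpace X]
    [TopologicalSpace Y] [TopologicalSpace Z] [CompactlyGeneratedSpace T] {R : X × Y → Prop}
    {F : {x : X × Y // R x} → Z} (hF : Continuous fun x : Kify {x : X × Y // R x} => F x.val)
    {s : Set T} (hs : IsOpen s) {f : T → X} {g : T → Y} (hf : ContinuousOn f s)
    (hg : ContinuousOn g s) (hR : ∀ t ∈ s, R (f t, g t)) {k : T → Z}
    (hk : ∀ t (ht : t ∈ s), k t = F ⟨(f t, g t), hR t ht⟩) : ContinuousOn k s := by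
  have := compactlyGeneratedSpace_of_isOpen_subtype hs
  rw [continuousOn_iff_continuous_domRestrict] at hf hg ⊢
  have h1 : Continuous fun t : s => (⟨(f t, g t), hR t t.2⟩ : {x : X × Y // R x}) :=
    (hf.prodMk hg).subtype_mk _
  have h2 := hF.comp (Kify.continuous_lift _ h1)
  have h3 : s.domRestrict k = fun t : s => F ⟨(f t, g t), hR t t.2⟩ := funext fun t => hk t t.2
  rw [h3]
  exact h2

open scoped Classical in
/-- The composite of two arrows, with a junk value when they are not composable. -/
noncomputable def TopGroupoid.mul (Γ : TopGroupoid.{u}) (g h : Γ.Mor) : Γ.Mor :=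
  if e : Γ.tgt g = Γ.src h then Γ.comp g h e else g

namespace TopGroupoid

variable (Γ : TopGroupoid.{u})

theorem mul_eq {g h : Γ.Mor} (e : Γ.tgt g = Γ.src h) : Γ.mul g h = Γ.comp g h e := dif_pos e

theorem src_mul {g h : Γ.Mor} (e : Γ.tgt g = Γ.src h) : Γ.src (Γ.mul g h) = Γ.src g := by
  rw [Γ.mul_eq e, Γ.src_comp]

theorem continuousOn_mul {T : Type u} [TopologicalSpace T] [CompactlyGeneratedSpace T] {s : Set T}
    (hs : IsOpen s) {g h : T → Γ.Mor} (hg : ContinuousOn g s) (hh : ContinuousOn h s)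
    (e : ∀ t ∈ s, Γ.tgt (g t) = Γ.src (h t)) : ContinuousOn (fun t => Γ.mul (g t) (h t)) s :=
  continuousOn_of_kify (R := fun x => Γ.tgt x.1 = Γ.src x.2)
    (F := fun x => Γ.comp x.1.1 x.1.2 x.2) Γ.continuous_comp hs hg hh e
    fun t ht => Γ.mul_eq (e t ht)

end TopGroupoid

/-- A torsor without topology: the action `smul p g` is meaningful if `anchor p = Γ.src g`, and the
difference `div p q`, the arrow which carries `p` to `q`, if `proj p = proj q`. -/
structure SetTorsor (Γ : TopGroupoid.{u}) (B : Type u) where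
  /-- The total space. -/
  E : Type u
  /-- The projection. -/
  proj : E → B
  /-- The anchor map. -/
  anchor : E → Γ.Ob
  /-- The action. -/
  smul : E → Γ.Mor → E
  /-- The difference of two points of a fibre. -/
  div : E → E → Γ.Mor
  proj_smul : ∀ {p g}, anchor p = Γ.src g → proj (smul p g) = proj p
  anchor_smul : ∀ {p g}, anchor p = Γ.src g → anchor (smul p g) = Γ.tgt g
  smul_unit : ∀ p, smul p (Γ.unit (anchor p)) = p
  smul_mul : ∀ {p g h}, anchor p = Γ.src g → Γ.tgt g = Γ.src h →
    smul p (Γ.mul g h) = smul (smul p g) h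
  src_div : ∀ {p q}, proj p = proj q → Γ.src (div p q) = anchor p
  smul_div : ∀ {p q}, proj p = proj q → smul p (div p q) = q
  div_smul : ∀ {p g}, anchor p = Γ.src g → div p (smul p g) = g

namespace SetTorsor

variable {Γ : TopGroupoid.{u}} {B : Type u} (S : SetTorsor Γ B)

theorem tgt_div {p q : S.E} (h : S.proj p = S.proj q) : Γ.tgt (S.div p q) = S.anchor q := by
  rw [← S.anchor_smul (S.src_div h).symm, S.smul_div h]

theorem smul_injective {p : S.E} {g h : Γ.Mor} (hg : S.anchor p = Γ.src g)
    (hh : S.anchor p = Γ.src h) (e : S.smul p g = S.smul p h) : g = h := by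
  rw [← S.div_smul hg, e, S.div_smul hh]

theorem mul_div {p q r : S.E} (h : S.proj p = S.proj q) (h' : S.proj q = S.proj r) :
    Γ.mul (S.div p q) (S.div q r) = S.div p r := by
  have e : Γ.tgt (S.div p q) = Γ.src (S.div q r) := by rw [S.tgt_div h, S.src_div h']
  refine S.smul_injective (p := p) ?_ (S.src_div (h.trans h')).symm ?_
  · rw [Γ.src_mul e, S.src_div h]
  · rw [S.smul_mul (S.src_div h).symm e, S.smul_div h, S.smul_div h', S.smul_div (h.trans h')]

theorem div_smul_right {p q : S.E} {g : Γ.Mor} (h : S.proj p = S.proj q)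
    (hg : S.anchor q = Γ.src g) : S.div p (S.smul q g) = Γ.mul (S.div p q) g := by
  rw [← S.mul_div h (S.proj_smul hg).symm, S.div_smul hg]

theorem inv_div {p q : S.E} (h : S.proj p = S.proj q) : Γ.inv (S.div p q) = S.div q p := by
  refine S.smul_injective (p := q) ?_ (S.src_div h.symm).symm ?_
  · rw [Γ.src_inv, S.tgt_div h]
  · rw [S.smul_div h.symm]
    nth_rewrite 1 [← S.smul_div h]
    rw [← S.smul_mul (S.src_div h).symm (Γ.src_inv _).symm, Γ.mul_eq (Γ.src_inv _).symm,
      Γ.comp_inv, S.src_div h, S.smul_unit]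

end SetTorsor

/-! ## Torsors -/

namespace Torsor

variable {Γ : TopGroupoid.{u}} (P : Torsor Γ)

theorem exists_section (b : P.base) : ∃ (U : Set P.base) (σ : P.base → P.total),
    IsOpen U ∧ b ∈ U ∧ ContinuousOn σ U ∧ ∀ x ∈ U, P.proj (σ x) = x := by
  classical
  obtain ⟨U, σ, hU, hb, hσ⟩ := P.exists_local_section b
  refine ⟨U, fun x => if h : x ∈ U then σ ⟨x, h⟩ else σ ⟨b, hb⟩, hU, hb, ?_, fun x hx => ?_⟩
  · rw [continuousOn_iff_continuous_domRestrict]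
    convert σ.continuous using 1
    ext x
    simp
  · simp only [dif_pos hx]
    exact hσ ⟨x, hx⟩

/-- The inverse of the shear map. -/
noncomputable def shearInv : Kify {y : P.total × P.total // P.proj y.1 = P.proj y.2} →
    Kify {x : P.total × Γ.Mor // P.anchor x.1 = Γ.src x.2} :=
  P.shear.homeomorph.symm

theorem continuous_shearInv : Continuous P.shearInv := P.shear.homeomorph.symm.continuous

theorem shear_shearInv (y : Kify {y : P.total × P.total // P.proj y.1 = P.proj y.2}) :
    (P.shearInv y).val.1.1 = y.val.1.1 ∧
      P.act (P.shearInv y).val.1.1 (P.shearInv y).val.1.2 (P.shearInv y).val.2 = y.val.1.2 := by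
  have h := P.shear.homeomorph.apply_symm_apply y
  have h' := congrArg (fun z => z.val.1) h
  exact ⟨congrArg Prod.fst h', congrArg Prod.snd h'⟩

theorem act_injective {p : P.total} {g h : Γ.Mor} (hg : P.anchor p = Γ.src g)
    (hh : P.anchor p = Γ.src h) (e : P.act p g hg = P.act p h hh) : g = h := by
  have := P.shear.homeomorph.injective (a₁ := ⟨⟨(p, g), hg⟩⟩) (a₂ := ⟨⟨(p, h), hh⟩⟩)
    (Kify.ext (Subtype.ext (Prod.ext rfl e)))
  exact congrArg (fun z => z.val.1.2) this

theorem act_congr {p p' : P.total} {g g' : Γ.Mor} (hp : p = p') (hg : g = g')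
    (e : P.anchor p = Γ.src g) :
    P.act p g e = P.act p' g' (by rw [← hp, ← hg]; exact e) := by
  subst hp hg
  rfl

open scoped Classical in
/-- The set-theoretic torsor underlying a torsor. -/
noncomputable def toSetTorsor : SetTorsor Γ P.base where
  E := P.total
  proj := P.proj
  anchor := P.anchor
  smul p g := if e : P.anchor p = Γ.src g then P.act p g e else p
  div p q := if e : P.proj p = P.proj q then (P.shearInv ⟨⟨(p, q), e⟩⟩).val.1.2
    else Γ.unit (P.anchor p)
  proj_smul e := by rw [dif_pos e, P.proj_act]
  anchor_smul e := by rw [dif_pos e, P.anchor_act]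
  smul_unit p := by rw [dif_pos (Γ.src_unit _).symm, P.act_unit]
  smul_mul {p g h} e e' := by
    rw [dif_pos e, dif_pos ((P.anchor_act p g e).trans e'), dif_pos (e.trans (Γ.src_mul e').symm),
      ← P.act_comp]
    exact P.act_congr rfl (Γ.mul_eq e') _
  src_div {p q} e := by
    rw [dif_pos e, ← (P.shearInv ⟨⟨(p, q), e⟩⟩).val.2, (P.shear_shearInv _).1]
  smul_div {p q} e := by
    have h := P.shear_shearInv ⟨⟨(p, q), e⟩⟩
    have e' : P.anchor p = Γ.src (P.shearInv ⟨⟨(p, q), e⟩⟩).val.1.2 := by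
      rw [← (P.shearInv ⟨⟨(p, q), e⟩⟩).val.2, h.1]
    rw [dif_pos e, dif_pos e']
    refine Eq.trans ?_ h.2
    exact P.act_congr h.1.symm rfl _
  div_smul {p g} e := by
    rw [dif_pos e, dif_pos (P.proj_act _ _ _).symm]
    have h := P.shear_shearInv ⟨⟨(p, P.act p g e), (P.proj_act _ _ _).symm⟩⟩
    refine P.act_injective (p := p) ?_ e ?_
    · rw [← (P.shearInv _).val.2, h.1]
    · refine Eq.trans ?_ h.2
      exact P.act_congr h.1.symm rfl _

/-- The action of a torsor, as a total function. -/
noncomputable def smul (p : P.total) (g : Γ.Mor) : P.total := P.toSetTorsor.smul p g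

/-- The difference of two points in a fibre of a torsor. -/
noncomputable def div (p q : P.total) : Γ.Mor := P.toSetTorsor.div p q

theorem smul_eq {p : P.total} {g : Γ.Mor} (e : P.anchor p = Γ.src g) :
    P.smul p g = P.act p g e := dif_pos e

theorem proj_smul {p : P.total} {g : Γ.Mor} (e : P.anchor p = Γ.src g) :
    P.proj (P.smul p g) = P.proj p := P.toSetTorsor.proj_smul e

theorem src_div {p q : P.total} (e : P.proj p = P.proj q) : Γ.src (P.div p q) = P.anchor p :=
  P.toSetTorsor.src_div e

theorem smul_div {p q : P.total} (e : P.proj p = P.proj q) : P.smul p (P.div p q) = q :=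
  P.toSetTorsor.smul_div e

theorem div_smul {p : P.total} {g : Γ.Mor} (e : P.anchor p = Γ.src g) :
    P.div p (P.smul p g) = g := P.toSetTorsor.div_smul e

section

variable {T : Type u} [TopologicalSpace T] [CompactlyGeneratedSpace T] {s : Set T}

theorem continuousOn_smul (hs : IsOpen s) {p : T → P.total} {g : T → Γ.Mor}
    (hp : ContinuousOn p s) (hg : ContinuousOn g s) (e : ∀ t ∈ s, P.anchor (p t) = Γ.src (g t)) :
    ContinuousOn (fun t => P.smul (p t) (g t)) s :=
  continuousOn_of_kify (R := fun x => P.anchor x.1 = Γ.src x.2)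
    (F := fun x => P.act x.1.1 x.1.2 x.2) P.continuous_act hs hp hg e
    fun t ht => P.smul_eq (e t ht)

theorem continuousOn_div (hs : IsOpen s) {p q : T → P.total} (hp : ContinuousOn p s)
    (hq : ContinuousOn q s) (e : ∀ t ∈ s, P.proj (p t) = P.proj (q t)) :
    ContinuousOn (fun t => P.div (p t) (q t)) s :=
  continuousOn_of_kify (R := fun x => P.proj x.1 = P.proj x.2)
    (F := fun x => (P.shearInv ⟨x⟩).val.1.2)
    (continuous_snd.comp (continuous_subtype_val.comp
      (Kify.continuous_val.comp P.continuous_shearInv))) hs hp hq e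
    fun t ht => dif_pos (e t ht)

end

namespace Hom

variable {P} {Q : Torsor Γ} (φ : P ⟶ Q)

theorem map_smul {p : P.total} {g : Γ.Mor} (e : P.anchor p = Γ.src g) :
    φ.totalMap (P.smul p g) = Q.smul (φ.totalMap p) g := by
  rw [P.smul_eq e, Q.smul_eq ((φ.anchor_map p).trans e), φ.map_act]

theorem div_map {p q : P.total} (e : P.proj p = P.proj q) :
    Q.div (φ.totalMap p) (φ.totalMap q) = P.div p q := by
  have h := (P.src_div e).symm
  rw [← P.smul_div e, φ.map_smul h, P.div_smul h, Q.div_smul ((φ.anchor_map p).trans h)]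

theorem injective_of_proj_eq {p q : P.total} (e : P.proj p = P.proj q)
    (h : φ.totalMap p = φ.totalMap q) : p = q := by
  have h1 := φ.div_map e
  have h2 := φ.div_map (p := p) (q := p) rfl
  rw [← P.smul_div e, ← h1, ← h, h2, P.smul_div rfl]

/-- Together with `injective_of_proj_eq`: a morphism of torsors is bijective on fibres. Any point of
the fibre over `b` is moved to the required one by an arrow computed in `Q`. -/
theorem exists_lift {b : P.base} {q : Q.total} (h : Q.proj q = φ.baseMap b) :
    ∃ p, P.proj p = b ∧ φ.totalMap p = q := by
  obtain ⟨U, σ, -, hb, -, hσ⟩ := P.exists_section b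
  have e : Q.proj (φ.totalMap (σ b)) = Q.proj q := by rw [φ.proj_map, hσ b hb, h]
  have e' : P.anchor (σ b) = Γ.src (Q.div (φ.totalMap (σ b)) q) := by
    rw [Q.src_div e, φ.anchor_map]
  exact ⟨P.smul (σ b) (Q.div (φ.totalMap (σ b)) q), (P.proj_smul e').trans (hσ b hb),
    (φ.map_smul e').trans (Q.smul_div e)⟩

/-- `P` has the topology of the pullback of `Q`: near a point, `l` is a local section of `P` acted
on by its difference from `l`, and `φ` preserves differences, so this one may be computed in `Q`. -/
theorem continuousOn_of_comp {T : Type u} [TopologicalSpace T] [CompactlyGeneratedSpace T]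
    {s : Set T} (hs : IsOpen s) {l : T → P.total} (hb : ContinuousOn (fun t => P.proj (l t)) s)
    (hq : ContinuousOn (fun t => φ.totalMap (l t)) s) : ContinuousOn l s := by
  intro t₀ ht₀
  obtain ⟨U, σ, hU, hb₀, hσc, hσ⟩ := P.exists_section (P.proj (l t₀))
  let s' : Set T := s ∩ (fun t => P.proj (l t)) ⁻¹' U
  have hs' : IsOpen s' := hb.isOpen_inter_preimage hs hU
  have hb' := hb.mono (Set.inter_subset_left : s' ⊆ s)
  have hq' := hq.mono (Set.inter_subset_left : s' ⊆ s)
  have hσl : ContinuousOn (fun t => σ (P.proj (l t))) s' := hσc.comp hb' fun t ht => ht.2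
  have hφσ : ContinuousOn (fun t => φ.totalMap (σ (P.proj (l t)))) s' :=
    (map_continuous (ConcreteCategory.hom φ.totalMap)).comp_continuousOn hσl
  have e : ∀ t ∈ s', P.proj (σ (P.proj (l t))) = P.proj (l t) := fun t ht => hσ _ ht.2
  have hd := Q.continuousOn_div hs' hφσ hq' fun t ht => by rw [φ.proj_map, φ.proj_map, e t ht]
  have hd' : ContinuousOn (fun t => P.div (σ (P.proj (l t))) (l t)) s' :=
    hd.congr fun t ht => (φ.div_map (e t ht)).symm
  have h := P.continuousOn_smul hs' hσl hd' fun t ht => (P.src_div (e t ht)).symm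
  have hl : ContinuousOn l s' := h.congr fun t ht => (P.smul_div (e t ht)).symm
  exact (hl.continuousAt (hs'.mem_nhds ⟨ht₀, hb₀⟩)).continuousWithinAt

end Hom

end Torsor

/-! ## Torsors from local sections -/

namespace SetTorsor

variable {Γ : TopGroupoid.{u}} {B : CGTop.{u}}

/-- A family of local sections of a set-theoretic torsor with continuous transition functions. -/
structure Atlas (S : SetTorsor Γ B) where
  /-- The index set. -/
  ι : Type u
  /-- The domain of a local section. -/
  dom : ι → Set B
  /-- The local section. -/
  sec : ι → B → S.E
  isOpen_dom : ∀ j, IsOpen (dom j)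
  proj_sec : ∀ {j x}, x ∈ dom j → S.proj (sec j x) = x
  continuousOn_div_sec : ∀ j k,
    ContinuousOn (fun x => S.div (sec j x) (sec k x)) (dom j ∩ dom k)
  exists_mem_dom : ∀ x, ∃ j, x ∈ dom j

namespace Atlas

variable {S : SetTorsor Γ B} (𝔸 : S.Atlas)

/-- The total space of the torsor given by an atlas. -/
def Total (_ : S.Atlas) : Type u := S.E

/-- The domain of a local trivialization. -/
abbrev ChartDomain (j : 𝔸.ι) : Type u :=
  Kify {x : 𝔸.dom j × Γ.Mor // S.anchor (𝔸.sec j x.1) = Γ.src x.2}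

/-- The local trivialization given by a local section. -/
def chart (j : 𝔸.ι) (x : 𝔸.ChartDomain j) : 𝔸.Total := S.smul (𝔸.sec j x.val.1.1) x.val.1.2

/-- With the final topology for the charts, `Total` is compactly generated because the chart domains
are, and maps out of it are tested on charts. Maps into it are governed by `continuousOn_total`. -/
instance : TopologicalSpace 𝔸.Total :=
  ⨆ j, TopologicalSpace.coinduced (𝔸.chart j) inferInstance

theorem isOpen_iff {s : Set 𝔸.Total} : IsOpen s ↔ ∀ j, IsOpen (𝔸.chart j ⁻¹' s) := by
  rw [isOpen_iSup_iff]
  exact forall_congr' fun j => isOpen_coinduced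

theorem continuous_dom_iff {Z : Type*} [TopologicalSpace Z] {f : 𝔸.Total → Z} :
    Continuous f ↔ ∀ j, Continuous (f ∘ 𝔸.chart j) := by
  rw [continuous_iSup_dom]
  exact forall_congr' fun j => continuous_coinduced_dom

theorem continuous_chart (j : 𝔸.ι) : Continuous (𝔸.chart j) :=
  𝔸.continuous_dom_iff.1 continuous_id j

instance : CompactlyGeneratedSpace 𝔸.Total :=
  uCompactlyGeneratedSpace_of_continuous_maps fun _ hf =>
    𝔸.continuous_dom_iff.2 fun j =>
      continuous_from_uCompactlyGeneratedSpace _ fun K g =>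
        hf K ⟨fun k => 𝔸.chart j (g k), (𝔸.continuous_chart j).comp g.continuous⟩

theorem proj_chart {j : 𝔸.ι} (x : 𝔸.ChartDomain j) :
    S.proj (𝔸.chart j x) = x.val.1.1 :=
  (S.proj_smul x.val.2).trans (𝔸.proj_sec x.val.1.1.2)

theorem continuous_fst_val (j : 𝔸.ι) :
    Continuous fun x : 𝔸.ChartDomain j => (x.val.1.1 : B) :=
  continuous_subtype_val.comp
    (continuous_fst.comp (continuous_subtype_val.comp Kify.continuous_val))

theorem continuous_snd_val (j : 𝔸.ι) : Continuous fun x : 𝔸.ChartDomain j => x.val.1.2 :=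
  continuous_snd.comp (continuous_subtype_val.comp Kify.continuous_val)

theorem continuous_proj : Continuous (fun e : 𝔸.Total => S.proj e) :=
  𝔸.continuous_dom_iff.2 fun j => (𝔸.continuous_fst_val j).congr fun x => (𝔸.proj_chart x).symm

theorem continuous_anchor : Continuous (fun e : 𝔸.Total => S.anchor e) :=
  𝔸.continuous_dom_iff.2 fun j => (Γ.tgt.continuous.comp (𝔸.continuous_snd_val j)).congr
    fun x => (S.anchor_smul x.val.2).symm

/-- Continuity of the inverse of the chart `j`: read in the chart `k`, the coordinate is the
transition function from `j` to `k` times the group coordinate. -/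
theorem continuousOn_div (j : 𝔸.ι) :
    ContinuousOn (fun e : 𝔸.Total => S.div (𝔸.sec j (S.proj e)) e)
      ((fun e : 𝔸.Total => S.proj e) ⁻¹' 𝔸.dom j) := by
  have hs := (𝔸.isOpen_dom j).preimage 𝔸.continuous_proj
  rw [continuousOn_open_iff hs]
  intro V hV
  refine 𝔸.isOpen_iff.2 fun k => ?_
  let s : Set (𝔸.ChartDomain k) := 𝔸.chart k ⁻¹' ((fun e : 𝔸.Total => S.proj e) ⁻¹' 𝔸.dom j)
  have hs' : IsOpen s := hs.preimage (𝔸.continuous_chart k)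
  have hmem : ∀ x ∈ s, (x.val.1.1 : B) ∈ 𝔸.dom j ∩ 𝔸.dom k := fun x hx =>
    ⟨by rw [← 𝔸.proj_chart x]; exact hx, x.val.1.1.2⟩
  have h1 : ContinuousOn (fun x : 𝔸.ChartDomain k =>
      S.div (𝔸.sec j x.val.1.1) (𝔸.sec k x.val.1.1)) s :=
    (𝔸.continuousOn_div_sec j k).comp (𝔸.continuous_fst_val k).continuousOn hmem
  have hproj : ∀ x ∈ s, S.proj (𝔸.sec j x.val.1.1) = S.proj (𝔸.sec k x.val.1.1) := fun x hx => by
    rw [𝔸.proj_sec (hmem x hx).1, 𝔸.proj_sec (hmem x hx).2]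
  have h2 := Γ.continuousOn_mul hs' h1 (𝔸.continuous_snd_val k).continuousOn fun x hx => by
    rw [S.tgt_div (hproj x hx), x.val.2]
  have h3 : ContinuousOn (fun x : 𝔸.ChartDomain k =>
      S.div (𝔸.sec j (S.proj (𝔸.chart k x))) (𝔸.chart k x)) s :=
    h2.congr fun x hx => by
      simp only [𝔸.proj_chart]
      exact S.div_smul_right (hproj x hx) x.val.2
  exact h3.isOpen_inter_preimage hs' hV

/-- A map to the total space is continuous if its projection and its coordinates in the local
trivializations are. -/
theorem continuousOn_total {T : Type u} [TopologicalSpace T] [CompactlyGeneratedSpace T]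
    {s : Set T} (hs : IsOpen s) {f : T → 𝔸.Total} (hp : ContinuousOn (fun t => S.proj (f t)) s)
    (hd : ∀ j, ContinuousOn (fun t => S.div (𝔸.sec j (S.proj (f t))) (f t))
      (s ∩ (fun t => S.proj (f t)) ⁻¹' 𝔸.dom j)) : ContinuousOn f s := by
  intro t₀ ht₀
  obtain ⟨j, hj⟩ := 𝔸.exists_mem_dom (S.proj (f t₀))
  let s' := s ∩ (fun t => S.proj (f t)) ⁻¹' 𝔸.dom j
  have hs' : IsOpen s' := hp.isOpen_inter_preimage hs (𝔸.isOpen_dom j)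
  have := compactlyGeneratedSpace_of_isOpen_subtype hs'
  have hproj : ∀ t ∈ s', S.proj (𝔸.sec j (S.proj (f t))) = S.proj (f t) :=
    fun t ht => 𝔸.proj_sec ht.2
  have h1 := (hp.mono (Set.inter_subset_left : s' ⊆ s)).domRestrict
  have h2 := (hd j).domRestrict
  have h3 : Continuous fun t : s' =>
      (⟨(⟨S.proj (f t), t.2.2⟩, S.div (𝔸.sec j (S.proj (f t))) (f t)),
        (S.src_div (hproj t t.2)).symm⟩ :
          {x : 𝔸.dom j × Γ.Mor // S.anchor (𝔸.sec j x.1) = Γ.src x.2}) :=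
    ((h1.subtype_mk _).prodMk h2).subtype_mk _
  have h4 := (𝔸.continuous_chart j).comp (Kify.continuous_lift _ h3)
  have h5 : ContinuousOn f s' := by
    rw [continuousOn_iff_continuous_domRestrict]
    exact h4.congr fun t => S.smul_div (hproj t t.2)
  exact (h5.continuousAt (hs'.mem_nhds ⟨ht₀, hj⟩)).continuousWithinAt

theorem continuous_total {T : Type u} [TopologicalSpace T] [CompactlyGeneratedSpace T]
    {f : T → 𝔸.Total} (hp : Continuous fun t => S.proj (f t))
    (hd : ∀ j, ContinuousOn (fun t => S.div (𝔸.sec j (S.proj (f t))) (f t))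
      ((fun t => S.proj (f t)) ⁻¹' 𝔸.dom j)) : Continuous f := by
  rw [← continuousOn_univ]
  refine 𝔸.continuousOn_total isOpen_univ hp.continuousOn fun j => ?_
  rw [Set.univ_inter]
  exact hd j

theorem continuous_smul : Continuous (Y := 𝔸.Total)
    (fun x : Kify {x : 𝔸.Total × Γ.Mor // S.anchor x.1 = Γ.src x.2} =>
      S.smul x.val.1.1 x.val.1.2) := by
  have hfst : Continuous fun x : Kify {x : 𝔸.Total × Γ.Mor // S.anchor x.1 = Γ.src x.2} =>
      x.val.1.1 := continuous_fst.comp (continuous_subtype_val.comp Kify.continuous_val)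
  have hsnd : Continuous fun x : Kify {x : 𝔸.Total × Γ.Mor // S.anchor x.1 = Γ.src x.2} =>
      x.val.1.2 := continuous_snd.comp (continuous_subtype_val.comp Kify.continuous_val)
  have hpr : ∀ x : Kify {x : 𝔸.Total × Γ.Mor // S.anchor x.1 = Γ.src x.2},
      S.proj (S.smul x.val.1.1 x.val.1.2) = S.proj x.val.1.1 := fun x => S.proj_smul x.val.2
  refine 𝔸.continuous_total ((𝔸.continuous_proj.comp hfst).congr fun x => (hpr x).symm)
    fun j => ?_
  simp only [hpr]
  have hs := (𝔸.isOpen_dom j).preimage (𝔸.continuous_proj.comp hfst)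
  have hd := (𝔸.continuousOn_div j).comp hfst.continuousOn (Set.mapsTo_preimage _ _)
  have hproj : ∀ x : Kify {x : 𝔸.Total × Γ.Mor // S.anchor x.1 = Γ.src x.2},
      S.proj x.val.1.1 ∈ 𝔸.dom j →
      S.proj (𝔸.sec j (S.proj x.val.1.1)) = S.proj x.val.1.1 := fun x hx => 𝔸.proj_sec hx
  refine (Γ.continuousOn_mul hs hd hsnd.continuousOn fun x hx => ?_).congr fun x hx => ?_
  · exact (S.tgt_div (hproj x hx)).trans x.val.2
  · exact S.div_smul_right (hproj x hx) x.val.2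

/-- For a section `σ` near the common projection, the difference of `p` and `q` is the inverse of
that of `σ` and `p`, times that of `σ` and `q`. -/
theorem continuous_div : Continuous
    (fun x : Kify {x : 𝔸.Total × 𝔸.Total // S.proj x.1 = S.proj x.2} =>
      S.div x.val.1.1 x.val.1.2) := by
  have hfst : Continuous fun x : Kify {x : 𝔸.Total × 𝔸.Total // S.proj x.1 = S.proj x.2} =>
      x.val.1.1 := continuous_fst.comp (continuous_subtype_val.comp Kify.continuous_val)
  have hsnd : Continuous fun x : Kify {x : 𝔸.Total × 𝔸.Total // S.proj x.1 = S.proj x.2} =>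
      x.val.1.2 := continuous_snd.comp (continuous_subtype_val.comp Kify.continuous_val)
  rw [continuous_iff_continuousAt]
  intro x₀
  obtain ⟨j, hj⟩ := 𝔸.exists_mem_dom (S.proj x₀.val.1.1)
  let s : Set (Kify {x : 𝔸.Total × 𝔸.Total // S.proj x.1 = S.proj x.2}) :=
    (fun x => S.proj x.val.1.1) ⁻¹' 𝔸.dom j
  have hs : IsOpen s := (𝔸.isOpen_dom j).preimage (𝔸.continuous_proj.comp hfst)
  have hmem : ∀ x ∈ s, S.proj x.val.1.2 ∈ 𝔸.dom j := fun x hx => by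
    rw [← x.val.2]; exact hx
  have hd1 := (𝔸.continuousOn_div j).comp hfst.continuousOn (s := s) fun x hx => hx
  have hd2 := (𝔸.continuousOn_div j).comp hsnd.continuousOn (s := s) hmem
  have h1 : ∀ x ∈ s, S.proj (𝔸.sec j (S.proj x.val.1.1)) = S.proj x.val.1.1 :=
    fun x hx => 𝔸.proj_sec hx
  have h2 : ∀ x ∈ s, S.proj (𝔸.sec j (S.proj x.val.1.2)) = S.proj x.val.1.2 :=
    fun x hx => 𝔸.proj_sec (hmem x hx)
  have h := Γ.continuousOn_mul hs (Γ.inv.continuous.comp_continuousOn hd1) hd2 fun x hx => by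
    change Γ.tgt (Γ.inv (S.div _ _)) = Γ.src (S.div _ _)
    rw [Γ.tgt_inv, S.src_div (h1 x hx), S.src_div (h2 x hx), x.val.2]
  refine (h.congr fun x hx => ?_).continuousAt (hs.mem_nhds hj)
  change _ = Γ.mul (Γ.inv (S.div _ _)) (S.div _ _)
  rw [S.inv_div (h1 x hx), ← x.val.2, S.mul_div (h1 x hx).symm ((h1 x hx).trans x.val.2)]

theorem continuousOn_sec (j : 𝔸.ι) :
    ContinuousOn (Y := 𝔸.Total) (fun x => 𝔸.sec j x) (𝔸.dom j) := by
  refine 𝔸.continuousOn_total (𝔸.isOpen_dom j)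
    (continuousOn_id.congr fun x hx => 𝔸.proj_sec hx) fun k => ?_
  have hx : ∀ x ∈ 𝔸.dom j ∩ (fun t => S.proj (𝔸.sec j t)) ⁻¹' 𝔸.dom k,
      x ∈ 𝔸.dom k ∩ 𝔸.dom j := fun x hx =>
    ⟨by rw [← 𝔸.proj_sec hx.1]; exact hx.2, hx.1⟩
  refine ((𝔸.continuousOn_div_sec k j).mono hx).congr fun x hx => ?_
  simp only [𝔸.proj_sec hx.1]

/-- The torsor given by an atlas of local sections. -/
noncomputable def toTorsor : Torsor Γ where
  base := B
  total := CompactlyGenerated.of 𝔸.Total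
  proj := ⟨fun e => S.proj e, 𝔸.continuous_proj⟩
  anchor := ⟨fun e => S.anchor e, 𝔸.continuous_anchor⟩
  act p g _ := S.smul p g
  continuous_act := 𝔸.continuous_smul
  proj_act _ _ e := S.proj_smul e
  anchor_act _ _ e := S.anchor_smul e
  act_unit p := S.smul_unit p
  act_comp p g h e e' := by
    rw [← Γ.mul_eq e']
    exact S.smul_mul e e'
  shear := by
    rw [isHomeomorph_iff_exists_inverse]
    refine ⟨Kify.continuous_lift _ (Continuous.subtype_mk
        ((continuous_fst.comp (continuous_subtype_val.comp Kify.continuous_val)).prodMk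
          𝔸.continuous_smul) _),
      fun y => ⟨⟨(y.val.1.1, S.div y.val.1.1 y.val.1.2), (S.src_div y.val.2).symm⟩⟩, ?_, ?_, ?_⟩
    · intro x
      exact Kify.ext (Subtype.ext (Prod.ext rfl (S.div_smul x.val.2)))
    · intro y
      exact Kify.ext (Subtype.ext (Prod.ext rfl (S.smul_div y.val.2)))
    · exact Kify.continuous_lift _ (Continuous.subtype_mk
        ((continuous_fst.comp (continuous_subtype_val.comp Kify.continuous_val)).prodMk
          𝔸.continuous_div) _)
  exists_local_section b := by
    obtain ⟨j, hj⟩ := 𝔸.exists_mem_dom b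
    exact ⟨𝔸.dom j, ⟨_, (𝔸.continuousOn_sec j).domRestrict⟩, 𝔸.isOpen_dom j, hj,
      fun x => 𝔸.proj_sec x.2⟩

end Atlas

end SetTorsor

/-! ## Gluing squares -/

/-- A pushout square of spaces along a closed local neighbourhood deformation retract `i` and a
closed map `f` whose fibres can be separated in `Y`. -/
structure GluingSquare {A Y Z U : Type u} [TopologicalSpace A] [TopologicalSpace Y]
    [TopologicalSpace Z] [TopologicalSpace U] (i : A → Y) (f : A → Z) (inY : Y → U)
    (inZ : Z → U) : Prop where
  isClosedEmbedding : IsClosedEmbedding i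
  isLocalNDR : IsLocalNDR (Set.range i)
  continuous_f : Continuous f
  isClosedMap_f : IsClosedMap f
  exists_disjoint : ∀ z, ∃ N : A → Set Y, (∀ a, f a = z → IsOpen (N a) ∧ i a ∈ N a) ∧
    ∀ a b, f a = z → f b = z → a ≠ b → Disjoint (N a) (N b)
  continuous_inY : Continuous inY
  continuous_inZ : Continuous inZ
  comm : ∀ a, inY (i a) = inZ (f a)
  exists_rep : ∀ x, (∃ y, inY y = x) ∨ ∃ z, inZ z = x
  inZ_injective : Function.Injective inZ
  inY_eq_inZ : ∀ {y z}, inY y = inZ z → ∃ a, i a = y ∧ f a = z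
  inY_injOn : Set.InjOn inY (Set.range i)ᶜ
  isOpen_of_preimage : ∀ {O : Set U}, IsOpen (inY ⁻¹' O) → IsOpen (inZ ⁻¹' O) → IsOpen O

namespace GluingSquare

variable {A Y Z U : Type u} [TopologicalSpace A] [TopologicalSpace Y]
    [TopologicalSpace Z] [TopologicalSpace U] {i : A → Y} {f : A → Z} {inY : Y → U}
    {inZ : Z → U} (hG : GluingSquare i f inY inZ)

include hG

theorem continuousOn_of_comp {X : Type*} [TopologicalSpace X] {O : Set U} (hO : IsOpen O)
    {k : U → X} (hY : ContinuousOn (k ∘ inY) (inY ⁻¹' O))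
    (hZ : ContinuousOn (k ∘ inZ) (inZ ⁻¹' O)) : ContinuousOn k O := by
  rw [continuousOn_open_iff hO]
  intro V hV
  exact hG.isOpen_of_preimage
    (hY.isOpen_inter_preimage (hO.preimage hG.continuous_inY) hV)
    (hZ.isOpen_inter_preimage (hO.preimage hG.continuous_inZ) hV)

theorem inY_eq_iff {y y' : Y} (h : inY y = inY y') :
    y = y' ∨ ∃ a a', i a = y ∧ i a' = y' ∧ f a = f a' := by
  by_cases hy : y ∈ Set.range i
  · obtain ⟨a, rfl⟩ := hy
    obtain ⟨a', ha', hf⟩ := hG.inY_eq_inZ (h.symm.trans (hG.comm a))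
    exact Or.inr ⟨a, a', rfl, ha', hf.symm⟩
  · by_cases hy' : y' ∈ Set.range i
    · obtain ⟨a, rfl⟩ := hy'
      obtain ⟨a', ha', -⟩ := hG.inY_eq_inZ (h.trans (hG.comm a))
      exact (hy ⟨a', ha'⟩).elim
    · exact Or.inl (hG.inY_injOn hy hy' h)

theorem exists_desc {E : Type*} {α : Y → E} {β : Z → E} {O : Set U}
    (h : ∀ a, inZ (f a) ∈ O → α (i a) = β (f a)) :
    ∃ σ : U → E, (∀ y, inY y ∈ O → σ (inY y) = α y) ∧ ∀ z, inZ z ∈ O → σ (inZ z) = β z := by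
  have key : ∀ x, ∃ e, (∀ y, inY y = x → x ∈ O → e = α y) ∧ ∀ z, inZ z = x → x ∈ O → e = β z := by
    intro x
    by_cases hx : ∃ z, inZ z = x
    · obtain ⟨z, rfl⟩ := hx
      refine ⟨β z, fun y hy hO => ?_, fun z' hz' _ => congrArg β (hG.inZ_injective hz').symm⟩
      obtain ⟨a, rfl, rfl⟩ := hG.inY_eq_inZ hy
      exact (h a hO).symm
    · obtain ⟨y, rfl⟩ | h' := hG.exists_rep x
      · refine ⟨α y, fun y' hy' hO => ?_, fun z hz => (hx ⟨z, hz⟩).elim⟩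
        rcases hG.inY_eq_iff hy' with rfl | ⟨a, a', -, rfl, -⟩
        · rfl
        · exact (hx ⟨f a', (hG.comm a').symm⟩).elim
      · exact (hx h').elim
  choose σ hσ using key
  exact ⟨σ, fun y hy => (hσ _).1 y rfl hy, fun z hz => (hσ _).2 z rfl hz⟩

/-- Saturated open sets: open sets `V₁` of `Y` and `Z₁` of `Z` with the same preimage in `A` are the
preimages of an open set of the pushout. -/
theorem exists_isOpen {V₁ : Set Y} {Z₁ : Set Z} (hV₁ : IsOpen V₁) (hZ₁ : IsOpen Z₁)
    (h : ∀ a, i a ∈ V₁ ↔ f a ∈ Z₁) :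
    ∃ O : Set U, IsOpen O ∧ inY ⁻¹' O = V₁ ∧ inZ ⁻¹' O = Z₁ := by
  have h1 : inY ⁻¹' (inZ '' Z₁ ∪ inY '' V₁) = V₁ := by
    refine Set.Subset.antisymm ?_ fun y hy => Or.inr ⟨y, hy, rfl⟩
    rintro y (⟨z, hz, e⟩ | ⟨y', hy', e⟩)
    · obtain ⟨a, rfl, rfl⟩ := hG.inY_eq_inZ e.symm
      exact (h a).2 hz
    · rcases hG.inY_eq_iff e with rfl | ⟨a, a', rfl, rfl, hf⟩
      · exact hy'
      · rw [h] at hy' ⊢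
        rwa [← hf]
  have h2 : inZ ⁻¹' (inZ '' Z₁ ∪ inY '' V₁) = Z₁ := by
    refine Set.Subset.antisymm ?_ fun y hy => Or.inl ⟨y, hy, rfl⟩
    rintro z (⟨z', hz, e⟩ | ⟨y, hy, e⟩)
    · rwa [← hG.inZ_injective e]
    · obtain ⟨a, rfl, rfl⟩ := hG.inY_eq_inZ e
      exact (h a).1 hy
  exact ⟨_, hG.isOpen_of_preimage (by rwa [h1]) (by rwa [h2]), h1, h2⟩

end GluingSquare

/-! ## Morphisms out of a torsor over a pushout -/

namespace Torsor

variable {Γ : TopGroupoid.{u}}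

theorem totalMap_comm {PA PY PZ P : Torsor Γ} {φ : PA ⟶ PY} {ψ : PA ⟶ PZ} {η : PY ⟶ P}
    {ζ : PZ ⟶ P} (h : φ ≫ η = ψ ≫ ζ) (r : PA.total) :
    η.totalMap (φ.totalMap r) = ζ.totalMap (ψ.totalMap r) :=
  congrArg (fun θ : PA ⟶ P => θ.totalMap r) h

section Desc

variable {PA PY PZ P P' : Torsor Γ} {φ : PA ⟶ PY} {ψ : PA ⟶ PZ} {η : PY ⟶ P} {ζ : PZ ⟶ P}

theorem exists_total_rep (hG : GluingSquare φ.baseMap ψ.baseMap η.baseMap ζ.baseMap)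
    (p : P.total) : (∃ q, η.totalMap q = p) ∨ ∃ q, ζ.totalMap q = p := by
  rcases hG.exists_rep (P.proj p) with ⟨y, hy⟩ | ⟨z, hz⟩
  · obtain ⟨q, -, hq⟩ := η.exists_lift hy.symm
    exact Or.inl ⟨q, hq⟩
  · obtain ⟨q, -, hq⟩ := ζ.exists_lift hz.symm
    exact Or.inr ⟨q, hq⟩

theorem totalMap_injective {P Q : Torsor Γ} (φ : P ⟶ Q) (h : Function.Injective φ.baseMap) :
    Function.Injective φ.totalMap := fun p q e =>
  φ.injective_of_proj_eq (h (by rw [← φ.proj_map, ← φ.proj_map, e])) e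

/-- The total spaces form a pushout of sets because the bases do and torsor morphisms are bijective
on fibres: two points identified in `P` are equal or come from points of `PA`. -/
theorem exists_totalMap_desc (hG : GluingSquare φ.baseMap ψ.baseMap η.baseMap ζ.baseMap)
    (comm : φ ≫ η = ψ ≫ ζ) (η' : PY ⟶ P') (ζ' : PZ ⟶ P') (comm' : φ ≫ η' = ψ ≫ ζ') :
    ∃ θ : P.total → P'.total, (∀ q, θ (η.totalMap q) = η'.totalMap q) ∧
      ∀ q, θ (ζ.totalMap q) = ζ'.totalMap q := by
  have hζ := totalMap_injective ζ hG.inZ_injective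
  have key : ∀ p, ∃ p', (∀ q, η.totalMap q = p → p' = η'.totalMap q) ∧
      ∀ q, ζ.totalMap q = p → p' = ζ'.totalMap q := by
    intro p
    by_cases hp : ∃ q, ζ.totalMap q = p
    · obtain ⟨q, rfl⟩ := hp
      refine ⟨ζ'.totalMap q, fun q' hq' => ?_, fun q' hq' => by rw [hζ hq']⟩
      have hpr : η.baseMap (PY.proj q') = ζ.baseMap (PZ.proj q) := by
        rw [← η.proj_map, ← ζ.proj_map, hq']
      obtain ⟨a, ha, -⟩ := hG.inY_eq_inZ hpr
      obtain ⟨r, -, rfl⟩ := φ.exists_lift ha.symm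
      rw [totalMap_comm comm] at hq'
      rw [← hζ hq', totalMap_comm comm']
    · obtain ⟨q, rfl⟩ | h' := exists_total_rep hG p
      · refine ⟨η'.totalMap q, fun q' hq' => ?_, fun q' hq' => (hp ⟨q', hq'⟩).elim⟩
        have hpr : η.baseMap (PY.proj q') = η.baseMap (PY.proj q) := by
          rw [← η.proj_map, ← η.proj_map, hq']
        rcases hG.inY_eq_iff hpr with h | ⟨-, a, -, ha, -⟩
        · rw [η.injective_of_proj_eq h hq']
        · obtain ⟨r, -, rfl⟩ := φ.exists_lift ha.symm
          exact (hp ⟨_, (totalMap_comm comm r).symm⟩).elim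
      · exact (hp h').elim
  choose θ hθ using key
  exact ⟨θ, fun q => (hθ _).1 q rfl, fun q => (hθ _).2 q rfl⟩

/-- An equivariant map out of a torsor over a pushout is continuous if its restrictions are. -/
theorem continuous_desc (hG : GluingSquare φ.baseMap ψ.baseMap η.baseMap ζ.baseMap)
    {θ : P.total → P'.total}
    (hη : Continuous fun q => θ (η.totalMap q)) (hζ : Continuous fun q => θ (ζ.totalMap q))
    (han : ∀ p, P'.anchor (θ p) = P.anchor p)
    (hsm : ∀ {p g}, P.anchor p = Γ.src g → θ (P.smul p g) = P'.smul (θ p) g) :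
    Continuous θ := by
  rw [continuous_iff_continuousAt]
  intro p₀
  obtain ⟨O, σ, hO, hp₀, hσc, hσ⟩ := P.exists_section (P.proj p₀)
  -- By equivariance `θ p` is `θ (σ x)` acted on by the difference of `σ x` and `p`, where `x =
  -- P.proj p`, so it suffices to treat `θ ∘ σ`. Its continuity is tested over `Y` and `Z`, where
  -- `σ` pulls back to continuous sections `l`.
  have hθσ : ContinuousOn (fun x => θ (σ x)) O := by
    refine hG.continuousOn_of_comp hO ?_ ?_
    · have hO' : IsOpen (η.baseMap ⁻¹' O) := hO.preimage hG.continuous_inY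
      have hl : ∀ y, ∃ q, η.baseMap y ∈ O → PY.proj q = y ∧ η.totalMap q = σ (η.baseMap y) := by
        intro y
        by_cases hy : η.baseMap y ∈ O
        · obtain ⟨q, hq⟩ := η.exists_lift (hσ _ hy)
          exact ⟨q, fun _ => hq⟩
        · obtain ⟨-, s, -, -, -, -⟩ := PY.exists_section y
          exact ⟨s y, fun h => (hy h).elim⟩
      choose l hl using hl
      have hlc : ContinuousOn l (η.baseMap ⁻¹' O) := by
        refine η.continuousOn_of_comp hO' (continuousOn_id.congr fun y hy => (hl y hy).1) ?_
        exact (hσc.comp hG.continuous_inY.continuousOn fun y hy => hy).congr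
          fun y hy => (hl y hy).2
      refine (hη.comp_continuousOn hlc).congr fun y hy => ?_
      simp only [Function.comp, (hl y hy).2]
    · have hO' : IsOpen (ζ.baseMap ⁻¹' O) := hO.preimage hG.continuous_inZ
      have hl : ∀ y, ∃ q, ζ.baseMap y ∈ O → PZ.proj q = y ∧ ζ.totalMap q = σ (ζ.baseMap y) := by
        intro y
        by_cases hy : ζ.baseMap y ∈ O
        · obtain ⟨q, hq⟩ := ζ.exists_lift (hσ _ hy)
          exact ⟨q, fun _ => hq⟩
        · obtain ⟨-, s, -, -, -, -⟩ := PZ.exists_section y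
          exact ⟨s y, fun h => (hy h).elim⟩
      choose l hl using hl
      have hlc : ContinuousOn l (ζ.baseMap ⁻¹' O) := by
        refine ζ.continuousOn_of_comp hO' (continuousOn_id.congr fun y hy => (hl y hy).1) ?_
        exact (hσc.comp hG.continuous_inZ.continuousOn fun y hy => hy).congr
          fun y hy => (hl y hy).2
      refine (hζ.comp_continuousOn hlc).congr fun y hy => ?_
      simp only [Function.comp, (hl y hy).2]
  have hs : IsOpen (P.proj ⁻¹' O) := hO.preimage P.proj.continuous
  have hmap : Set.MapsTo P.proj (P.proj ⁻¹' O) O := fun _ h => h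
  have h1 := hθσ.comp P.proj.continuous.continuousOn hmap
  have e : ∀ p ∈ P.proj ⁻¹' O, P.proj (σ (P.proj p)) = P.proj p := fun p hp => hσ _ hp
  have h2 := P.continuousOn_div hs (hσc.comp P.proj.continuous.continuousOn hmap)
    continuousOn_id e
  have h3 := P'.continuousOn_smul hs h1 h2 fun p hp =>
    (han _).trans (P.src_div (e p hp)).symm
  refine (h3.congr fun p hp => ?_).continuousAt (hs.mem_nhds hp₀)
  refine Eq.trans ?_ (hsm (P.src_div (e p hp)).symm)
  exact congrArg θ (P.smul_div (e p hp)).symm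

/-- The base map `k` is left free because two objects over `U` have bases that are equal only
propositionally; it is applied with an `eqToHom`. -/
theorem exists_hom_desc (hG : GluingSquare φ.baseMap ψ.baseMap η.baseMap ζ.baseMap)
    (comm : φ ≫ η = ψ ≫ ζ) (η' : PY ⟶ P') (ζ' : PZ ⟶ P') (comm' : φ ≫ η' = ψ ≫ ζ')
    (k : P.base ⟶ P'.base) (hη' : η'.baseMap = η.baseMap ≫ k)
    (hζ' : ζ'.baseMap = ζ.baseMap ≫ k) :
    ∃ θ : P ⟶ P', θ.baseMap = k ∧ η ≫ θ = η' ∧ ζ ≫ θ = ζ' := by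
  obtain ⟨θ, hθη, hθζ⟩ := exists_totalMap_desc hG comm η' ζ' comm'
  have hpr : ∀ p, P'.proj (θ p) = k (P.proj p) := by
    intro p
    obtain ⟨q, rfl⟩ | ⟨q, rfl⟩ := exists_total_rep hG p
    · rw [hθη, η'.proj_map, η.proj_map, hη']
      rfl
    · rw [hθζ, ζ'.proj_map, ζ.proj_map, hζ']
      rfl
  have han : ∀ p, P'.anchor (θ p) = P.anchor p := by
    intro p
    obtain ⟨q, rfl⟩ | ⟨q, rfl⟩ := exists_total_rep hG p
    · rw [hθη, η'.anchor_map, η.anchor_map]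
    · rw [hθζ, ζ'.anchor_map, ζ.anchor_map]
  have hsm : ∀ {p g}, P.anchor p = Γ.src g → θ (P.smul p g) = P'.smul (θ p) g := by
    intro p g e
    obtain ⟨q, rfl⟩ | ⟨q, rfl⟩ := exists_total_rep hG p
    · have e' : PY.anchor q = Γ.src g := (η.anchor_map q).symm.trans e
      rw [← η.map_smul e', hθη, hθη, η'.map_smul e']
    · have e' : PZ.anchor q = Γ.src g := (ζ.anchor_map q).symm.trans e
      rw [← ζ.map_smul e', hθζ, hθζ, ζ'.map_smul e']
  have hc : Continuous θ := continuous_desc hG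
    ((map_continuous (ConcreteCategory.hom η'.totalMap)).congr fun q => (hθη q).symm)
    ((map_continuous (ConcreteCategory.hom ζ'.totalMap)).congr fun q => (hθζ q).symm) han hsm
  refine ⟨⟨k, ConcreteCategory.ofHom (⟨θ, hc⟩ : C(P.total, P'.total)), hpr, han,
    fun p g e => ?_⟩, rfl, Torsor.Hom.ext hη'.symm ?_, Torsor.Hom.ext hζ'.symm ?_⟩
  · have h := hsm e
    rw [P.smul_eq e, P'.smul_eq ((han p).trans e)] at h
    exact h
  · ext q
    exact hθη q
  · ext q
    exact hθζ q

theorem hom_ext_of_gluingSquare (hG : GluingSquare φ.baseMap ψ.baseMap η.baseMap ζ.baseMap)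
    {θ θ' : P ⟶ P'} (hη : η ≫ θ = η ≫ θ') (hζ : ζ ≫ θ = ζ ≫ θ') : θ = θ' := by
  have ht : ∀ p, θ.totalMap p = θ'.totalMap p := by
    intro p
    obtain ⟨q, rfl⟩ | ⟨q, rfl⟩ := exists_total_rep hG p
    · exact congrArg (fun χ : PY ⟶ P' => χ.totalMap q) hη
    · exact congrArg (fun χ : PZ ⟶ P' => χ.totalMap q) hζ
  refine Torsor.Hom.ext ?_ ?_
  · ext b
    obtain ⟨U, σ, -, hb, -, hσ⟩ := P.exists_section b
    rw [← hσ b hb, ← θ.proj_map, ← θ'.proj_map, ht]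
  · ext p
    exact ht p

end Desc

end Torsor

/-! ## Gluing torsors -/

namespace Torsor

variable {Γ : TopGroupoid.{u}}

theorem exists_total_section (P : Torsor Γ) : ∃ s : P.base → P.total, ∀ b, P.proj (s b) = b := by
  have : ∀ b, ∃ p, P.proj p = b := fun b => by
    obtain ⟨U, σ, -, hb, -, hσ⟩ := P.exists_section b
    exact ⟨σ b, hσ b hb⟩
  exact ⟨fun b => (this b).choose, fun b => (this b).choose_spec⟩

variable {PA PY PZ : Torsor Γ} (φ : PA ⟶ PY) (ψ : PA ⟶ PZ) {U : CGTop.{u}}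
  {inY : PY.base ⟶ U} {inZ : PZ.base ⟶ U}
  (hG : GluingSquare φ.baseMap ψ.baseMap inY inZ)

/-- The points of the glued torsor. -/
abbrev GlueTotal : Type u := PZ.total ⊕ {q : PY.total // PY.proj q ∉ Set.range φ.baseMap}

open scoped Classical in
/-- The gluing of two torsors over a pushout, without topology. -/
noncomputable def glue : SetTorsor Γ U where
  E := GlueTotal (PZ := PZ) φ
  proj := Sum.elim (fun p => inZ (PZ.proj p)) fun q => inY (PY.proj q)
  anchor := Sum.elim PZ.anchor fun q => PY.anchor q
  smul
    | Sum.inl p, g => Sum.inl (PZ.smul p g)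
    | Sum.inr q, g => if e : PY.anchor q = Γ.src g then
        Sum.inr ⟨PY.smul q g, by rw [PY.proj_smul e]; exact q.2⟩ else Sum.inr q
  div
    | Sum.inl p, Sum.inl p' => PZ.div p p'
    | Sum.inr q, Sum.inr q' => PY.div q q'
    | Sum.inl p, Sum.inr _ => Γ.unit (PZ.anchor p)
    | Sum.inr q, Sum.inl _ => Γ.unit (PY.anchor q)
  proj_smul {p g} e := by
    rcases p with p | q
    · exact congrArg inZ (PZ.proj_smul e)
    · have e' : PY.anchor q = Γ.src g := e
      simp only [dif_pos e']
      exact congrArg inY (PY.proj_smul e')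
  anchor_smul {p g} e := by
    rcases p with p | q
    · exact PZ.toSetTorsor.anchor_smul e
    · have e' : PY.anchor q = Γ.src g := e
      simp only [dif_pos e']
      exact PY.toSetTorsor.anchor_smul e'
  smul_unit p := by
    rcases p with p | q
    · exact congrArg Sum.inl (PZ.toSetTorsor.smul_unit p)
    · have e' : PY.anchor q = Γ.src (Γ.unit (PY.anchor q)) := (Γ.src_unit _).symm
      exact (dif_pos e').trans (congrArg Sum.inr (Subtype.ext (PY.toSetTorsor.smul_unit q.1)))
  smul_mul {p g h} e e' := by
    rcases p with p | q
    · exact congrArg Sum.inl (PZ.toSetTorsor.smul_mul e e')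
    · have e1 : PY.anchor q = Γ.src g := e
      have e2 : PY.anchor q = Γ.src (Γ.mul g h) := by rw [Γ.src_mul e', e1]
      have e3 : PY.anchor (PY.smul q g) = Γ.src h := (PY.toSetTorsor.anchor_smul e1).trans e'
      simp only [dif_pos e1, dif_pos e2, dif_pos e3]
      exact congrArg Sum.inr (Subtype.ext (PY.toSetTorsor.smul_mul e1 e'))
  src_div {p q} e := by
    rcases p with p | p <;> rcases q with q | q
    · exact PZ.src_div (hG.inZ_injective e)
    · exact Γ.src_unit _
    · exact Γ.src_unit _
    · exact PY.src_div (hG.inY_injOn p.2 q.2 e)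
  smul_div {p q} e := by
    rcases p with p | p <;> rcases q with q | q
    · exact congrArg Sum.inl (PZ.smul_div (hG.inZ_injective e))
    · obtain ⟨a, ha, -⟩ := hG.inY_eq_inZ e.symm
      exact (q.2 ⟨a, ha⟩).elim
    · obtain ⟨a, ha, -⟩ := hG.inY_eq_inZ e
      exact (p.2 ⟨a, ha⟩).elim
    · have e' := hG.inY_injOn p.2 q.2 e
      exact (dif_pos (PY.src_div e').symm).trans
        (congrArg Sum.inr (Subtype.ext (PY.smul_div e')))
  div_smul {p g} e := by
    rcases p with p | q
    · exact PZ.div_smul e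
    · have e' : PY.anchor q = Γ.src g := e
      simp only [dif_pos e']
      exact PY.div_smul e'

open scoped Classical in
/-- The map from the torsor over `Y` to the glued torsor. -/
noncomputable def toGlue (q : PY.total) : GlueTotal (PZ := PZ) φ :=
  if h : PY.proj q ∈ Set.range φ.baseMap then
    Sum.inl (ψ.totalMap (φ.exists_lift (q := q) (b := h.choose) h.choose_spec.symm).choose)
  else Sum.inr ⟨q, h⟩

include hG in
theorem toGlue_totalMap (r : PA.total) : toGlue φ ψ (φ.totalMap r) = Sum.inl (ψ.totalMap r) := by
  have h : PY.proj (φ.totalMap r) ∈ Set.range φ.baseMap := ⟨PA.proj r, (φ.proj_map r).symm⟩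
  rw [toGlue, dif_pos h]
  have h' := (φ.exists_lift (q := φ.totalMap r) (b := h.choose) h.choose_spec.symm).choose_spec
  rw [totalMap_injective φ hG.isClosedEmbedding.injective h'.2]

theorem toGlue_of_notMem {q : PY.total} (h : PY.proj q ∉ Set.range φ.baseMap) :
    toGlue φ ψ q = Sum.inr ⟨q, h⟩ := dif_neg h

theorem exists_totalMap_of_mem {q : PY.total} (h : PY.proj q ∈ Set.range φ.baseMap) :
    ∃ r, φ.totalMap r = q := by
  obtain ⟨a, ha⟩ := h
  obtain ⟨r, -, hr⟩ := φ.exists_lift ha.symm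
  exact ⟨r, hr⟩

theorem proj_toGlue (q : PY.total) : (glue φ ψ hG).proj (toGlue φ ψ q) = inY (PY.proj q) := by
  by_cases h : PY.proj q ∈ Set.range φ.baseMap
  · obtain ⟨r, rfl⟩ := exists_totalMap_of_mem φ h
    rw [toGlue_totalMap φ ψ hG]
    change inZ _ = _
    rw [ψ.proj_map, φ.proj_map, hG.comm]
  · rw [toGlue_of_notMem φ ψ h]
    rfl

theorem anchor_toGlue (q : PY.total) : (glue φ ψ hG).anchor (toGlue φ ψ q) = PY.anchor q := by
  by_cases h : PY.proj q ∈ Set.range φ.baseMap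
  · obtain ⟨r, rfl⟩ := exists_totalMap_of_mem φ h
    rw [toGlue_totalMap φ ψ hG, φ.anchor_map]
    exact ψ.anchor_map r
  · rw [toGlue_of_notMem φ ψ h]
    rfl

theorem toGlue_smul {q : PY.total} {g : Γ.Mor} (e : PY.anchor q = Γ.src g) :
    toGlue φ ψ (PY.smul q g) = (glue φ ψ hG).smul (toGlue φ ψ q) g := by
  by_cases h : PY.proj q ∈ Set.range φ.baseMap
  · obtain ⟨r, rfl⟩ := exists_totalMap_of_mem φ h
    have e' : PA.anchor r = Γ.src g := (φ.anchor_map r).symm.trans e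
    rw [← φ.map_smul e', toGlue_totalMap φ ψ hG, toGlue_totalMap φ ψ hG, ψ.map_smul e']
    rfl
  · have h' : PY.proj (PY.smul q g) ∉ Set.range φ.baseMap := by rwa [PY.proj_smul e]
    rw [toGlue_of_notMem φ ψ h, toGlue_of_notMem φ ψ h']
    exact Eq.symm (Eq.trans (dif_pos e) rfl)

theorem div_toGlue {q q' : PY.total} (e : PY.proj q = PY.proj q') :
    (glue φ ψ hG).div (toGlue φ ψ q) (toGlue φ ψ q') = PY.div q q' := by
  have e' := (PY.src_div e).symm
  rw [← PY.smul_div e, toGlue_smul φ ψ hG e', PY.div_smul e',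
    (glue φ ψ hG).div_smul ((anchor_toGlue φ ψ hG q).trans e')]

/-- A compatible pair of sections of the torsors over `Y` and `Z`, on the preimages of an open set
of the pushout. -/
structure GlueSection (φ : PA ⟶ PY) (ψ : PA ⟶ PZ) (inY : PY.base ⟶ U) (inZ : PZ.base ⟶ U) where
  /-- The domain. -/
  dom : Set U
  /-- The section over `Y`. -/
  secY : PY.base → PY.total
  /-- The section over `Z`. -/
  secZ : PZ.base → PZ.total
  isOpen_dom : IsOpen dom
  continuousOn_secY : ContinuousOn secY (inY ⁻¹' dom)
  continuousOn_secZ : ContinuousOn secZ (inZ ⁻¹' dom)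
  proj_secY : ∀ {y}, inY y ∈ dom → PY.proj (secY y) = y
  proj_secZ : ∀ {z}, inZ z ∈ dom → PZ.proj (secZ z) = z
  compat : ∀ a, inZ (ψ.baseMap a) ∈ dom →
    toGlue φ ψ (secY (φ.baseMap a)) = Sum.inl (secZ (ψ.baseMap a))

namespace GlueSection

variable {φ ψ} (j : GlueSection φ ψ inY inZ)

/-- The section of the glued torsor given by a compatible pair of sections. -/
noncomputable def sec (x : U) : GlueTotal (PZ := PZ) φ :=
  (hG.exists_desc (α := fun y => toGlue φ ψ (j.secY y)) (β := fun z => Sum.inl (j.secZ z))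
    j.compat).choose x

theorem sec_inY {y : PY.base} (hy : inY y ∈ j.dom) : j.sec hG (inY y) = toGlue φ ψ (j.secY y) :=
  (hG.exists_desc (α := fun y => toGlue φ ψ (j.secY y)) (β := fun z => Sum.inl (j.secZ z))
    j.compat).choose_spec.1 y hy

theorem sec_inZ {z : PZ.base} (hz : inZ z ∈ j.dom) : j.sec hG (inZ z) = Sum.inl (j.secZ z) :=
  (hG.exists_desc (α := fun y => toGlue φ ψ (j.secY y)) (β := fun z => Sum.inl (j.secZ z))
    j.compat).choose_spec.2 z hz

end GlueSection

/-- Near `φ.baseMap a` there are sections over `Y` compatible with a given section over `Z`. -/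
theorem exists_compatible_section (hi : IsEmbedding φ.baseMap)
    (hNDR : IsLocalNDR (Set.range φ.baseMap)) (hsrc : IsLocalHurewiczFibration Γ.src)
    {Z₀ : Set PZ.base} (hZ₀ : IsOpen Z₀) {τ : PZ.base → PZ.total} (hτ : ContinuousOn τ Z₀)
    (hpr : ∀ z ∈ Z₀, PZ.proj (τ z) = z) {a : PA.base} (ha : ψ.baseMap a ∈ Z₀) :
    ∃ (V : Set PY.base) (σ : PY.base → PY.total), IsOpen V ∧ φ.baseMap a ∈ V ∧
      ContinuousOn σ V ∧ (∀ y ∈ V, PY.proj (σ y) = y) ∧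
      ∀ a', φ.baseMap a' ∈ V → ψ.baseMap a' ∈ Z₀ ∧
        ∃ r, φ.totalMap r = σ (φ.baseMap a') ∧ ψ.totalMap r = τ (ψ.baseMap a') := by
  have hf : Continuous ψ.baseMap := map_continuous (ConcreteCategory.hom ψ.baseMap)
  obtain ⟨V₀, σ₀, hV₀, haV₀, hσ₀c, hσ₀⟩ := PY.exists_section (φ.baseMap a)
  obtain ⟨O, hO, hOZ⟩ := hi.isInducing.isOpen_iff.1 (hZ₀.preimage hf)
  have hOZ' : ∀ a', φ.baseMap a' ∈ O ↔ ψ.baseMap a' ∈ Z₀ := fun a' => by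
    change a' ∈ φ.baseMap ⁻¹' O ↔ _
    rw [hOZ]
    rfl
  obtain ⟨sA, -⟩ := PA.exists_total_section
  have hr : ∀ a', ∃ r, ψ.baseMap a' ∈ Z₀ →
      PA.proj r = a' ∧ ψ.totalMap r = τ (ψ.baseMap a') := fun a' => by
    by_cases h : ψ.baseMap a' ∈ Z₀
    · obtain ⟨r, hr⟩ := ψ.exists_lift (hpr _ h)
      exact ⟨r, fun _ => hr⟩
    · exact ⟨sA a', fun h' => (h h').elim⟩
  choose r hr using hr
  have hV₁ : IsOpen (V₀ ∩ O) := hV₀.inter hO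
  have hs : IsOpen (φ.baseMap ⁻¹' (V₀ ∩ O)) := hV₁.preimage hi.continuous
  have hsZ : ∀ a' ∈ φ.baseMap ⁻¹' (V₀ ∩ O), ψ.baseMap a' ∈ Z₀ := fun a' h => (hOZ' a').1 h.2
  have hrc : ContinuousOn r (φ.baseMap ⁻¹' (V₀ ∩ O)) := by
    refine ψ.continuousOn_of_comp hs
      (continuousOn_id.congr fun a' ha' => (hr a' (hsZ a' ha')).1) ?_
    exact (hτ.comp hf.continuousOn hsZ).congr fun a' ha' => (hr a' (hsZ a' ha')).2
  have e : ∀ a' ∈ φ.baseMap ⁻¹' (V₀ ∩ O),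
      PY.proj (σ₀ (φ.baseMap a')) = PY.proj (φ.totalMap (r a')) := fun a' ha' => by
    rw [hσ₀ _ ha'.1, φ.proj_map, (hr a' (hsZ a' ha')).1]
  -- The difference between an arbitrary section `σ₀` and the section over `A` to be extended. Its
  -- source is the anchor of `σ₀`, which is defined on all of `V₀`, so extending it is a lifting
  -- problem for `Γ.src`; `σ₀` corrected by the extension is the section sought.
  have hg := PY.continuousOn_div hs
    ((hσ₀c.mono Set.inter_subset_left).comp hi.continuous.continuousOn fun _ h => h)
    ((map_continuous (ConcreteCategory.hom φ.totalMap)).comp_continuousOn hrc) e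
  have hh : ContinuousOn (fun y => PY.anchor (σ₀ y)) (V₀ ∩ O) :=
    PY.anchor.continuous.comp_continuousOn (hσ₀c.mono Set.inter_subset_left)
  obtain ⟨V, g', hV, hVV₁, haV, hg'c, hg's, hg'⟩ := exists_local_extension hi hNDR hsrc hV₁ hh hg
    (fun a' ha' => PY.src_div (e a' ha')) (a₀ := a) ⟨haV₀, (hOZ' a).2 ha⟩
  refine ⟨V, fun y => PY.smul (σ₀ y) (g' y), hV, haV,
    PY.continuousOn_smul hV (hσ₀c.mono fun y hy => (hVV₁ hy).1) hg'c
      fun y hy => (hg's y hy).symm, fun y hy => ?_, fun a' ha' => ?_⟩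
  · rw [PY.proj_smul (hg's y hy).symm, hσ₀ y (hVV₁ hy).1]
  · have hZ := hsZ a' (hVV₁ ha')
    refine ⟨hZ, r a', ?_, (hr a' hZ).2⟩
    change φ.totalMap (r a') = PY.smul (σ₀ (φ.baseMap a')) (g' (φ.baseMap a'))
    rw [hg' a' ha']
    exact (PY.smul_div (e a' (hVV₁ ha'))).symm

include hG in
-- Each point of the fibre over `z` has a neighbourhood with a section compatible with `τ`. Kept
-- inside the disjoint sets `N a`, these sections unite to one on `W`, and `W` is then shrunk to a
-- saturated set.
theorem exists_glueSection_inZ (hsrc : IsLocalHurewiczFibration Γ.src) (z : PZ.base) :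
    ∃ j : GlueSection φ ψ inY inZ, inZ z ∈ j.dom := by
  classical
  have hi := hG.isClosedEmbedding
  obtain ⟨Z₀, τ, hZ₀, hz, hτc, hτ⟩ := PZ.exists_section z
  obtain ⟨N, hN, hNd⟩ := hG.exists_disjoint z
  obtain ⟨sY, -⟩ := PY.exists_total_section
  have key : ∀ a, ∃ (V : Set PY.base) (σ : PY.base → PY.total), ψ.baseMap a = z →
      IsOpen V ∧ φ.baseMap a ∈ V ∧ V ⊆ N a ∧
      ContinuousOn σ V ∧ (∀ y ∈ V, PY.proj (σ y) = y) ∧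
      ∀ a', φ.baseMap a' ∈ V → ψ.baseMap a' ∈ Z₀ ∧
        ∃ r, φ.totalMap r = σ (φ.baseMap a') ∧ ψ.totalMap r = τ (ψ.baseMap a') := by
    intro a
    by_cases ha : ψ.baseMap a = z
    · obtain ⟨V, σ, hV, haV, hσc, hσ, hc⟩ := exists_compatible_section φ ψ hi.isEmbedding
        hG.isLocalNDR hsrc hZ₀ hτc hτ (a := a) (ha ▸ hz)
      exact ⟨V ∩ N a, σ, fun _ => ⟨hV.inter (hN a ha).1, ⟨haV, (hN a ha).2⟩,
        Set.inter_subset_right, hσc.mono Set.inter_subset_left, fun y hy => hσ y hy.1,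
        fun a' ha' => hc a' ha'.1⟩⟩
    · exact ⟨∅, sY, fun h => (ha h).elim⟩
  choose V σ hV using key
  let W : Set PY.base := {y | ∃ a, ψ.baseMap a = z ∧ y ∈ V a}
  have hW : IsOpen W := by
    have : W = ⋃ a, ⋃ _ : ψ.baseMap a = z, V a := by ext y; simp [W]
    rw [this]
    exact isOpen_iUnion fun a => isOpen_iUnion fun ha => (hV a ha).1
  -- The choice of index is harmless: the sets `V a` over the fibre are pairwise disjoint.
  let σW : PY.base → PY.total := fun y => if h : y ∈ W then σ h.choose y else sY y
  have hσW : ∀ a, ψ.baseMap a = z → ∀ y ∈ V a, σW y = σ a y := fun a ha y hy => by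
    have h : y ∈ W := ⟨a, ha, hy⟩
    simp only [σW, dif_pos h]
    have hc := h.choose_spec
    by_cases hne : h.choose = a
    · rw [hne]
    · exact (Set.disjoint_left.1 (hNd _ _ hc.1 ha hne)
        ((hV _ hc.1).2.2.1 hc.2) ((hV a ha).2.2.1 hy)).elim
  have hσWc : ContinuousOn σW W := by
    rintro y ⟨a, ha, hy⟩
    have h : ContinuousOn σW (V a) := (hV a ha).2.2.2.1.congr (hσW a ha)
    exact (h.continuousAt ((hV a ha).1.mem_nhds hy)).continuousWithinAt
  -- The points of `Z₀` whose whole fibre lies in `W`, an open set since the map to `Z` is closed.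
  let Z₁ : Set PZ.base := Z₀ ∩ (ψ.baseMap '' (φ.baseMap ⁻¹' W)ᶜ)ᶜ
  have hZ₁ : IsOpen Z₁ := hZ₀.inter
    (hG.isClosedMap_f _ (hW.preimage hi.continuous).isClosed_compl).isOpen_compl
  have hZ₁W : ∀ a, ψ.baseMap a ∈ Z₁ → φ.baseMap a ∈ W := fun a ha => by
    by_contra hne
    exact ha.2 ⟨a, hne, rfl⟩
  -- Removing from `W` the points of `A` not lying over `Z₁`, a closed set of `Y`, makes `V₁` and
  -- `Z₁` have the same preimage in `A`.
  let V₁ : Set PY.base := W ∩ (φ.baseMap '' (ψ.baseMap ⁻¹' Z₁)ᶜ)ᶜ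
  have hV₁ : IsOpen V₁ := hW.inter
    (hi.isClosedMap _ (hZ₁.preimage hG.continuous_f).isClosed_compl).isOpen_compl
  have hsat : ∀ a, φ.baseMap a ∈ V₁ ↔ ψ.baseMap a ∈ Z₁ := fun a => by
    constructor
    · intro ha
      by_contra hne
      exact ha.2 ⟨a, hne, rfl⟩
    · intro ha
      refine ⟨hZ₁W a ha, ?_⟩
      rintro ⟨a', ha', e⟩
      rw [hi.injective e] at ha'
      exact ha' ha
  obtain ⟨O, hO, hOY, hOZ⟩ := hG.exists_isOpen hV₁ hZ₁ hsat
  have hOY' : ∀ y, inY y ∈ O ↔ y ∈ V₁ := fun y => by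
    change y ∈ inY ⁻¹' O ↔ _
    rw [hOY]
  have hOZ' : ∀ z, inZ z ∈ O ↔ z ∈ Z₁ := fun z => by
    change z ∈ inZ ⁻¹' O ↔ _
    rw [hOZ]
  refine ⟨⟨O, σW, τ, hO, ?_, ?_, ?_, ?_, ?_⟩, ?_⟩
  · rw [hOY]
    exact hσWc.mono Set.inter_subset_left
  · rw [hOZ]
    exact hτc.mono Set.inter_subset_left
  · intro y hy
    obtain ⟨a, ha, hya⟩ := ((hOY' y).1 hy).1
    rw [hσW a ha y hya, (hV a ha).2.2.2.2.1 y hya]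
  · intro z' hz'
    exact hτ z' ((hOZ' z').1 hz').1
  · intro a ha
    obtain ⟨b, hb, hab⟩ := hZ₁W a ((hOZ' _).1 ha)
    obtain ⟨-, r, hr1, hr2⟩ := (hV b hb).2.2.2.2.2 a hab
    rw [hσW b hb _ hab, ← hr1, ← hr2, toGlue_totalMap φ ψ hG]
  · refine (hOZ' z).2 ⟨hz, ?_⟩
    rintro ⟨a, ha, haz⟩
    exact ha ⟨a, haz, (hV a haz).2.1⟩

include hG in
theorem exists_glueSection (hsrc : IsLocalHurewiczFibration Γ.src) (x : U) :
    ∃ j : GlueSection φ ψ inY inZ, x ∈ j.dom := by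
  by_cases hx : ∃ z, inZ z = x
  · obtain ⟨z, rfl⟩ := hx
    exact exists_glueSection_inZ φ ψ hG hsrc z
  · obtain ⟨y, rfl⟩ | h := hG.exists_rep x
    · have hy : y ∉ Set.range φ.baseMap := by
        rintro ⟨a, rfl⟩
        exact hx ⟨_, (hG.comm a).symm⟩
      obtain ⟨V, σ, hV, hyV, hσc, hσ⟩ := PY.exists_section y
      -- The domain chosen below misses `Z`, so any set-theoretic section serves there.
      obtain ⟨sZ, -⟩ := PZ.exists_total_section
      obtain ⟨O, hO, hOY, hOZ⟩ := hG.exists_isOpen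
        (hV.inter hG.isClosedEmbedding.isClosed_range.isOpen_compl) isOpen_empty
        (fun a => ⟨fun h => (h.2 ⟨a, rfl⟩).elim, fun h => h.elim⟩)
      have hOZ' : ∀ z, inZ z ∉ O := fun z hz => by
        have : z ∈ inZ ⁻¹' O := hz
        rwa [hOZ] at this
      refine ⟨⟨O, σ, sZ, hO, ?_, ?_, ?_, fun h => (hOZ' _ h).elim,
        fun a ha => (hOZ' _ ha).elim⟩, ?_⟩
      · rw [hOY]
        exact hσc.mono Set.inter_subset_left
      · rw [hOZ]
        exact continuousOn_empty _
      · intro y' hy'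
        have : y' ∈ inY ⁻¹' O := hy'
        rw [hOY] at this
        exact hσ y' this.1
      · have : y ∈ inY ⁻¹' O := by
          rw [hOY]
          exact ⟨hyV, hy⟩
        exact this
    · exact (hx h).elim

/-- The atlas of the glued torsor given by all compatible pairs of sections. -/
noncomputable def glueAtlas (hsrc : IsLocalHurewiczFibration Γ.src) : (glue φ ψ hG).Atlas where
  ι := GlueSection φ ψ inY inZ
  dom j := j.dom
  sec j := j.sec hG
  isOpen_dom j := j.isOpen_dom
  proj_sec {j x} hx := by
    obtain ⟨y, rfl⟩ | ⟨z, rfl⟩ := hG.exists_rep x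
    · rw [j.sec_inY hG hx, proj_toGlue, j.proj_secY hx]
    · rw [j.sec_inZ hG hx]
      exact congrArg inZ (j.proj_secZ hx)
  continuousOn_div_sec j k := by
    refine hG.continuousOn_of_comp (j.isOpen_dom.inter k.isOpen_dom) ?_ ?_
    · have e : ∀ y ∈ inY ⁻¹' (j.dom ∩ k.dom), PY.proj (j.secY y) = PY.proj (k.secY y) :=
        fun y hy => by rw [j.proj_secY hy.1, k.proj_secY hy.2]
      refine (PY.continuousOn_div ((j.isOpen_dom.inter k.isOpen_dom).preimage hG.continuous_inY)
        (j.continuousOn_secY.mono fun y hy => hy.1) (k.continuousOn_secY.mono fun y hy => hy.2)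
        e).congr fun y hy => ?_
      change (glue φ ψ hG).div (j.sec hG (inY y)) (k.sec hG (inY y)) = _
      rw [j.sec_inY hG hy.1, k.sec_inY hG hy.2, div_toGlue φ ψ hG (e y hy)]
    · have e : ∀ z ∈ inZ ⁻¹' (j.dom ∩ k.dom), PZ.proj (j.secZ z) = PZ.proj (k.secZ z) :=
        fun z hz => by rw [j.proj_secZ hz.1, k.proj_secZ hz.2]
      refine (PZ.continuousOn_div ((j.isOpen_dom.inter k.isOpen_dom).preimage hG.continuous_inZ)
        (j.continuousOn_secZ.mono fun y hy => hy.1) (k.continuousOn_secZ.mono fun y hy => hy.2)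
        e).congr fun z hz => ?_
      change (glue φ ψ hG).div (j.sec hG (inZ z)) (k.sec hG (inZ z)) = _
      rw [j.sec_inZ hG hz.1, k.sec_inZ hG hz.2]
      rfl
  exists_mem_dom x := exists_glueSection φ ψ hG hsrc x

theorem continuous_toGlue (hsrc : IsLocalHurewiczFibration Γ.src) :
    Continuous (Y := (glueAtlas φ ψ hG hsrc).Total) fun q => toGlue φ ψ q := by
  have hp : Continuous fun q => (glue φ ψ hG).proj (toGlue φ ψ q) :=
    (hG.continuous_inY.comp PY.proj.continuous).congr fun q => (proj_toGlue φ ψ hG q).symm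
  refine (glueAtlas φ ψ hG hsrc).continuous_total hp fun (j : GlueSection φ ψ inY inZ) => ?_
  have hmem : ∀ q ∈ (fun q => (glue φ ψ hG).proj (toGlue φ ψ q)) ⁻¹' j.dom,
      inY (PY.proj q) ∈ j.dom := fun q hq => by
    rw [← proj_toGlue φ ψ hG]
    exact hq
  refine (PY.continuousOn_div (j.isOpen_dom.preimage hp)
    (j.continuousOn_secY.comp PY.proj.continuous.continuousOn hmem) continuousOn_id
    fun q hq => j.proj_secY (hmem q hq)).congr fun q hq => ?_
  change (glue φ ψ hG).div (j.sec hG ((glue φ ψ hG).proj (toGlue φ ψ q))) (toGlue φ ψ q) = _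
  rw [proj_toGlue, j.sec_inY hG (hmem q hq), div_toGlue φ ψ hG (j.proj_secY (hmem q hq))]
  rfl

theorem continuous_inl_glue (hsrc : IsLocalHurewiczFibration Γ.src) :
    Continuous (Y := (glueAtlas φ ψ hG hsrc).Total) fun p : PZ.total => Sum.inl p := by
  have hp : Continuous fun p : PZ.total => (glue φ ψ hG).proj (Sum.inl p) :=
    hG.continuous_inZ.comp PZ.proj.continuous
  refine (glueAtlas φ ψ hG hsrc).continuous_total hp fun (j : GlueSection φ ψ inY inZ) => ?_
  refine (PZ.continuousOn_div (j.isOpen_dom.preimage hp)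
    (j.continuousOn_secZ.comp PZ.proj.continuous.continuousOn fun _ h => h) continuousOn_id
    fun p hp => j.proj_secZ hp).congr fun p hp => ?_
  change (glue φ ψ hG).div (j.sec hG (inZ (PZ.proj p))) (Sum.inl p) = _
  rw [j.sec_inZ hG hp]
  rfl

include hG in
/-- Torsors can be glued over the pushout of a gluing square. -/
theorem exists_glue (hsrc : IsLocalHurewiczFibration Γ.src) :
    ∃ (P : Torsor Γ) (η : PY ⟶ P) (ζ : PZ ⟶ P), (quotientStack Γ).p.IsHomLift inY η ∧
      (quotientStack Γ).p.IsHomLift inZ ζ ∧ φ ≫ η = ψ ≫ ζ := by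
  let η : PY ⟶ (glueAtlas φ ψ hG hsrc).toTorsor :=
    { baseMap := inY
      totalMap := ConcreteCategory.ofHom
        (⟨_, continuous_toGlue φ ψ hG hsrc⟩ : C(PY.total, (glueAtlas φ ψ hG hsrc).Total))
      proj_map := proj_toGlue φ ψ hG
      anchor_map := anchor_toGlue φ ψ hG
      map_act := fun p g e => by
        rw [← PY.smul_eq e]
        exact toGlue_smul φ ψ hG e }
  let ζ : PZ ⟶ (glueAtlas φ ψ hG hsrc).toTorsor :=
    { baseMap := inZ
      totalMap := ConcreteCategory.ofHom
        (⟨_, continuous_inl_glue φ ψ hG hsrc⟩ : C(PZ.total, (glueAtlas φ ψ hG hsrc).Total))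
      proj_map := fun _ => rfl
      anchor_map := fun _ => rfl
      map_act := fun p g e => by
        rw [← PZ.smul_eq e]
        rfl }
  refine ⟨_, η, ζ, IsHomLift.map (quotientStack Γ).p η, IsHomLift.map (quotientStack Γ).p ζ,
    Torsor.Hom.ext ?_ ?_⟩
  · ext a
    exact hG.comm a
  · ext r
    exact toGlue_totalMap φ ψ hG r

end Torsor

/-! ## Descent along a square -/

/-- A category over the category of spaces has descent along a square of spaces with corners `A`,
`Y`, `Z`, `U` if every span over `Y ⟵ A ⟶ Z` can be completed to a commutative square over the given
one, and every such commutative square has the universal property of a pushout with respect to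
objects over `U`. -/
structure HasDescent (𝒳 : BasedCategory.{v, w} CGTop.{u}) {A Y Z U : CGTop.{u}} (i : A ⟶ Y)
    (f : A ⟶ Z) (inY : Y ⟶ U) (inZ : Z ⟶ U) : Prop where
  exists_glue : ∀ {a y z : 𝒳.obj} (φ : a ⟶ y) (ψ : a ⟶ z), 𝒳.p.IsHomLift i φ →
    𝒳.p.IsHomLift f ψ → ∃ (x : 𝒳.obj) (η : y ⟶ x) (ζ : z ⟶ x), 𝒳.p.IsHomLift inY η ∧
      𝒳.p.IsHomLift inZ ζ ∧ φ ≫ η = ψ ≫ ζ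
  exists_hom : ∀ {a y z x x' : 𝒳.obj} {φ : a ⟶ y} {ψ : a ⟶ z} {η : y ⟶ x} {ζ : z ⟶ x}
    (η' : y ⟶ x') (ζ' : z ⟶ x'), 𝒳.p.IsHomLift i φ → 𝒳.p.IsHomLift f ψ →
    𝒳.p.IsHomLift inY η → 𝒳.p.IsHomLift inZ ζ → φ ≫ η = ψ ≫ ζ →
    𝒳.p.IsHomLift inY η' → 𝒳.p.IsHomLift inZ ζ' → φ ≫ η' = ψ ≫ ζ' →
    ∃ θ : x ⟶ x', 𝒳.p.IsHomLift (𝟙 U) θ ∧ η ≫ θ = η' ∧ ζ ≫ θ = ζ'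
  hom_ext : ∀ {a y z x x' : 𝒳.obj} {φ : a ⟶ y} {ψ : a ⟶ z} {η : y ⟶ x} {ζ : z ⟶ x}
    {θ θ' : x ⟶ x'}, 𝒳.p.IsHomLift i φ → 𝒳.p.IsHomLift f ψ →
    𝒳.p.IsHomLift inY η → 𝒳.p.IsHomLift inZ ζ → φ ≫ η = ψ ≫ ζ →
    η ≫ θ = η ≫ θ' → ζ ≫ θ = ζ ≫ θ' → θ = θ'

/-- The quotient stack of a groupoid with locally fibrant source map has descent along gluing
squares. -/
theorem hasDescent_quotientStack {Γ : TopGroupoid.{u}} (hsrc : IsLocalHurewiczFibration Γ.src)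
    {A Y Z U : CGTop.{u}} {i : A ⟶ Y} {f : A ⟶ Z} {inY : Y ⟶ U} {inZ : Z ⟶ U}
    (hG : GluingSquare i f inY inZ) : HasDescent (quotientStack Γ) i f inY inZ where
  exists_glue {a y z} φ ψ hφ hψ := by
    obtain rfl := IsHomLift.domain_eq (quotientStack Γ).p i φ
    obtain rfl := IsHomLift.codomain_eq (quotientStack Γ).p i φ
    obtain rfl := IsHomLift.codomain_eq (quotientStack Γ).p f ψ
    obtain rfl := IsHomLift.eq_of_isHomLift (quotientStack Γ).p i φ
    obtain rfl := IsHomLift.eq_of_isHomLift (quotientStack Γ).p f ψ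
    exact Torsor.exists_glue φ ψ hG hsrc
  exists_hom {a y z x x' φ ψ η ζ} η' ζ' hφ hψ hη hζ h hη' hζ' h' := by
    obtain rfl := IsHomLift.domain_eq (quotientStack Γ).p i φ
    obtain rfl := IsHomLift.codomain_eq (quotientStack Γ).p i φ
    obtain rfl := IsHomLift.codomain_eq (quotientStack Γ).p f ψ
    obtain rfl := IsHomLift.codomain_eq (quotientStack Γ).p inY η
    obtain rfl := IsHomLift.eq_of_isHomLift (quotientStack Γ).p i φ
    obtain rfl := IsHomLift.eq_of_isHomLift (quotientStack Γ).p f ψ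
    obtain rfl := IsHomLift.eq_of_isHomLift (quotientStack Γ).p inY η
    obtain rfl := IsHomLift.eq_of_isHomLift (quotientStack Γ).p inZ ζ
    -- `x` and `x'` lie over the same space only up to a propositional equality, so the base map of
    -- `θ` is an `eqToHom`.
    have e := IsHomLift.codomain_eq (quotientStack Γ).p ((quotientStack Γ).p.map η) η'
    obtain ⟨θ, hθ, h1, h2⟩ := Torsor.exists_hom_desc hG h η' ζ' h' (eqToHom e.symm)
      ((IsHomLift.fac' (quotientStack Γ).p ((quotientStack Γ).p.map η) η').trans
        (Category.id_comp _))
      ((IsHomLift.fac' (quotientStack Γ).p ((quotientStack Γ).p.map ζ) ζ').trans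
        (Category.id_comp _))
    exact ⟨θ, IsHomLift.of_fac' (quotientStack Γ).p _ θ rfl e
      (hθ.trans ((Category.id_comp _).trans (Category.id_comp _)).symm), h1, h2⟩
  hom_ext {a y z x x' φ ψ η ζ θ θ'} hφ hψ hη hζ h h1 h2 := by
    obtain rfl := IsHomLift.domain_eq (quotientStack Γ).p i φ
    obtain rfl := IsHomLift.codomain_eq (quotientStack Γ).p i φ
    obtain rfl := IsHomLift.codomain_eq (quotientStack Γ).p f ψ
    obtain rfl := IsHomLift.codomain_eq (quotientStack Γ).p inY η
    obtain rfl := IsHomLift.eq_of_isHomLift (quotientStack Γ).p i φ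
    obtain rfl := IsHomLift.eq_of_isHomLift (quotientStack Γ).p f ψ
    obtain rfl := IsHomLift.eq_of_isHomLift (quotientStack Γ).p inY η
    obtain rfl := IsHomLift.eq_of_isHomLift (quotientStack Γ).p inZ ζ
    exact Torsor.hom_ext_of_gluingSquare hG h1 h2

open Functor.IsPreFibered in
/-- Descent along a square is invariant under equivalences of fibred categories. -/
theorem HasDescent.of_isEquivalence {𝒳 : BasedCategory.{v, w} CGTop.{u}}
    {𝒴 : BasedCategory.{v', w'} CGTop.{u}} [𝒳.p.IsFibered] (F : BasedFunctor 𝒳 𝒴)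
    [F.toFunctor.IsEquivalence] {A Y Z U : CGTop.{u}} {i : A ⟶ Y} {f : A ⟶ Z} {inY : Y ⟶ U}
    {inZ : Z ⟶ U} (hD : HasDescent 𝒴 i f inY inZ) : HasDescent 𝒳 i f inY inZ where
  exists_glue {a y z} φ ψ hφ hψ := by
    obtain ⟨P, η, ζ, hη, hζ, h⟩ := hD.exists_glue (F.map φ) (F.map ψ) inferInstance inferInstance
    obtain rfl := IsHomLift.codomain_eq 𝒴.p inY η
    -- The preimage of `P` under the equivalence lies over a space merely isomorphic to `U`. Pulling
    -- it back along this isomorphism gives an object over `U` itself, and `χ` compares the two over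
    -- the identity.
    let x₀ := F.toFunctor.objPreimage P
    let ε : F.obj x₀ ≅ P := F.toFunctor.objObjPreimageIso P
    have hx₀ : 𝒳.p.obj x₀ = 𝒴.p.obj (F.obj x₀) := (F.w_obj x₀).symm
    let π := pullbackMap hx₀ (𝒴.p.map ε.inv)
    have : IsIso π := Functor.IsStronglyCartesian.isIso_of_base_isIso 𝒳.p (𝒴.p.map ε.inv) π
    have : IsIso (F.map π) := inferInstanceAs (IsIso (F.toFunctor.map π))
    let χ : P ⟶ F.obj (pullbackObj hx₀ (𝒴.p.map ε.inv)) := ε.inv ≫ inv (F.map π)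
    have hχ : 𝒴.p.IsHomLift (𝟙 (𝒴.p.obj P)) χ := by
      have : 𝒴.p.IsHomLift (𝒴.p.map ε.inv ≫ inv (𝒴.p.map ε.inv)) χ := inferInstance
      simpa using this
    have h1 : 𝒴.p.IsHomLift inY (F.map (F.toFunctor.preimage (η ≫ χ))) := by
      rw [F.toFunctor.map_preimage]
      infer_instance
    have h2 : 𝒴.p.IsHomLift inZ (F.map (F.toFunctor.preimage (ζ ≫ χ))) := by
      rw [F.toFunctor.map_preimage]
      infer_instance
    refine ⟨_, F.toFunctor.preimage (η ≫ χ), F.toFunctor.preimage (ζ ≫ χ),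
      F.isHomLift_map _ _, F.isHomLift_map _ _, F.toFunctor.map_injective ?_⟩
    simp [reassoc_of% h]
  exists_hom {a y z x x' φ ψ η ζ} η' ζ' hφ hψ hη hζ h hη' hζ' h' := by
    obtain ⟨θ, hθ, h1, h2⟩ := hD.exists_hom (φ := F.map φ) (ψ := F.map ψ) (η := F.map η)
      (ζ := F.map ζ) (F.map η') (F.map ζ') inferInstance inferInstance inferInstance inferInstance
      (by rw [← F.map_comp, ← F.map_comp, h]) inferInstance inferInstance
      (by rw [← F.map_comp, ← F.map_comp, h'])
    have h3 : 𝒴.p.IsHomLift (𝟙 U) (F.map (F.toFunctor.preimage θ)) := by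
      rwa [F.toFunctor.map_preimage]
    exact ⟨F.toFunctor.preimage θ, F.isHomLift_map _ _,
      F.toFunctor.map_injective (by simpa using h1), F.toFunctor.map_injective (by simpa using h2)⟩
  hom_ext {a y z x x' φ ψ η ζ θ θ'} hφ hψ hη hζ h h1 h2 := by
    refine F.toFunctor.map_injective (hD.hom_ext (φ := F.map φ) (ψ := F.map ψ) (η := F.map η)
      (ζ := F.map ζ) inferInstance inferInstance inferInstance inferInstance ?_ ?_ ?_)
    · rw [← F.map_comp, ← F.map_comp, h]
    · rw [← F.map_comp, ← F.map_comp, h1]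
    · rw [← F.map_comp, ← F.map_comp, h2]

theorem IsTopologicalStack.hasDescent {𝒳 : BasedCategory.{v, w} CGTop.{u}}
    (hX : IsTopologicalStack 𝒳) {A Y Z U : CGTop.{u}} {i : A ⟶ Y} {f : A ⟶ Z} {inY : Y ⟶ U}
    {inZ : Z ⟶ U} (hG : GluingSquare i f inY inZ) : HasDescent 𝒳 i f inY inZ := by
  obtain ⟨Γ, hsrc, -, F, hF⟩ := hX.exists_presentation
  have := hX.isFibredInGroupoids.isFibered
  exact (hasDescent_quotientStack hsrc hG).of_isEquivalence F

/-! ## The 2-Yoneda lemma -/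

section Yoneda

variable {𝒳 : BasedCategory.{v, w} CGTop.{u}}

/-- The morphism differs from a chosen pullback by a vertical morphism, which is invertible. -/
theorem IsFibredInGroupoids.isStronglyCartesian (hX : IsFibredInGroupoids 𝒳) {R S : CGTop.{u}}
    (f : R ⟶ S) {a b : 𝒳.obj} (φ : a ⟶ b) [𝒳.p.IsHomLift f φ] :
    𝒳.p.IsStronglyCartesian f φ := by
  have := hX.isFibered
  let π := Functor.IsPreFibered.pullbackMap (IsHomLift.codomain_eq 𝒳.p f φ) f
  let χ := Functor.IsCartesian.map 𝒳.p f π φ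
  have : IsIso χ := hX.isIso_of_vertical R _ _ χ inferInstance
  have : 𝒳.p.IsHomLift (𝟙 R) (asIso χ).hom := inferInstanceAs (𝒳.p.IsHomLift (𝟙 R) χ)
  have h : 𝒳.p.IsCartesian f ((asIso χ).hom ≫ π) := inferInstance
  have hφ : (asIso χ).hom ≫ π = φ := Functor.IsCartesian.fac 𝒳.p f π φ
  rw [hφ] at h
  infer_instance

/-- The structure map of a space over `T`. -/
def overHom {T : CGTop.{u}} (w : (spaceStack T).obj) : (spaceStack T).p.obj w ⟶ T :=
  Over.hom (X := T) w

theorem over_w {T : CGTop.{u}} {w w' : (spaceStack T).obj} (k : w ⟶ w') :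
    (spaceStack T).p.map k ≫ overHom w' = overHom w :=
  Over.w (X := T) k

/-- The identity of `T`, as an object of the stack `T`. -/
def idOver (T : CGTop.{u}) : (spaceStack T).obj := Over.mk (𝟙 T)

/-- The map of a space over `T` to `T`. -/
def toIdOver {T : CGTop.{u}} (w : (spaceStack T).obj) : w ⟶ idOver T :=
  Over.homMk (U := (w : Over T)) (V := Over.mk (𝟙 T)) (overHom w) (Category.comp_id _)

theorem toIdOver_unique {T : CGTop.{u}} {w : (spaceStack T).obj} (k k' : w ⟶ idOver T) :
    k = k' := by
  have h : ∀ k : w ⟶ idOver T, (spaceStack T).p.map k = overHom w := fun k =>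
    (Category.comp_id _).symm.trans (over_w k)
  exact Over.OverMorphism.ext ((h k).trans (h k').symm)

instance {T : CGTop.{u}} (w : (spaceStack T).obj) :
    (spaceStack T).p.IsHomLift (overHom w) (toIdOver w) :=
  IsHomLift.map (spaceStack T).p (toIdOver w)

instance {T : CGTop.{u}} (F : BasedFunctor (spaceStack T) 𝒳) (w : (spaceStack T).obj) :
    𝒳.p.IsHomLift (overHom w) (F.map (toIdOver w)) :=
  inferInstance

instance {T : CGTop.{u}} {F G : BasedFunctor (spaceStack T) 𝒳} (α : F ⟶ G)
    (w : (spaceStack T).obj) : 𝒳.p.IsHomLift (𝟙 ((spaceStack T).p.obj w)) (α.toNatTrans.app w) :=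
  BasedNatTrans.isHomLift α rfl

/-- The identity is terminal among spaces over `T` and `G.map (toIdOver w)` is cartesian, so
naturality determines every component from the one at the identity. -/
theorem points_hom_ext (hX : IsFibredInGroupoids 𝒳) {T : CGTop.{u}}
    {F G : BasedFunctor (spaceStack T) 𝒳} {α β : F ⟶ G}
    (h : α.toNatTrans.app (idOver T) = β.toNatTrans.app (idOver T)) : α = β := by
  refine BasedNatTrans.homCategory.ext _ _ (NatTrans.ext (funext fun w => ?_))
  have := hX.isStronglyCartesian (overHom w) (G.map (toIdOver w))
  refine Functor.IsStronglyCartesian.ext 𝒳.p (overHom w) (G.map (toIdOver w))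
    (𝟙 ((spaceStack T).p.obj w)) ?_
  have h1 := α.toNatTrans.naturality (toIdOver w)
  have h2 := β.toNatTrans.naturality (toIdOver w)
  exact h1.symm.trans ((congrArg (F.map (toIdOver w) ≫ ·) h).trans h2)

theorem exists_points_hom (hX : IsFibredInGroupoids 𝒳) {T : CGTop.{u}}
    (F G : BasedFunctor (spaceStack T) 𝒳) (m : F.obj (idOver T) ⟶ G.obj (idOver T))
    (hm : 𝒳.p.IsHomLift (𝟙 T) m) :
    ∃ α : F ⟶ G, α.toNatTrans.app (idOver T) = m := by
  have hcart : ∀ w : (spaceStack T).obj, 𝒳.p.IsStronglyCartesian (overHom w)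
      (G.map (toIdOver w)) := fun w => hX.isStronglyCartesian _ _
  have key : ∀ w : (spaceStack T).obj, ∃ χ : F.obj w ⟶ G.obj w,
      𝒳.p.IsHomLift (𝟙 ((spaceStack T).p.obj w)) χ ∧
        χ ≫ G.map (toIdOver w) = F.map (toIdOver w) ≫ m := fun w =>
    ⟨Functor.IsCartesian.map 𝒳.p (overHom w) (G.map (toIdOver w)) (F.map (toIdOver w) ≫ m),
      inferInstance, Functor.IsCartesian.fac _ _ _ _⟩
  choose χ hχ hχm using key
  refine ⟨{ app := χ, naturality := fun w w' k => ?_, isHomLift' := hχ }, ?_⟩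
  · have hk : (spaceStack T).p.IsHomLift ((spaceStack T).p.map k) k :=
      IsHomLift.map (spaceStack T).p k
    have h1 : 𝒳.p.IsHomLift ((spaceStack T).p.map k) (F.map k ≫ χ w') := inferInstance
    have h2 : 𝒳.p.IsHomLift ((spaceStack T).p.map k) (χ w ≫ G.map k) := inferInstance
    refine Functor.IsStronglyCartesian.ext 𝒳.p (overHom w') (G.map (toIdOver w'))
      ((spaceStack T).p.map k) ?_
    rw [Category.assoc, hχm, Category.assoc, ← G.map_comp, ← F.map_comp_assoc,
      toIdOver_unique (k ≫ toIdOver w') (toIdOver w), hχm]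
  · change χ (idOver T) = m
    have h := hχm (idOver T)
    rw [toIdOver_unique (toIdOver (idOver T)) (𝟙 _), F.map_id, G.map_id] at h
    simpa using h

theorem isIso_points_hom (hX : IsFibredInGroupoids 𝒳) {T : CGTop.{u}}
    {F G : BasedFunctor (spaceStack T) 𝒳} (α : F ⟶ G) : IsIso α := by
  have : ∀ w, IsIso (α.toNatTrans.app w) := fun w =>
    hX.isIso_of_vertical ((spaceStack T).p.obj w) _ _ (α.toNatTrans.app w) inferInstance
  have : IsIso (X := F.toFunctor) α.toNatTrans := NatIso.isIso_of_isIso_app _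
  exact BasedNatIso.isIso_of_toNatTrans_isIso α

open Functor.IsPreFibered in
-- Pull `x` back along every structure map; the universal property of cartesian morphisms makes the
-- choices functorial.
theorem exists_point (hX : IsFibredInGroupoids 𝒳) {T : CGTop.{u}} {x : 𝒳.obj}
    (hx : 𝒳.p.obj x = T) :
    ∃ (F : BasedFunctor (spaceStack T) 𝒳) (m : F.obj (idOver T) ⟶ x), 𝒳.p.IsHomLift (𝟙 T) m := by
  have := hX.isFibered
  let mp : ∀ {w w' : (spaceStack T).obj} (_ : w ⟶ w'),
      pullbackObj hx (overHom w) ⟶ pullbackObj hx (overHom w') := fun {w w'} k =>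
    Functor.IsStronglyCartesian.map 𝒳.p (overHom w') (pullbackMap hx (overHom w'))
      (g := ((spaceStack T).p.map k)) (f' := (overHom w))
      (over_w k).symm (pullbackMap hx (overHom w))
  have hmp : ∀ {w w' : (spaceStack T).obj} (k : w ⟶ w'),
      𝒳.p.IsHomLift ((spaceStack T).p.map k) (mp k) := fun k => inferInstance
  have hfac : ∀ {w w' : (spaceStack T).obj} (k : w ⟶ w'),
      mp k ≫ pullbackMap hx (overHom w') = pullbackMap hx (overHom w) := fun k =>
    Functor.IsStronglyCartesian.fac _ _ _ _ _
  let F : (spaceStack T).obj ⥤ 𝒳.obj :=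
    { obj := fun w => pullbackObj hx (overHom w)
      map := mp
      map_id := fun w => by
        have h1 := hmp (𝟙 w)
        have h2 : 𝒳.p.IsHomLift ((spaceStack T).p.map (𝟙 w)) (𝟙 (pullbackObj hx (overHom w))) :=
          IsHomLift.id (pullbackObj_proj hx _)
        refine Functor.IsStronglyCartesian.ext 𝒳.p (overHom w)
          (pullbackMap hx (overHom w)) ((spaceStack T).p.map (𝟙 w)) ?_
        rw [hfac, Category.id_comp]
      map_comp := fun {w w' w''} k k' => by
        have h1 := hmp (k ≫ k')
        have h2 : 𝒳.p.IsHomLift ((spaceStack T).p.map (k ≫ k')) (mp k ≫ mp k') :=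
          inferInstanceAs (𝒳.p.IsHomLift
            (((spaceStack T).p.map k) ≫ ((spaceStack T).p.map k')) (mp k ≫ mp k'))
        refine Functor.IsStronglyCartesian.ext 𝒳.p (overHom w'')
          (pullbackMap hx (overHom w'')) ((spaceStack T).p.map (k ≫ k')) ?_
        rw [hfac, Category.assoc, hfac, hfac] }
  have hw : F ⋙ 𝒳.p = (spaceStack T).p :=
    CategoryTheory.Functor.ext (fun w => pullbackObj_proj hx (overHom w)) fun w w' k => by
      have := hmp k
      exact IsHomLift.fac' 𝒳.p ((spaceStack T).p.map k) (mp k)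
  exact ⟨⟨F, hw⟩, pullbackMap hx (overHom (idOver T)),
    inferInstanceAs (𝒳.p.IsHomLift (overHom (idOver T)) (pullbackMap hx (overHom (idOver T))))⟩

end Yoneda

/-! ## From descent to 2-cartesian squares -/

section TwoCartesian

variable {𝒳 : BasedCategory.{v, w} CGTop.{u}}

section

variable {A Y Z U : CGTop.{u}} {i : A ⟶ Y} {f : A ⟶ Z} {inY : Y ⟶ U} {inZ : Z ⟶ U}

theorem IsFibredInGroupoids.eq_of_comp_eq (hX : IsFibredInGroupoids 𝒳) {R S : CGTop.{u}}
    (k : R ⟶ S) {a b c : 𝒳.obj} {α β : a ⟶ b} (g : b ⟶ c) (hg : 𝒳.p.IsHomLift k g)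
    (hα : 𝒳.p.IsHomLift (𝟙 R) α) (hβ : 𝒳.p.IsHomLift (𝟙 R) β) (h : α ≫ g = β ≫ g) : α = β := by
  have := hX.isStronglyCartesian k g
  exact Functor.IsStronglyCartesian.ext 𝒳.p k g (𝟙 R) h

theorem IsFibredInGroupoids.exists_fac (hX : IsFibredInGroupoids 𝒳) {R S : CGTop.{u}}
    (k : R ⟶ S) {a b c : 𝒳.obj} (g : b ⟶ c) (g' : a ⟶ c) (hg : 𝒳.p.IsHomLift k g)
    (hg' : 𝒳.p.IsHomLift k g') : ∃ α : a ⟶ b, 𝒳.p.IsHomLift (𝟙 R) α ∧ α ≫ g = g' := by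
  have := hX.isStronglyCartesian k g
  exact ⟨Functor.IsCartesian.map 𝒳.p k g g', inferInstance, Functor.IsCartesian.fac 𝒳.p k g g'⟩

/-- A morphism between spans in the total category, given up to isomorphic corners over `A`, extends
to squares. -/
theorem HasDescent.exists_hom_of_comm (hD : HasDescent 𝒳 i f inY inZ)
    {a₁ a₂ y z x a₁' a₂' y' z' x' : 𝒳.obj} {e : a₁ ⟶ a₂} {φ : a₂ ⟶ y} {ψ : a₁ ⟶ z} {η : y ⟶ x}
    {ζ : z ⟶ x} {e' : a₁' ⟶ a₂'} {φ' : a₂' ⟶ y'} {ψ' : a₁' ⟶ z'} {η' : y' ⟶ x'} {ζ' : z' ⟶ x'}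
    {βa : a₁ ⟶ a₁'} {βz : z ⟶ z'} {γa : a₂ ⟶ a₂'} {γy : y ⟶ y'}
    (hφ : 𝒳.p.IsHomLift i (e ≫ φ)) (hψ : 𝒳.p.IsHomLift f ψ) (hη : 𝒳.p.IsHomLift inY η)
    (hζ : 𝒳.p.IsHomLift inZ ζ) (h : (e ≫ φ) ≫ η = ψ ≫ ζ) (hη' : 𝒳.p.IsHomLift inY η')
    (hζ' : 𝒳.p.IsHomLift inZ ζ') (h' : (e' ≫ φ') ≫ η' = ψ' ≫ ζ')
    (hβ : 𝒳.p.IsHomLift (𝟙 Z) βz) (hγ : 𝒳.p.IsHomLift (𝟙 Y) γy) (nβ : ψ ≫ βz = βa ≫ ψ')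
    (nγ : φ ≫ γy = γa ≫ φ') (hβγ : βa ≫ e' = e ≫ γa) :
    ∃ θ : x ⟶ x', 𝒳.p.IsHomLift (𝟙 U) θ ∧ η ≫ θ = γy ≫ η' ∧ ζ ≫ θ = βz ≫ ζ' := by
  refine hD.exists_hom (γy ≫ η') (βz ≫ ζ') hφ hψ hη hζ h inferInstance inferInstance ?_
  simp only [Category.assoc] at h' ⊢
  rw [reassoc_of% nγ, ← reassoc_of% hβγ, reassoc_of% nβ, h']

/-- Both sides are vertical and agree after composition with `φ' ≫ η'`, which is cartesian. This is
how a glued object is seen to induce the given isomorphism over `A`. -/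
theorem IsFibredInGroupoids.comm_of_comm (hX : IsFibredInGroupoids 𝒳)
    {a₁ a₂ y z x a₁' a₂' y' z' : 𝒳.obj} {e : a₁ ⟶ a₂} {φ : a₂ ⟶ y} {ψ : a₁ ⟶ z} {η : y ⟶ x}
    {ζ : z ⟶ x} {e' : a₁' ⟶ a₂'} {φ' : a₂' ⟶ y'} {ψ' : a₁' ⟶ z'} {η' : y' ⟶ x} {ζ' : z' ⟶ x}
    {βa : a₁ ⟶ a₁'} {βz : z ⟶ z'} {γa : a₂ ⟶ a₂'} {γy : y ⟶ y'}
    (h : (e ≫ φ) ≫ η = ψ ≫ ζ) (h' : (e' ≫ φ') ≫ η' = ψ' ≫ ζ')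
    (hφ' : 𝒳.p.IsHomLift i φ') (hη' : 𝒳.p.IsHomLift inY η')
    (he : 𝒳.p.IsHomLift (𝟙 A) e) (he' : 𝒳.p.IsHomLift (𝟙 A) e')
    (hβ : 𝒳.p.IsHomLift (𝟙 A) βa) (hγ : 𝒳.p.IsHomLift (𝟙 A) γa)
    (nβ : ψ ≫ βz = βa ≫ ψ') (nγ : φ ≫ γy = γa ≫ φ') (hζζ' : βz ≫ ζ' = ζ)
    (hηη' : γy ≫ η' = η) : βa ≫ e' = e ≫ γa := by
  refine hX.eq_of_comp_eq (i ≫ inY) (φ' ≫ η') inferInstance inferInstance inferInstance ?_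
  simp only [Category.assoc] at h h' ⊢
  rw [h', ← reassoc_of% nγ, ← reassoc_of% nβ, hηη', hζζ', h]

end

/-- Restriction of a point along a map of spaces. -/
abbrev restrict {S T : CGTop.{u}} (k : S ⟶ T) (F : BasedFunctor (spaceStack T) 𝒳) :
    BasedFunctor (spaceStack S) 𝒳 :=
  BasedFunctor.comp (spaceStackMap k) F

/-- A map of spaces `k : S ⟶ T`, as an object of the stack `T`. -/
abbrev mapOver {S T : CGTop.{u}} (k : S ⟶ T) (w : (spaceStack S).obj) : (spaceStack T).obj :=
  (spaceStackMap k).obj w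

theorem isHomLift_mapOver {S T : CGTop.{u}} (k : S ⟶ T) (F : BasedFunctor (spaceStack T) 𝒳) :
    𝒳.p.IsHomLift k (F.map (toIdOver (mapOver k (idOver S)))) := by
  have h : 𝒳.p.IsHomLift (𝟙 S ≫ k) (F.map (toIdOver (mapOver k (idOver S)))) :=
    inferInstanceAs (𝒳.p.IsHomLift (overHom (mapOver k (idOver S))) _)
  rwa [Category.id_comp] at h

variable {A Y Z U : CGTop.{u}} {i : A ⟶ Y} {f : A ⟶ Z} {inY : Y ⟶ U} {inZ : Z ⟶ U}

/-- The two structure maps are equal but not definitionally so, whence the `eqToHom` in the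
compatibility conditions that follow. -/
theorem mapOver_comm (h : i ≫ inY = f ≫ inZ) :
    mapOver inZ (mapOver f (idOver A)) = mapOver inY (mapOver i (idOver A)) := by
  change Over.mk ((𝟙 A ≫ f) ≫ inZ) = Over.mk ((𝟙 A ≫ i) ≫ inY)
  rw [Category.assoc, Category.assoc, h]

theorem isHomLift_eqToHom_comp (h : i ≫ inY = f ≫ inZ) (F : BasedFunctor (spaceStack U) 𝒳) :
    𝒳.p.IsHomLift i (F.map (eqToHom (mapOver_comm h)) ≫
      F.map ((spaceStackMap inY).map (toIdOver (mapOver i (idOver A))))) := by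
  have h1 : 𝒳.p.IsHomLift i (F.map ((spaceStackMap inY).map (toIdOver (mapOver i (idOver A))))) :=
    isHomLift_mapOver i (restrict inY F)
  rw [eqToHom_map]
  exact IsHomLift.comp_eqToHom_lift 𝒳.p i _ _

theorem eqToHom_toNatTrans_app {S : BasedCategory.{v', w'} CGTop.{u}}
    {T : BasedCategory.{v, w} CGTop.{u}}
    {F G : BasedFunctor S T} (h : F = G) (x : S.obj) :
    (eqToHom h).toNatTrans.app x = eqToHom (by rw [h]) := by
  subst h
  rfl

/-- The pullbacks to `A`, `Y`, `Z` of a point over `U` form a commuting square in `𝒳`. -/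
theorem point_square (h : i ≫ inY = f ≫ inZ) (F : BasedFunctor (spaceStack U) 𝒳) :
    (F.map (eqToHom (mapOver_comm h)) ≫
      F.map ((spaceStackMap inY).map (toIdOver (mapOver i (idOver A))))) ≫
        F.map (toIdOver (mapOver inY (idOver Y))) =
    F.map ((spaceStackMap inZ).map (toIdOver (mapOver f (idOver A)))) ≫
      F.map (toIdOver (mapOver inZ (idOver Z))) := by
  rw [← F.map_comp, ← F.map_comp, ← F.map_comp]
  exact congrArg F.map (toIdOver_unique _ _)

theorem restrict_hom_ext (hX : IsFibredInGroupoids 𝒳) (h : i ≫ inY = f ≫ inZ)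
    (hD : HasDescent 𝒳 i f inY inZ) {F G : BasedFunctor (spaceStack U) 𝒳} {α β : F ⟶ G}
    (hZ : BasedCategory.whiskerLeft (spaceStackMap inZ) α =
      BasedCategory.whiskerLeft (spaceStackMap inZ) β)
    (hY : BasedCategory.whiskerLeft (spaceStackMap inY) α =
      BasedCategory.whiskerLeft (spaceStackMap inY) β) : α = β := by
  refine points_hom_ext hX (hD.hom_ext (isHomLift_eqToHom_comp h F)
    (isHomLift_mapOver f (restrict inZ F)) (isHomLift_mapOver inY F) (isHomLift_mapOver inZ F)
    (point_square h F) ?_ ?_)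
  · have e : α.toNatTrans.app (mapOver inY (idOver Y)) =
        β.toNatTrans.app (mapOver inY (idOver Y)) :=
      congrArg (fun γ : restrict inY F ⟶ restrict inY G => γ.toNatTrans.app (idOver Y)) hY
    have h1 := α.toNatTrans.naturality (toIdOver (mapOver inY (idOver Y)))
    have h2 := β.toNatTrans.naturality (toIdOver (mapOver inY (idOver Y)))
    exact h1.trans ((congrArg (· ≫ G.map (toIdOver _)) e).trans h2.symm)
  · have e : α.toNatTrans.app (mapOver inZ (idOver Z)) =
        β.toNatTrans.app (mapOver inZ (idOver Z)) :=
      congrArg (fun γ : restrict inZ F ⟶ restrict inZ G => γ.toNatTrans.app (idOver Z)) hZ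
    have h1 := α.toNatTrans.naturality (toIdOver (mapOver inZ (idOver Z)))
    have h2 := β.toNatTrans.naturality (toIdOver (mapOver inZ (idOver Z)))
    exact h1.trans ((congrArg (· ≫ G.map (toIdOver _)) e).trans h2.symm)

/-- A morphism of points over `U` whose value at the identity is compatible with a morphism of their
restrictions along `k` restricts to that morphism. -/
theorem whiskerLeft_eq_of_comp_eq (hX : IsFibredInGroupoids 𝒳) {S : CGTop.{u}} {k : S ⟶ U}
    {F G : BasedFunctor (spaceStack U) 𝒳} (α : F ⟶ G) (β : restrict k F ⟶ restrict k G)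
    (h : F.map (toIdOver (mapOver k (idOver S))) ≫ α.toNatTrans.app (idOver U) =
      β.toNatTrans.app (idOver S) ≫ G.map (toIdOver (mapOver k (idOver S)))) :
    BasedCategory.whiskerLeft (spaceStackMap k) α = β := by
  refine points_hom_ext hX (hX.eq_of_comp_eq k _ (isHomLift_mapOver k G)
    (BasedNatTrans.isHomLift α rfl) (BasedNatTrans.isHomLift β rfl) ?_)
  exact (α.toNatTrans.naturality (toIdOver (mapOver k (idOver S)))).symm.trans h

theorem exists_hom_of_restrict (hX : IsFibredInGroupoids 𝒳) (h : i ≫ inY = f ≫ inZ)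
    (hD : HasDescent 𝒳 i f inY inZ) {F G : BasedFunctor (spaceStack U) 𝒳}
    (β : restrict inZ F ⟶ restrict inZ G) (γ : restrict inY F ⟶ restrict inY G)
    (hβγ : β.toNatTrans.app (mapOver f (idOver A)) ≫ G.map (eqToHom (mapOver_comm h)) =
      F.map (eqToHom (mapOver_comm h)) ≫ γ.toNatTrans.app (mapOver i (idOver A))) :
    ∃ α : F ⟶ G, BasedCategory.whiskerLeft (spaceStackMap inZ) α = β ∧
      BasedCategory.whiskerLeft (spaceStackMap inY) α = γ := by
  obtain ⟨θ, hθ, hθY, hθZ⟩ := hD.exists_hom_of_comm (isHomLift_eqToHom_comp h F)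
    (isHomLift_mapOver f (restrict inZ F)) (isHomLift_mapOver inY F) (isHomLift_mapOver inZ F)
    (point_square h F) (isHomLift_mapOver inY G) (isHomLift_mapOver inZ G) (point_square h G)
    (BasedNatTrans.isHomLift β rfl) (BasedNatTrans.isHomLift γ rfl)
    (β.toNatTrans.naturality (toIdOver (mapOver f (idOver A))))
    (γ.toNatTrans.naturality (toIdOver (mapOver i (idOver A)))) hβγ
  obtain ⟨α, hα⟩ := exists_points_hom hX F G θ hθ
  exact ⟨α, whiskerLeft_eq_of_comp_eq hX α β (by rw [hα]; exact hθZ),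
    whiskerLeft_eq_of_comp_eq hX α γ (by rw [hα]; exact hθY)⟩

/-- Essential surjectivity: glue the values of `b` and `c` at the identities to an object over `U`,
represent it by a point `F`, and obtain the comparisons `β` and `γ` by factoring through the
cartesian morphisms `ζ` and `η`. -/
theorem exists_point_of_restrict (hX : IsFibredInGroupoids 𝒳) (h : i ≫ inY = f ≫ inZ)
    (hD : HasDescent 𝒳 i f inY inZ) (b : BasedFunctor (spaceStack Z) 𝒳)
    (c : BasedFunctor (spaceStack Y) 𝒳) (ι : restrict f b ⟶ restrict i c) :
    ∃ (F : BasedFunctor (spaceStack U) 𝒳) (β : restrict inZ F ⟶ b) (γ : restrict inY F ⟶ c),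
      β.toNatTrans.app (mapOver f (idOver A)) ≫ ι.toNatTrans.app (idOver A) =
        F.map (eqToHom (mapOver_comm h)) ≫ γ.toNatTrans.app (mapOver i (idOver A)) := by
  have hι : 𝒳.p.IsHomLift (𝟙 A) (ι.toNatTrans.app (idOver A)) := BasedNatTrans.isHomLift ι rfl
  obtain ⟨x, η, ζ, hη, hζ, hx⟩ := hD.exists_glue
    (ι.toNatTrans.app (idOver A) ≫ c.map (toIdOver (mapOver i (idOver A))))
    (b.map (toIdOver (mapOver f (idOver A))))
    (@IsHomLift.comp_lift_id_left _ _ _ _ 𝒳.p _ _ _ _ _ i _ (isHomLift_mapOver i c) _ hι)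
    (isHomLift_mapOver f b)
  obtain ⟨F, m, hm⟩ := exists_point hX (IsHomLift.codomain_eq 𝒳.p inY η)
  have hFY := isHomLift_mapOver inY F
  have hFZ := isHomLift_mapOver inZ F
  obtain ⟨βz, hβz, hβζ⟩ := hX.exists_fac inZ ζ (F.map (toIdOver (mapOver inZ (idOver Z))) ≫ m) hζ
    inferInstance
  obtain ⟨γy, hγy, hγη⟩ := hX.exists_fac inY η (F.map (toIdOver (mapOver inY (idOver Y))) ≫ m) hη
    inferInstance
  obtain ⟨β, rfl⟩ := exists_points_hom hX (restrict inZ F) b βz hβz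
  obtain ⟨γ, rfl⟩ := exists_points_hom hX (restrict inY F) c γy hγy
  have he : 𝒳.p.IsHomLift (𝟙 A) (F.map (eqToHom (mapOver_comm h))) := by
    rw [eqToHom_map]
    exact IsHomLift.eqToHom_domain_lift_id _ (F.w_obj _)
  have hsq := congrArg (· ≫ m) (point_square h F)
  simp only [Category.assoc] at hsq
  exact ⟨F, β, γ, hX.comm_of_comm
    (φ := F.map ((spaceStackMap inY).map (toIdOver (mapOver i (idOver A)))))
    (ψ := F.map ((spaceStackMap inZ).map (toIdOver (mapOver f (idOver A)))))
    (by simpa only [Category.assoc] using hsq) hx (isHomLift_mapOver i c) hη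
    he hι (BasedNatTrans.isHomLift β rfl) (BasedNatTrans.isHomLift γ rfl)
    (β.toNatTrans.naturality (toIdOver (mapOver f (idOver A))))
    (γ.toNatTrans.naturality (toIdOver (mapOver i (idOver A)))) hβζ hγη⟩

/-- Descent for a fibred category implies that the square of groupoids of points is 2-cartesian. -/
theorem HasDescent.isTwoCartesianCat (hX : IsFibredInGroupoids 𝒳) (h : i ≫ inY = f ≫ inZ)
    (hD : HasDescent 𝒳 i f inY inZ) :
    IsTwoCartesianCat ((points 𝒳).map inZ.op) ((points 𝒳).map inY.op)
      ((points 𝒳).map f.op) ((points 𝒳).map i.op) (points_square h 𝒳) := by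
  have hiso : ∀ F : BasedFunctor (spaceStack U) 𝒳,
      (show restrict f (restrict inZ F) ⟶ restrict i (restrict inY F) from
        (eqToIso (congrArg Cat.Hom.toFunctor (points_square h 𝒳))).hom.app F).toNatTrans.app
        (idOver A) = F.map (eqToHom (mapOver_comm h)) := fun F => by
    rw [eqToIso.hom, eqToHom_map]
    refine Eq.trans (congrArg (fun α : restrict f (restrict inZ F) ⟶ restrict i (restrict inY F) =>
      α.toNatTrans.app (idOver A)) (eqToHom_app _ F)) ?_
    exact eqToHom_toNatTrans_app _ _
  refine @Functor.IsEquivalence.mk _ _ _ _ _ ⟨?_⟩ ⟨?_⟩ ⟨?_⟩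
  · intro F G α β hαβ
    exact restrict_hom_ext hX h hD
      (congrArg Limits.CategoricalPullback.Hom.fst hαβ)
      (congrArg Limits.CategoricalPullback.Hom.snd hαβ)
  · intro F G g
    have hw := congrArg (fun α : restrict f (restrict inZ F) ⟶ restrict i (restrict inY G) =>
      α.toNatTrans.app (idOver A)) (Limits.CategoricalPullback.Hom.w g)
    obtain ⟨α, h1, h2⟩ := exists_hom_of_restrict hX h hD (F := F) (G := G) g.fst g.snd
      ((congrArg _ (hiso G)).symm.trans (hw.trans (congrArg (· ≫ _) (hiso F))))
    exact ⟨α, Limits.CategoricalPullback.Hom.ext h1 h2⟩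
  · intro x
    obtain ⟨F, β, γ, e⟩ := exists_point_of_restrict hX h hD x.fst x.snd x.iso.hom
    refine ⟨F, ⟨Limits.CategoricalPullback.mkIso (@asIso _ _ _ _ β (isIso_points_hom hX β))
      (@asIso _ _ _ _ γ (isIso_points_hom hX γ)) ?_⟩⟩
    refine points_hom_ext hX ?_
    exact e.trans (congrArg (· ≫ _) (hiso F)).symm

end TwoCartesian

/-! ## Products of gluing squares with a space -/

section Product

theorem compactlyGeneratedSpace_of_compactSpace {X : Type u} [TopologicalSpace X] [CompactSpace X]
    [T2Space X] : CompactlyGeneratedSpace X :=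
  inferInstance

theorem isOpen_of_isOpen_preimage_prodMap {X X' K : Type*} [TopologicalSpace X]
    [TopologicalSpace X'] [TopologicalSpace K] [CompactSpace K] [T2Space K] {q : X' → X}
    (hq : IsQuotientMap q) {W : Set (X × K)} (hW : IsOpen (Prod.map q id ⁻¹' W)) : IsOpen W :=
  isOpen_iff_continuous_mem.2 (hq.continuous_lift_prod_left (isOpen_iff_continuous_mem.1 hW))

theorem Kify.isOpen_of_test {X : Type u} [TopologicalSpace X] {O : Set (Kify X)}
    (h : ∀ (S : CompHaus.{u}) (g : C(S, X)), IsOpen {s | Kify.mk (g s) ∈ O}) : IsOpen O :=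
  UCompactlyGeneratedSpace.isOpen fun S g =>
    h S ⟨fun s => (g s).val, Kify.continuous_val.comp g.continuous⟩

theorem Kify.isClosed_of_test {X : Type u} [TopologicalSpace X] {C : Set (Kify X)}
    (h : ∀ (S : CompHaus.{u}) (g : C(S, X)), IsClosed {s | Kify.mk (g s) ∈ C}) : IsClosed C :=
  UCompactlyGeneratedSpace.isClosed fun S g =>
    h S ⟨fun s => (g s).val, Kify.continuous_val.comp g.continuous⟩

variable {A Y Z U : CGTop.{u}}

/-- Closedness in `Kify` is tested on compact Hausdorff `S`. Since `f` is proper, the fibre product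
`K` of `S` and `A` over `Z` is compact, and the set to be tested is the image in `S` of a closed
subset of `K`. -/
theorem isClosedMap_kProdMap [T2Space A] {f : A ⟶ Z} (hf : IsProperMap f) (T : CGTop.{u}) :
    IsClosedMap (kProdMap (𝟙 T) f) := by
  intro C hC
  refine Kify.isClosed_of_test fun S g => ?_
  have hgr : IsCompact (Set.range fun s : S => (s, (g s).2)) :=
    isCompact_range (by fun_prop)
  have hK := ((isProperMap_id (X := S)).prodMap hf).isCompact_preimage hgr
  set K := Prod.map id f ⁻¹' Set.range fun s : S => (s, (g s).2) with hKdef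
  have : CompactSpace K := isCompact_iff_compactSpace.1 hK
  have : T2Space K := inferInstance
  have : CompactlyGeneratedSpace K := compactlyGeneratedSpace_of_compactSpace
  have hmem : ∀ {s : S} {a : A}, (s, a) ∈ K ↔ f a = (g s).2 := fun {s a} => by
    constructor
    · rintro ⟨s', h⟩
      obtain ⟨rfl, h⟩ := Prod.ext_iff.1 h
      exact h.symm
    · exact fun h => ⟨s, Prod.ext rfl h.symm⟩
  have hcont : Continuous fun x : K => Kify.mk ((g x.1.1).1, x.1.2) :=
    Kify.continuous_lift _ (by fun_prop)
  have := ((hC.preimage hcont).isCompact.image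
    (continuous_fst.comp continuous_subtype_val)).isClosed
  convert this using 1
  ext s
  constructor
  · rintro ⟨⟨t, a⟩, hx, e⟩
    have e1 : t = (g s).1 := congrArg (fun z => z.val.1) e
    have e2 : f a = (g s).2 := congrArg (fun z => z.val.2) e
    subst e1
    exact ⟨⟨(s, a), hmem.2 e2⟩, hx, rfl⟩
  · rintro ⟨⟨⟨s', a⟩, hsa⟩, hx, rfl⟩
    exact ⟨_, hx, Kify.ext (Prod.ext rfl (hmem.1 hsa))⟩

theorem GluingSquare.kProdMap {i : A ⟶ Y} {f : A ⟶ Z} {inY : Y ⟶ U} {inZ : Z ⟶ U}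
    (hG : GluingSquare i f inY inZ) [T2Space A] (hf : IsProperMap f) (T : CGTop.{u}) :
    GluingSquare (kProdMap (𝟙 T) i) (kProdMap (𝟙 T) f) (kProdMap (𝟙 T) inY)
      (kProdMap (𝟙 T) inZ) where
  isClosedEmbedding := .of_continuous_injective_isClosedMap 
    (map_continuous (ConcreteCategory.hom (TopStack.kProdMap (𝟙 T) i)))
    (fun x y h => Kify.ext (Prod.ext (congrArg (fun z => z.val.1) h)
      (hG.isClosedEmbedding.injective (congrArg (fun z => z.val.2) h))))
    (isClosedMap_kProdMap hG.isClosedEmbedding.isProperMap T)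
  isLocalNDR := by
    convert hG.isLocalNDR.preimage_kify (T := T)
    ext x
    constructor
    · rintro ⟨y, rfl⟩
      exact ⟨y.val.2, rfl⟩
    · rintro ⟨a, ha⟩
      exact ⟨⟨(x.val.1, a)⟩, Kify.ext (Prod.ext rfl ha)⟩
  continuous_f := map_continuous (ConcreteCategory.hom (TopStack.kProdMap (𝟙 T) f))
  isClosedMap_f := isClosedMap_kProdMap hf T
  exists_disjoint z := by
    obtain ⟨N, hN, hd⟩ := hG.exists_disjoint z.val.2
    refine ⟨fun x => (fun y => y.val.2) ⁻¹' N x.val.2, fun x hx => ?_, fun x y hx hy hxy => ?_⟩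
    · obtain ⟨h1, h2⟩ := hN x.val.2 (congrArg (fun z => z.val.2) hx)
      exact ⟨h1.preimage (continuous_snd.comp Kify.continuous_val), h2⟩
    · refine (hd _ _ (congrArg (fun z => z.val.2) hx) (congrArg (fun z => z.val.2) hy)
        fun h => hxy (Kify.ext (Prod.ext ?_ h))).preimage _
      exact (congrArg (fun z => z.val.1) (hx.trans hy.symm))
  continuous_inY := map_continuous (ConcreteCategory.hom (TopStack.kProdMap (𝟙 T) inY))
  continuous_inZ := map_continuous (ConcreteCategory.hom (TopStack.kProdMap (𝟙 T) inZ))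
  comm x := Kify.ext (Prod.ext rfl (hG.comm x.val.2))
  exists_rep x := (hG.exists_rep x.val.2).imp
    (fun ⟨y, hy⟩ => ⟨⟨(x.val.1, y)⟩, Kify.ext (Prod.ext rfl hy)⟩)
    (fun ⟨z, hz⟩ => ⟨⟨(x.val.1, z)⟩, Kify.ext (Prod.ext rfl hz)⟩)
  inZ_injective x y h := Kify.ext (Prod.ext (congrArg (fun z => z.val.1) h)
    (hG.inZ_injective (congrArg (fun z => z.val.2) h)))
  inY_eq_inZ {y z} h := by
    obtain ⟨a, h1, h2⟩ := hG.inY_eq_inZ (congrArg (fun z => z.val.2) h)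
    exact ⟨⟨(y.val.1, a)⟩, Kify.ext (Prod.ext rfl h1),
      Kify.ext (Prod.ext (congrArg (fun z => z.val.1) h) h2)⟩
  inY_injOn x hx y hy h := Kify.ext (Prod.ext (congrArg (fun z => z.val.1) h)
    (hG.inY_injOn (fun ⟨a, ha⟩ => hx ⟨⟨(x.val.1, a)⟩, Kify.ext (Prod.ext rfl ha)⟩)
      (fun ⟨a, ha⟩ => hy ⟨⟨(y.val.1, a)⟩, Kify.ext (Prod.ext rfl ha)⟩)
      (congrArg (fun z => z.val.2) h)))
  isOpen_of_preimage {O} hY hZ := by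
    -- The components of the test map are decoupled: `O` is pulled back to `U × S` by `(x, s) ↦ ((g
    -- s).1, x)`. There openness is checked on `Y × S` and `Z × S`, since the product with the
    -- compact `S` preserves quotient maps; `s ↦ ((g s).2, s)` then recovers the test map.
    refine Kify.isOpen_of_test fun S g => ?_
    have hq : IsQuotientMap (Sum.elim inY inZ) := by
      refine (isQuotientMap_iff _).2 ⟨isCoinducing_iff.2 fun s => ⟨fun hs => ?_, fun hs => ?_⟩,
        fun x => ?_⟩
      · exact hG.isOpen_of_preimage (isOpen_sum_iff.1 hs).1 (isOpen_sum_iff.1 hs).2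
      · exact hs.preimage (hG.continuous_inY.sumElim hG.continuous_inZ)
      · rcases hG.exists_rep x with ⟨y, hy⟩ | ⟨z, hz⟩
        exacts [⟨Sum.inl y, hy⟩, ⟨Sum.inr z, hz⟩]
    have hYS : CompactlyGeneratedSpace (Y × S) := compactlyGeneratedSpace_prod_compHaus
    have hZS : CompactlyGeneratedSpace (Z × S) := compactlyGeneratedSpace_prod_compHaus
    have h1 : IsOpen {x : Y × S | Kify.mk ((g x.2).1, inY x.1) ∈ O} :=
      hY.preimage (f := fun x : Y × S => Kify.mk ((g x.2).1, x.1))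
        (Kify.continuous_lift _ (by fun_prop))
    have h2 : IsOpen {x : Z × S | Kify.mk ((g x.2).1, inZ x.1) ∈ O} :=
      hZ.preimage (f := fun x : Z × S => Kify.mk ((g x.2).1, x.1))
        (Kify.continuous_lift _ (by fun_prop))
    have hW : IsOpen {x : U × S | Kify.mk ((g x.2).1, x.1) ∈ O} := by
      refine isOpen_of_isOpen_preimage_prodMap hq ?_
      rw [← Homeomorph.sumProdDistrib.symm.isOpen_preimage, isOpen_sum_iff]
      exact ⟨h1, h2⟩
    exact hW.preimage (f := fun s : S => ((g s).2, s)) (by fun_prop)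

end Product

theorem GluingSquare.comp_homeomorph {A A' Y Z U : Type u} [TopologicalSpace A]
    [TopologicalSpace A'] [TopologicalSpace Y] [TopologicalSpace Z] [TopologicalSpace U]
    {i : A → Y} {f : A → Z} {inY : Y → U} {inZ : Z → U} (hG : GluingSquare i f inY inZ)
    (e : A' ≃ₜ A) : GluingSquare (i ∘ e) (f ∘ e) inY inZ where
  isClosedEmbedding := hG.isClosedEmbedding.comp e.isClosedEmbedding
  isLocalNDR := by
    rw [e.surjective.range_comp]
    exact hG.isLocalNDR
  continuous_f := hG.continuous_f.comp e.continuous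
  isClosedMap_f := hG.isClosedMap_f.comp e.isClosedMap
  exists_disjoint z := by
    obtain ⟨N, hN, hd⟩ := hG.exists_disjoint z
    exact ⟨N ∘ e, fun a => hN (e a), fun a b ha hb hab => hd _ _ ha hb (e.injective.ne hab)⟩
  continuous_inY := hG.continuous_inY
  continuous_inZ := hG.continuous_inZ
  comm a := hG.comm (e a)
  exists_rep := hG.exists_rep
  inZ_injective := hG.inZ_injective
  inY_eq_inZ h := by
    obtain ⟨a, h1, h2⟩ := hG.inY_eq_inZ h
    exact ⟨e.symm a, by simpa using h1, by simpa using h2⟩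
  inY_injOn := by
    rw [e.surjective.range_comp]
    exact hG.inY_injOn
  isOpen_of_preimage := hG.isOpen_of_preimage

/-! ## Pushouts of spaces are gluing squares -/

section Pushout

variable {A Y Z U : CGTop.{u}} {i : A ⟶ Y} {f : A ⟶ Z} {inY : Y ⟶ U} {inZ : Z ⟶ U}

open Classical in
/-- The adjunction space as a set: `Z` together with the points of `Y` outside the image of `A`. -/
noncomputable def adjoinMap (i : A ⟶ Y) (f : A ⟶ Z) : Y → Z ⊕ {y : Y // y ∉ Set.range i} :=
  fun y => if h : ∃ a, i a = y then Sum.inl (f h.choose) else Sum.inr ⟨y, h⟩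

theorem adjoinMap_apply (hi : Function.Injective i) (a : A) :
    adjoinMap i f (i a) = Sum.inl (f a) := by
  have h : ∃ b, i b = i a := ⟨a, rfl⟩
  rw [adjoinMap, dif_pos h, hi h.choose_spec]

theorem adjoinMap_of_notMem {y : Y} (hy : y ∉ Set.range i) :
    adjoinMap i f y = Sum.inr ⟨y, hy⟩ :=
  dif_neg hy

/-- A pushout in the category of spaces has the expected underlying set and topology. -/
theorem exists_adjoin_of_isPushout (hi : Function.Injective i) (hU : IsPushout i f inY inZ) :
    ∃ (d : U → Z ⊕ {y : Y // y ∉ Set.range i}), (∀ y, d (inY y) = adjoinMap i f y) ∧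
      (∀ z, d (inZ z) = Sum.inl z) ∧ (∀ x, Sum.elim inZ (fun y => inY y.1) (d x) = x) ∧
      ∀ O : Set U, IsOpen (inY ⁻¹' O) → IsOpen (inZ ⁻¹' O) → IsOpen O := by
  let q : Y ⊕ Z → Z ⊕ {y : Y // y ∉ Set.range i} := Sum.elim (adjoinMap i f) Sum.inl
  -- A quotient of a compactly generated space is compactly generated, so the adjunction space is an
  -- object of the category in which the pushout is taken.
  let tQ : TopologicalSpace (Z ⊕ {y : Y // y ∉ Set.range i}) := .coinduced q inferInstance
  have hq : @Continuous _ _ _ tQ q := continuous_coinduced_rng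
  have cQ : @CompactlyGeneratedSpace _ tQ :=
    @uCompactlyGeneratedSpace_of_coinduced _ _ _ tQ _ q hq rfl
  let Q : CGTop.{u} := @CompactlyGenerated.of _ tQ cQ
  let qY : Y ⟶ Q := CompactlyGenerated.ofHom ⟨adjoinMap i f, hq.comp continuous_inl⟩
  let qZ : Z ⟶ Q := CompactlyGenerated.ofHom ⟨Sum.inl, hq.comp continuous_inr⟩
  have hsq : i ≫ qY = f ≫ qZ := by
    ext a
    exact adjoinMap_apply hi a
  have hcomm : ∀ a, inY (i a) = inZ (f a) := fun a => ConcreteCategory.congr_hom hU.w a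
  have hY : ∀ y, Sum.elim inZ (fun y : {y : Y // y ∉ Set.range i} => inY y.1)
      (adjoinMap i f y) = inY y := fun y => by
    by_cases hy : y ∈ Set.range i
    · obtain ⟨a, rfl⟩ := hy
      rw [adjoinMap_apply hi]
      exact (hcomm a).symm
    · rw [adjoinMap_of_notMem hy]
      rfl
  have he : Continuous[tQ, _] (Sum.elim inZ fun y => inY y.1) := by
    rw [continuous_coinduced_dom]
    refine continuous_sum_dom.2 ⟨?_, map_continuous (ConcreteCategory.hom inZ)⟩
    convert map_continuous (ConcreteCategory.hom inY) using 1
    exact funext hY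
  let e : Q ⟶ U := CompactlyGenerated.ofHom ⟨Sum.elim inZ fun y => inY y.1, he⟩
  -- This one composite is enough: the map from `U` to the adjunction space has a continuous left
  -- inverse, so points and open sets of `U` are controlled by those of the adjunction space.
  have hde : hU.desc qY qZ hsq ≫ e = 𝟙 U := by
    refine hU.hom_ext ?_ ?_
    · rw [hU.inl_desc_assoc, Category.comp_id]
      ext y
      exact hY y
    · rw [hU.inr_desc_assoc, Category.comp_id]
      rfl
  have hde' : ∀ x, e (hU.desc qY qZ hsq x) = x := fun x => ConcreteCategory.congr_hom hde x
  refine ⟨hU.desc qY qZ hsq, fun y => ConcreteCategory.congr_hom (hU.inl_desc qY qZ hsq) y,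
    fun z => ConcreteCategory.congr_hom (hU.inr_desc qY qZ hsq) z, hde', fun O hOY hOZ => ?_⟩
  have hO : IsOpen[tQ] (e ⁻¹' O) := by
    rw [isOpen_coinduced, isOpen_sum_iff]
    refine ⟨?_, hOZ⟩
    convert hOY using 1
    ext y
    exact iff_of_eq (congrArg (· ∈ O) (hY y))
  have := hO.preimage (map_continuous (ConcreteCategory.hom (hU.desc qY qZ hsq)))
  convert this using 1
  ext x
  exact iff_of_eq (congrArg (· ∈ O) (hde' x).symm)

theorem gluingSquare_of_isPushout [T2Space Y] (hi : IsClosedEmbedding i)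
    (hloc : IsLocalCofibration i) (hf : IsProperMap f) (hfin : ∀ z : Z, (f ⁻¹' {z}).Finite)
    (hU : IsPushout i f inY inZ) : GluingSquare i f inY inZ := by
  obtain ⟨d, hdY, hdZ, hd, hO⟩ := exists_adjoin_of_isPushout hi.injective hU
  exact
  { isClosedEmbedding := hi
    isLocalNDR := isLocalNDR_of_isLocalCofibration hi hloc
    continuous_f := hf.continuous
    isClosedMap_f := hf.isClosedMap
    exists_disjoint := fun z => by
      obtain ⟨N, hN, hdis⟩ := ((hfin z).image i).t2_separation
      exact ⟨fun a => N (i a), fun a _ => ⟨(hN _).2, (hN _).1⟩, fun a b ha hb hab =>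
        hdis ⟨a, ha, rfl⟩ ⟨b, hb, rfl⟩ (hi.injective.ne hab)⟩
    continuous_inY := map_continuous (ConcreteCategory.hom inY)
    continuous_inZ := map_continuous (ConcreteCategory.hom inZ)
    comm := fun a => ConcreteCategory.congr_hom hU.w a
    exists_rep := fun x => by
      rw [← hd x]
      rcases d x with z | y
      exacts [Or.inr ⟨z, rfl⟩, Or.inl ⟨y, rfl⟩]
    inZ_injective := fun z z' h => Sum.inl_injective
      ((hdZ z).symm.trans ((congrArg d h).trans (hdZ z')))
    inY_eq_inZ := fun {y z} h => by
      have h1 := (hdY y).symm.trans ((congrArg d h).trans (hdZ z))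
      by_cases hy : y ∈ Set.range i
      · obtain ⟨a, rfl⟩ := hy
        rw [adjoinMap_apply hi.injective] at h1
        exact ⟨a, rfl, Sum.inl_injective h1⟩
      · rw [adjoinMap_of_notMem hy] at h1
        cases h1
    inY_injOn := fun y hy y' hy' h => by
      have h1 := (hdY y).symm.trans ((congrArg d h).trans (hdY y'))
      rw [adjoinMap_of_notMem hy, adjoinMap_of_notMem hy'] at h1
      exact congrArg Subtype.val (Sum.inr_injective h1)
    isOpen_of_preimage := fun {O} => hO O }

end Pushout

/-! ## The figure eight -/

section FigureEight

instance : T2Space circle.{u} := inferInstanceAs (T2Space (ULift.{u} UnitAddCircle))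

/-- The inclusion of the base point in the circle. -/
def circlePoint : CompactlyGenerated.of PUnit.{u + 1} ⟶ circle.{u} :=
  CompactlyGenerated.ofHom ⟨fun _ => circleBase, continuous_const⟩

theorem isClosedEmbedding_circlePoint : IsClosedEmbedding circlePoint.{u} :=
  .of_continuous_injective_isClosedMap continuous_const (fun _ _ _ => rfl)
    (Continuous.isClosedMap (X := PUnit.{u + 1}) continuous_const)

theorem range_circlePoint : Set.range circlePoint.{u} = {circleBase} :=
  Set.range_const

/-- The circle contracts to its base point away from the antipode. -/
theorem isLocalNDR_circleBase : IsLocalNDR ({circleBase} : Set circle.{u}) := by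
  rintro _ rfl
  let e := AddCircle.openPartialHomeomorphCoe (1 : ℝ) (-1 / 2)
  let V : Set circle.{u} := ULift.down ⁻¹' e.target
  have hV : IsOpen V := e.open_target.preimage continuous_uliftDown
  let r : V → ℝ := fun x => e.symm x.1.down
  have hr : Continuous r := e.continuousOn_symm.comp_continuous
    (continuous_uliftDown.comp continuous_subtype_val) fun x => x.2
  have hr' : ∀ x, |r x| ≤ 1 := fun x => by
    have h := e.map_target x.2
    change r x ∈ Set.Ioo (-1 / 2 : ℝ) (-1 / 2 + 1) at h
    rw [abs_le]
    constructor <;> linarith [h.1, h.2]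
  have her : ∀ x : V, ((r x : ℝ) : UnitAddCircle) = x.1.down := fun x => e.right_inv x.2
  have h0 : (0 : ℝ) ∈ e.source := by
    change (0 : ℝ) ∈ Set.Ioo (-1 / 2 : ℝ) (-1 / 2 + 1)
    norm_num
  have hb : circleBase.{u} ∈ V := e.map_source h0
  have hrb : ∀ x : V, (x : circle.{u}) ∈ ({circleBase} : Set circle.{u}) → r x = 0 := by
    rintro ⟨_, hx⟩ rfl
    exact e.left_inv h0
  -- In the coordinate `r`, with values between `-1/2` and `1/2`, a point moves to `0` at unit
  -- speed: `r` minus its truncation to `[-t, t]`. It arrives at time `|r|`.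
  refine ⟨V, ⟨fun x => ⟨|r x|, abs_nonneg _, hr' x⟩, by fun_prop⟩,
    ⟨fun x => ULift.up ((r x.1 - max (-(x.2 : ℝ)) (min (r x.1) x.2) : ℝ) : UnitAddCircle),
      continuous_uliftUp.comp ((AddCircle.continuous_mk' 1).comp (by fun_prop))⟩,
    hV, hb, fun x => ?_, fun x hx => ⟨?_, fun t => ?_⟩, fun x => ?_⟩
  · refine ULift.ext _ _ ((congrArg ((↑) : ℝ → UnitAddCircle) ?_).trans (her x))
    change r x - max (-(0 : ℝ)) (min (r x) 0) = r x
    simp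
  · refine Subtype.ext ?_
    change |r x| = 0
    rw [hrb x hx, abs_zero]
  · refine ULift.ext _ _ ((congrArg ((↑) : ℝ → UnitAddCircle) ?_).trans (her x))
    change r x - max (-(t : ℝ)) (min (r x) t) = r x
    rw [hrb x hx, min_eq_left t.2.1, max_eq_right (neg_nonpos.2 t.2.1), sub_zero]
  · refine ULift.ext _ _ ((congrArg ((↑) : ℝ → UnitAddCircle) ?_).trans (AddCircle.coe_zero 1))
    change r x - max (-|r x|) (min (r x) |r x|) = 0
    rw [min_eq_left (le_abs_self _), max_eq_right (neg_abs_le _), sub_self]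

/-- The map from the figure eight which folds the two circles by the pointed maps `a` and `b`. -/
def figureEightDesc (a b : circle.{u} → circle.{u}) (h : a circleBase = b circleBase) :
    figureEight.{u} → circle.{u} :=
  Quotient.lift (Sum.elim a b) fun x y hxy => by
    induction hxy with
    | rel x y hxy =>
      obtain ⟨rfl, rfl⟩ := hxy
      exact h
    | refl => rfl
    | symm _ _ _ ih => exact ih.symm
    | trans _ _ _ _ _ ih ih' => exact ih.trans ih'

/-- Maps back to the circle detect the identifications: the fold restricts to the identity on both
circles, and collapsing either circle shows that they meet only in the base point. -/
theorem gluingSquare_figureEight :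
    GluingSquare circlePoint.{u} circlePoint.{u} rightCircle.{u} leftCircle.{u} where
  isClosedEmbedding := isClosedEmbedding_circlePoint
  isLocalNDR := by
    rw [range_circlePoint]
    exact isLocalNDR_circleBase
  continuous_f := isClosedEmbedding_circlePoint.continuous
  isClosedMap_f := isClosedEmbedding_circlePoint.isClosedMap
  exists_disjoint _ := ⟨fun _ => Set.univ, fun _ _ => ⟨isOpen_univ, trivial⟩,
    fun _ _ _ _ h => (h rfl).elim⟩
  continuous_inY := map_continuous (ConcreteCategory.hom rightCircle)
  continuous_inZ := map_continuous (ConcreteCategory.hom leftCircle)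
  comm _ := leftCircle_base.symm
  exists_rep x := by
    obtain ⟨z | y, rfl⟩ := Quotient.exists_rep x
    exacts [Or.inr ⟨z, rfl⟩, Or.inl ⟨y, rfl⟩]
  inZ_injective _ _ h := congrArg (figureEightDesc id id rfl) h
  inY_eq_inZ {y z} h := ⟨⟨⟩, congrArg (figureEightDesc (fun _ => circleBase) id rfl) h.symm,
    congrArg (figureEightDesc id (fun _ => circleBase) rfl) h⟩
  inY_injOn _ _ _ _ h := congrArg (figureEightDesc id id rfl) h
  isOpen_of_preimage hY hZ := isOpen_coinduced.2 (isOpen_sum_iff.2 ⟨hZ, hY⟩)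

/-- The product of `T` with a point. -/
def kProdPUnit (T : CGTop.{u}) : T ≃ₜ kProd T (CompactlyGenerated.of PUnit.{u + 1}) where
  toFun t := ⟨(t, ⟨⟩)⟩
  invFun x := x.val.1
  left_inv _ := rfl
  right_inv _ := rfl
  continuous_toFun := Kify.continuous_lift _ (by fun_prop)
  continuous_invFun := continuous_fst.comp Kify.continuous_val

theorem gluingSquare_kProd_figureEight (T : CGTop.{u}) :
    GluingSquare ((sliceAt circleBase.{u}).app T) ((sliceAt circleBase.{u}).app T)
      (kProdMap (𝟙 T) rightCircle.{u}) (kProdMap (𝟙 T) leftCircle.{u}) :=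
  have : T2Space (CompactlyGenerated.of PUnit.{u + 1}) := inferInstanceAs (T2Space PUnit.{u + 1})
  (gluingSquare_figureEight.kProdMap isClosedEmbedding_circlePoint.isProperMap T).comp_homeomorph
    (kProdPUnit T)

end FigureEight

end TopStack


theorem corollaryL :
    (∀ {A Y Z U : CGTop.{u}} (i : A ⟶ Y) (f : A ⟶ Z) (inY : Y ⟶ U) (inZ : Z ⟶ U)
        [T2Space Y] [T2Space Z],
        IsClosedEmbedding i → IsLocalCofibration i →
        IsProperMap f → (∀ z : Z, (f ⁻¹' {z}).Finite) →
        ∀ hU : IsPushout i f inY inZ,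
        ∀ 𝒳 : BasedCategory.{v, w} CGTop.{u}, IsTopologicalStack 𝒳 →
          IsTwoCartesianCat ((points 𝒳).map inZ.op) ((points 𝒳).map inY.op)
            ((points 𝒳).map f.op) ((points 𝒳).map i.op) (points_square hU.w 𝒳) ∧
          IsTwoCartesian (mappingStackMap inZ 𝒳) (mappingStackMap inY 𝒳)
            (mappingStackMap f 𝒳) (mappingStackMap i 𝒳) (mappingStack_square hU.w 𝒳)) ∧
    (∀ 𝒳 : BasedCategory.{v, w} CGTop.{u}, IsTopologicalStack 𝒳 →
      IsTwoCartesian (mappingStackMap leftCircle 𝒳) (mappingStackMap rightCircle 𝒳)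
        (evalAt circleBase 𝒳) (evalAt circleBase 𝒳) (figureEight_square 𝒳)) := by
  refine ⟨fun {A Y Z U} i f inY inZ _ _ hi hloc hf hfin hU 𝒳 hX => ?_, fun 𝒳 hX T => ?_⟩
  · have hG := gluingSquare_of_isPushout hi hloc hf hfin hU
    have : T2Space A := hi.isEmbedding.t2Space
    refine ⟨(hX.hasDescent hG).isTwoCartesianCat hX.isFibredInGroupoids hU.w, fun T => ?_⟩
    -- The `T`-points of the mapping stacks are points of `𝒳` on the square multiplied by `T`.
    exact (hX.hasDescent (hG.kProdMap hf T.unop)).isTwoCartesianCat hX.isFibredInGroupoids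
      (congrArg (fun g => kProdMap (𝟙 T.unop) g) hU.w)
  · exact (hX.hasDescent (gluingSquare_kProd_figureEight T.unop)).isTwoCartesianCat
      hX.isFibredInGroupoids
      (congrArg (fun y : figureEight => (sliceAt y).app T.unop) leftCircle_base.symm)
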